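/- **Setting.** An instance of the connected min-sum-radii problem consists of a finite vertex set $V$, a metric $d$ on $V$, an integer $k \ge 2$ and an undirected connectivity graph $G = (V,E)$, where $d$ and $G$ need not be related. A feasible solution is a partition of $V$ into $k$ disjoint clusters $P_1,\dots,P_k$ with centers $c_1,\dots,c_k$ such that, for every $i$, $c_i \in P_i$ and the subgraph of $G$ induced by $P_i$ is connected. Its cost is $\sum_{i=1}^{k} \max_{v \in P_i} d(v,c_i)$. For algorithmic purposes the distances are non-negative rational numbers; an instance is given by $n = |V|$, $k$, the adjacency matrix of $G$ and the matrices of numerators and denominators of the distances, all integers being written in binary. **Theorem.** For every real $\varepsilon > 0$ there is an algorithm (which may depend on $\varepsilon$) that, on every instance of the connected min-sum-radii problem, halts after a number of steps that is bounded by a polynomial (which may depend on $\varepsilon$) in the encoding length of the instance, and that, on every instance which has a feasible solution, outputs a feasible solution whose cost is at most $(3+\varepsilon)$ times the minimum cost of a feasible solution. Here an algorithm is a program of a random access machine with integer cells and indirect addressing, in which constants, memory accesses, additions, subtractions and sign tests take one step each and a multiplication or division takes as many steps as its operands have bits, plus one. Polynomial time in this model is the same as polynomial time on Turing machines. -/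

import Mathlib

/-! ## Connected clustering with the min-sum-radii objective -/

namespace ConnectedMSR

/-- A feasible solution: a partition of `V` into `k` clusters `P i = {v | label v = i}` together
with a center of each cluster that belongs to the cluster, such that every cluster induces a
connected subgraph of the connectivity graph `G`. -/
structure Solution {V : Type*} (G : SimpleGraph V) (k : ℕ) where
  label : V → Fin k
  center : Fin k → V
  center_mem : ∀ i, label (center i) = i
  connected : ∀ i, (G.induce {v | label v = i}).Connected

/-- The radius `max_{v ∈ P i} d(v, c i)` of cluster `i` (the cluster is nonempty and distances are
nonnegative, so the supremum in `ℚ≥0` is this maximum). -/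
def Solution.radius {V : Type*} [Fintype V] {G : SimpleGraph V} {k : ℕ}
    (S : Solution G k) (d : V → V → ℚ≥0) (i : Fin k) : ℚ≥0 :=
  (Finset.univ.filter fun v => S.label v = i).sup fun v => d v (S.center i)

/-- The min-sum-radii objective. -/
def Solution.cost {V : Type*} [Fintype V] {G : SimpleGraph V} {k : ℕ}
    (S : Solution G k) (d : V → V → ℚ≥0) : ℚ≥0 :=
  ∑ i, S.radius d i

/-- An instance: the vertices are `0, …, n - 1`, and the distances are rational, so that an
instance can be written down. The graph and the metric are not related in any way. -/
structure Instance where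
  n : ℕ
  k : ℕ
  two_le_k : 2 ≤ k
  G : SimpleGraph (Fin n)
  d : Fin n → Fin n → ℚ≥0
  d_eq_zero : ∀ u v, d u v = 0 ↔ u = v
  d_symm : ∀ u v, d u v = d v u
  d_triangle : ∀ u v w, d u w ≤ d u v + d v w

open Classical in
/-- The word of integers that describes an instance: `n`, `k`, the adjacency matrix, the numerators
of the distances and their denominators (each matrix row by row: entry `(u, v)` is at position
`n * u + v` of its block). -/
noncomputable def Instance.encode (I : Instance) : List ℤ :=
  [(I.n : ℤ), (I.k : ℤ)]
    ++ List.ofFn (fun j : Fin (I.n * I.n) => if I.G.Adj j.divNat j.modNat then (1 : ℤ) else 0)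
    ++ List.ofFn (fun j : Fin (I.n * I.n) => ((I.d j.divNat j.modNat).num : ℤ))
    ++ List.ofFn (fun j : Fin (I.n * I.n) => ((I.d j.divNat j.modNat).den : ℤ))

/-- The word of integers that describes a solution: the cluster of each vertex, then the center of
each cluster. -/
def Solution.encode {n k : ℕ} {G : SimpleGraph (Fin n)} (S : Solution G k) : List ℤ :=
  List.ofFn (fun v => (((S.label v : Fin k) : ℕ) : ℤ))
    ++ List.ofFn (fun i => (((S.center i : Fin n) : ℕ) : ℤ))

end ConnectedMSR

/-! ## Random access machines -/

namespace RAM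

/-- The length of `z` in binary. -/
def bitLength (z : ℤ) : ℕ := z.natAbs.size

/-- The encoding length of a word of integers written in binary (one extra symbol for each entry,
for its sign and separator). -/
def size (w : List ℤ) : ℕ := (w.map fun z => bitLength z + 1).sum

/-- The memory: arrays `0, 1, 2, …` of integer cells. A program mentions only finitely many
arrays. -/
abbrev Memory := ℕ → ℤ → ℤ

/-- Expressions; `load a i` is cell `i` of array `a`, where the address `i` is itself computed. -/
inductive Expr where
  | const (c : ℤ)
  | load (a : ℕ) (i : Expr)
  | add (e f : Expr)
  | sub (e f : Expr)
  | mul (e f : Expr)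
  | div (e f : Expr)

def Expr.val (m : Memory) : Expr → ℤ
  | .const c => c
  | .load a i => m a (i.val m)
  | .add e f => e.val m + f.val m
  | .sub e f => e.val m - f.val m
  | .mul e f => e.val m * f.val m
  | .div e f => e.val m / f.val m

/-- The number of steps to evaluate an expression. A constant, a memory access, an addition and a
subtraction take one step, but a multiplication or division takes as many steps as its operands
have bits (plus one). Hence a run of `t` steps on input of encoding length `s` only produces
integers of bit length `O(s + t)`, and polynomial time here is polynomial time on Turing
machines. -/
def Expr.steps (m : Memory) : Expr → ℕ
  | .const _ => 1
  | .load _ i => i.steps m + 1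
  | .add e f => e.steps m + f.steps m + 1
  | .sub e f => e.steps m + f.steps m + 1
  | .mul e f => e.steps m + f.steps m + bitLength (e.val m) + bitLength (f.val m) + 1
  | .div e f => e.steps m + f.steps m + bitLength (e.val m) + bitLength (f.val m) + 1

/-- Programs: `store a i e` writes `e` to cell `i` of array `a`; `ifPos e p q` runs `p` if `0 < e`
and `q` otherwise; `whilePos e p` repeats `p` as long as `0 < e`. -/
inductive Program where
  | skip
  | store (a : ℕ) (i e : Expr)
  | seq (p q : Program)
  | ifPos (e : Expr) (p q : Program)
  | whilePos (e : Expr) (p : Program)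

/-- Writing `x` to cell `i` of array `a`. -/
def Memory.write (m : Memory) (a : ℕ) (i x : ℤ) : Memory :=
  fun b j => if b = a ∧ j = i then x else m b j

/-- `Exec p m t m'`: started in memory `m`, the program `p` halts after `t` steps in memory `m'`. -/
inductive Exec : Program → Memory → ℕ → Memory → Prop where
  | skip (m : Memory) : Exec .skip m 1 m
  | store (m : Memory) (a : ℕ) (i e : Expr) :
      Exec (.store a i e) m (i.steps m + e.steps m + 1) (m.write a (i.val m) (e.val m))
  | seq {p q : Program} {m m' m'' : Memory} {t t' : ℕ} :
      Exec p m t m' → Exec q m' t' m'' → Exec (.seq p q) m (t + t') m''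
  | if_pos {e : Expr} {p q : Program} {m m' : Memory} {t : ℕ} :
      0 < e.val m → Exec p m t m' → Exec (.ifPos e p q) m (e.steps m + 1 + t) m'
  | if_not_pos {e : Expr} {p q : Program} {m m' : Memory} {t : ℕ} :
      ¬ 0 < e.val m → Exec q m t m' → Exec (.ifPos e p q) m (e.steps m + 1 + t) m'
  | while_pos {e : Expr} {p : Program} {m m' m'' : Memory} {t t' : ℕ} :
      0 < e.val m → Exec p m t m' → Exec (.whilePos e p) m' t' m'' →
      Exec (.whilePos e p) m (e.steps m + 1 + t + t') m''
  | while_not_pos {e : Expr} {p : Program} {m : Memory} :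
      ¬ 0 < e.val m → Exec (.whilePos e p) m (e.steps m + 1) m

/-- Programs are deterministic: the halting time and the final memory are unique. -/
theorem Exec.unique {p : Program} {m m₁ m₂ : Memory} {t₁ t₂ : ℕ}
    (h₁ : Exec p m t₁ m₁) (h₂ : Exec p m t₂ m₂) : t₁ = t₂ ∧ m₁ = m₂ := by
  induction h₁ generalizing t₂ m₂ with
  | skip => cases h₂; exact ⟨rfl, rfl⟩
  | store => cases h₂; exact ⟨rfl, rfl⟩
  | seq _ _ ih ih' =>
    cases h₂ with
    | seq k k' =>
      obtain ⟨rfl, rfl⟩ := ih k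
      obtain ⟨rfl, rfl⟩ := ih' k'
      exact ⟨rfl, rfl⟩
  | if_pos h _ ih =>
    cases h₂ with
    | if_pos _ k => obtain ⟨rfl, rfl⟩ := ih k; exact ⟨rfl, rfl⟩
    | if_not_pos h' _ => exact absurd h h'
  | if_not_pos h _ ih =>
    cases h₂ with
    | if_pos h' _ => exact absurd h' h
    | if_not_pos _ k => obtain ⟨rfl, rfl⟩ := ih k; exact ⟨rfl, rfl⟩
  | while_pos h _ _ ih ih' =>
    cases h₂ with
    | while_pos _ k k' =>
      obtain ⟨rfl, rfl⟩ := ih k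
      obtain ⟨rfl, rfl⟩ := ih' k'
      exact ⟨rfl, rfl⟩
    | while_not_pos h' => exact absurd h h'
  | while_not_pos h =>
    cases h₂ with
    | while_pos h' _ _ => exact absurd h' h
    | while_not_pos _ => exact ⟨rfl, rfl⟩

/-- The initial memory for the input word `w`: array `0` holds the length of `w` in cell `0` and
the entries of `w` in cells `1, …, w.length`; all other cells hold `0`. -/
def input (w : List ℤ) : Memory :=
  fun a i => if a = 0 then
    (if i = 0 then (w.length : ℤ) else if 0 < i then w.getD (i - 1).toNat 0 else 0) else 0

/-- The output word, read from array `1` in the same format. -/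
def output (m : Memory) : List ℤ :=
  List.ofFn fun j : Fin (m 1 0).toNat => m 1 ((j : ℕ) + 1)

end RAM

set_option linter.unusedSectionVars false

namespace ConnectedMSR

/-! ### Centers of connected families of sets that pack well. -/

section CenterLemma

variable {V ι : Type*}

/-! The algorithm is a primal-dual method whose objects are connected balls (`pball`): the vertices
reachable from a center without leaving a ball around it. Every cluster of a solution lies in the
connected ball given by its center and its farthest vertex. The `L` largest clusters of an optimal
solution are guessed in this form by enumeration, which takes polynomially many trials for fixed
`L`. All other optimal clusters then have radius at most the least guessed radius `ρ ≤ OPT / L`.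
Distances are rescaled to integers of polynomial size and rounded up, so that dual values can be
raised one unit at a time.

A class of vertices is free if it contains no guessed ball. In each round the label of every free
class raises its dual value `α` by one, and the price `lam` of a cluster grows by one too. When the
duals in a ball `S` of radius at most `ρ` reach `d S + lam`, all classes that meet it are merged. Up
to a small additive error the duals stay feasible, so summing over the `K = k - L` small optimal
clusters bounds `∑ α` by their radii plus `K * lam` (`PDState.sum_le`). Merging stops as soon as
exactly `K` free classes are left. They are credited with `K * lam` in total, so the two terms
cancel (`PDState.centers`). The merge that is interrupted in this way costs a further `3 * ρ`.

The factor three comes from covering each class by a ball around one of its own vertices. The tight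
balls that created a class form a connected family. The invariant `Spanned` says that multiplicities
covering each vertex at most twice have total radius at most `2 * A`, where `A` is the dual value of
the class minus its price. `exists_center_of_packing` derives a center of radius `3 * A`. If every
center failed, a long shortest path in the intersection graph (the spine) and a shortest path from
it to a point far from the middle of the spine (the branch) would together violate the packing
bound.

In total the cost is at most `(3 + 3 / L + 9 / C) * OPT`, where `C` governs the precision of the
rescaling. If there are fewer than `k` classes, vertices are split off as singletons in an order
that keeps the remaining classes connected (`Candidate.exists_solution`). For the running time the
method is written with bounded loops. Multiplications and divisions occur only while the input is
read and tabulated, so the length of the integers is easily controlled. -/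

theorem exists_geodesic {H : SimpleGraph ι} (hH : H.Connected) (u v : ι) :
    ∃ s : ℕ → ι, s 0 = u ∧ s (H.dist u v) = v ∧ (∀ i < H.dist u v, H.Adj (s i) (s (i + 1))) ∧
      ∀ i ≤ H.dist u v, H.dist u (s i) ≤ i ∧ H.dist (s i) v + i ≤ H.dist u v := by
  obtain ⟨p, hp⟩ := hH.exists_walk_length_eq_dist u v
  refine ⟨p.getVert, p.getVert_zero, by rw [← hp]; exact p.getVert_length, fun i hi =>
    p.adj_getVert_succ (by omega), fun i hi => ⟨?_, ?_⟩⟩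
  · have := SimpleGraph.dist_le (p.take i)
    rw [SimpleGraph.Walk.take_length] at this
    omega
  · have := SimpleGraph.dist_le (p.drop i)
    rw [SimpleGraph.Walk.drop_length] at this
    omega

/-- Each set that is traversed costs at most its diameter `2 * rad`. Prefix sums stand on both sides
so that no natural subtraction is needed. -/
theorem chain_dist_le {d : V → V → ℕ} (tri : ∀ u v w, d u w ≤ d u v + d v w) {C : ι → Set V}
    {rad : ι → ℕ} (hdiam : ∀ S, ∀ u ∈ C S, ∀ v ∈ C S, d u v ≤ 2 * rad S) (s : ℕ → ι) {a b : ℕ}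
    (hab : a ≤ b) (hs : ∀ j, a ≤ j → j < b → (C (s j) ∩ C (s (j + 1))).Nonempty) :
    ∀ p ∈ C (s a), ∀ q ∈ C (s b),
      d p q + 2 * ∑ t ∈ Finset.range a, rad (s t) ≤ 2 * ∑ t ∈ Finset.range (b + 1), rad (s t) := by
  induction b, hab using Nat.le_induction with
  | base =>
    intro p hp q hq
    have := hdiam _ p hp q hq
    rw [Finset.sum_range_succ]
    omega
  | succ b hab ih =>
    intro p hp q hq
    obtain ⟨z, hz, hz'⟩ := hs b hab (by omega)
    have h1 := ih (fun j h h' => hs j h (by omega)) p hp z hz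
    have h2 := hdiam _ z hz' q hq
    have h3 := tri p z q
    rw [Finset.sum_range_succ _ (b + 1)]
    omega

/-- Sets at distance two or more along a shortest path of the intersection graph are disjoint, so
the indices of the sets that contain a given point satisfy this hypothesis. -/
theorem card_le_two_of_close (J : Finset ℕ) (h : ∀ i ∈ J, ∀ j ∈ J, j ≤ i + 1) : J.card ≤ 2 := by
  rcases J.eq_empty_or_nonempty with rfl | hJ
  · simp
  · have : J ⊆ {J.min' hJ, J.min' hJ + 1} := by
      intro j hj
      have h1 := J.min'_le j hj
      have h2 := h _ (J.min'_mem hJ) j hj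
      simp only [Finset.mem_insert, Finset.mem_singleton]
      omega
    exact (Finset.card_le_card this).trans Finset.card_le_two

/-- Converts a sum along a path into a sum over the family, weighted with the number of visits. This
is the shape in which packings are tested. -/
theorem sum_count_mul [Fintype ι] [DecidableEq ι] (J : Finset ℕ) (s : ℕ → ι) (g : ι → ℕ) :
    ∑ S, (∑ j ∈ J, if s j = S then 1 else 0) * g S = ∑ j ∈ J, g (s j) := by
  simp_rw [Finset.sum_mul]
  rw [Finset.sum_comm]
  refine Finset.sum_congr rfl fun j _ => ?_
  simp

open Classical in
/-- A connected family of sets, in which every subfamily covering each point at most twice has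
total radius at most `2 * A`, is contained in a ball of radius `3 * A` around one of its centers. -/
theorem exists_center_of_packing [Fintype ι] (d : V → V → ℕ)
    (symm : ∀ u v, d u v = d v u) (tri : ∀ u v w, d u w ≤ d u v + d v w)
    (C : ι → Set V) (cen : ι → V) (rad : ι → ℕ)
    (hC : ∀ S, ∀ v ∈ C S, d (cen S) v ≤ rad S) (A : ℕ)
    (pack : ∀ φ : ι → ℕ, (∀ v, ∑ S, φ S * (if v ∈ C S then 1 else 0) ≤ 2) →
      ∑ S, φ S * rad S ≤ 2 * A)
    (H : SimpleGraph ι) (hH : H.Connected)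
    (hadj : ∀ S T, H.Adj S T ↔ S ≠ T ∧ (C S ∩ C T).Nonempty) :
    ∃ T, ∀ S, ∀ v ∈ C S, d (cen T) v ≤ 3 * A := by
  by_contra hbad
  push Not at hbad
  have hdiam : ∀ S, ∀ u ∈ C S, ∀ v ∈ C S, d u v ≤ 2 * rad S := by
    intro S u hu v hv
    have h1 := hC S u hu
    have h2 := hC S v hv
    have h3 := tri u (cen S) v
    rw [symm u (cen S)] at h3
    omega
  have hmeet : ∀ S T, (C S ∩ C T).Nonempty → H.dist S T ≤ 1 := by
    intro S T h
    by_cases hST : S = T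
    · subst hST; simp
    · exact (SimpleGraph.dist_eq_one_iff_adj.2 ((hadj S T).2 ⟨hST, h⟩)).le
  have hdtri : ∀ S T U, H.dist S U ≤ H.dist S T + H.dist T U := fun S T U => hH.dist_triangle
  -- A single set taken with multiplicity two is an admissible packing.
  have hrad : ∀ S, rad S ≤ A := by
    intro S
    have := pack (fun T => if T = S then 2 else 0) (fun v => by
      simp only [ite_mul, zero_mul, Finset.sum_ite_eq', Finset.mem_univ, if_true]
      split_ifs <;> simp)
    simp only [ite_mul, zero_mul, Finset.sum_ite_eq', Finset.mem_univ, if_true] at this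
    omega
  have : Nonempty ι := hH.nonempty
  -- The spine starts at a set of largest radius. This makes the spine longer by `rad T₀` in `hM`,
  -- and bounds the gap between consecutive centers by `2 * rad T₀`.
  obtain ⟨T₀, -, hT₀⟩ := Finset.exists_max_image (Finset.univ : Finset ι) rad Finset.univ_nonempty
  replace hT₀ : ∀ S, rad S ≤ rad T₀ := fun S => hT₀ S (Finset.mem_univ S)
  obtain ⟨W, v₀, hv₀, hfar⟩ := hbad T₀
  obtain ⟨s, hs0, hsl, hsadj, hsdist⟩ := exists_geodesic hH T₀ W
  set l := H.dist T₀ W with hl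
  have hsmeet : ∀ j < l, (C (s j) ∩ C (s (j + 1))).Nonempty :=
    fun j hj => ((hadj _ _).1 (hsadj j hj)).2
  have hsclose : ∀ i ≤ l, ∀ j ≤ l, (C (s i) ∩ C (s j)).Nonempty → j ≤ i + 1 := by
    intro i hi j hj h
    have h1 := hmeet _ _ h
    have h2 := (hsdist i hi).1
    have h3 := (hsdist j hj).2
    have h4 := hdtri T₀ (s i) W
    have h5 := hdtri (s i) (s j) W
    omega
  -- `2 * P j` bounds the length of the spine before its member `j`, and `2 * P j + rad (s j)`
  -- serves as the position of the center of that member.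
  set P : ℕ → ℕ := fun j => ∑ t ∈ Finset.range j, rad (s t) with hP
  have hPs : ∀ j, P (j + 1) = P j + rad (s j) := fun j => Finset.sum_range_succ _ _
  have hP0 : P 0 = 0 := rfl
  have hPmono : Monotone P := monotone_nat_of_le_succ fun j => by rw [hPs]; omega
  have hchain : ∀ a b, a ≤ b → b ≤ l → ∀ p ∈ C (s a), ∀ q ∈ C (s b),
      d p q + 2 * P a ≤ 2 * P (b + 1) := fun a b hab hb =>
    chain_dist_le tri hdiam s hab fun j _ hj => hsmeet j (by omega)
  -- distances from a center of the spine to other members of the spine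
  have hright : ∀ i j, i < j → j ≤ l → ∀ q ∈ C (s j),
      d (cen (s i)) q + 2 * P (i + 1) ≤ rad (s i) + 2 * P (j + 1) := by
    intro i j hij hj q hq
    obtain ⟨z, hz, hz'⟩ := hsmeet i (by omega)
    have h1 := hC _ z hz
    have h2 := hchain (i + 1) j (by omega) hj z hz' q hq
    have h3 := tri (cen (s i)) z q
    omega
  have hleft : ∀ i j, j < i → i ≤ l → ∀ q ∈ C (s j),
      d (cen (s i)) q + 2 * P j ≤ rad (s i) + 2 * P i := by
    intro i j hij hi q hq
    obtain ⟨z, hz, hz'⟩ := hsmeet (i - 1) (by omega)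
    rw [show i - 1 + 1 = i by omega] at hz'
    have h1 := hC _ z hz'
    have h2 := hchain j (i - 1) (by omega) (by omega) q hq z hz
    rw [show i - 1 + 1 = i by omega, symm] at h2
    have h3 := tri (cen (s i)) z q
    omega
  -- The far point `v₀` is reached along the spine, and for the set `T₀` itself only the radius is
  -- paid instead of the diameter.
  have hM : 3 * A + rad T₀ < 2 * P (l + 1) := by
    have h0 := hT₀ W
    rcases Nat.eq_zero_or_pos l with h | h
    · have h1 : W = T₀ := by rw [← hsl, h, hs0]
      have := hC W v₀ hv₀
      have := hrad W
      subst h1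
      omega
    · have := hright 0 l h le_rfl v₀ (by rw [hsl]; exact hv₀)
      rw [hs0, hPs 0, hP0, hs0] at this
      omega
  have hIco : ∀ a b, a ≤ b → ∑ j ∈ Finset.Ico a b, rad (s j) + P a = P b := by
    intro a b hab
    rw [add_comm]
    exact Finset.sum_range_add_sum_Ico _ hab
  -- the index of a member in the middle of the spine
  obtain ⟨i, hil, hi1, hi2⟩ : ∃ i ≤ l, A ≤ 2 * P i + rad (s i) ∧
      2 * P i + rad (s i) + A ≤ 2 * P (l + 1) := by
    have hex : ∃ i, A ≤ 2 * P i + rad (s i) ∧ i ≤ l :=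
      ⟨l, by have := hPs l; have := hT₀ (s l); omega, le_rfl⟩
    -- The first position that reaches `A` is suitable: positions advance by at most `2 * rad T₀`,
    -- so by `hM` at least `A` remains beyond it.
    refine ⟨Nat.find hex, (Nat.find_spec hex).2, (Nat.find_spec hex).1, ?_⟩
    rcases hfi : Nat.find hex with _ | j
    · have := hrad (s 0)
      have := hT₀ (s 0)
      rw [hP0]
      omega
    · have hnot := Nat.find_min hex (show j < Nat.find hex by omega)
      have := (Nat.find_spec hex).2
      have h1 := hT₀ (s j)
      have h2 := hT₀ (s (j + 1))
      have := hrad T₀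
      rw [hPs]
      by_cases hA : A ≤ 2 * P j + rad (s j)
      · exact absurd ⟨hA, by omega⟩ hnot
      · omega
  obtain ⟨Y, v, hv, hfarv⟩ := hbad (s i)
  -- the member of the spine nearest to the witness
  obtain ⟨x, hx, hxmin⟩ := Finset.exists_min_image (Finset.range (l + 1))
    (fun c => H.dist (s c) Y) ⟨0, by simp⟩
  replace hx : x ≤ l := by simpa [Nat.lt_succ_iff] using hx
  replace hxmin : ∀ c ≤ l, H.dist (s x) Y ≤ H.dist (s c) Y := fun c hc =>
    hxmin c (by simpa [Nat.lt_succ_iff] using hc)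
  obtain ⟨e, he0, heh, headj, hedist⟩ := exists_geodesic hH (s x) Y
  set h := H.dist (s x) Y with hh
  have hemeet : ∀ j < h, (C (e j) ∩ C (e (j + 1))).Nonempty :=
    fun j hj => ((hadj _ _).1 (headj j hj)).2
  have heclose : ∀ i ≤ h, ∀ j ≤ h, (C (e i) ∩ C (e j)).Nonempty → j ≤ i + 1 := by
    intro i hi j hj h'
    have h1 := hmeet _ _ h'
    have h2 := (hedist i hi).1
    have h3 := (hedist j hj).2
    have h4 := hdtri (s x) (e i) Y
    have h5 := hdtri (e i) (e j) Y
    omega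
  -- As `s x` is nearest to `Y`, the branch can touch the spine only with `e 0` and `e 1`.
  have hse : ∀ c ≤ l, ∀ j ≤ h, (C (s c) ∩ C (e j)).Nonempty → j ≤ 1 := by
    intro c hc j hj h'
    have h1 := hmeet _ _ h'
    have h3 := (hedist j hj).2
    have h4 := hxmin c hc
    have h5 := hdtri (s c) (e j) Y
    omega
  set E : ℕ → ℕ := fun j => ∑ t ∈ Finset.range j, rad (e t) with hE
  have hEs : ∀ j, E (j + 1) = E j + rad (e j) := fun j => Finset.sum_range_succ _ _
  have hEmono : Monotone E := monotone_nat_of_le_succ fun j => by rw [hEs]; omega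
  have hEIco : ∀ a b, a ≤ b → ∑ j ∈ Finset.Ico a b, rad (e j) + E a = E b := by
    intro a b hab
    rw [add_comm]
    exact Finset.sum_range_add_sum_Ico _ hab
  -- packing along an interval of the spine and a part of the branch
  have hpack : ∀ a b c, b ≤ l + 1 → a ≤ b → 1 ≤ c → c ≤ h + 1 →
      (c = 1 → 1 ≤ h → ∀ j, a ≤ j → j + 1 < b → (C (s j) ∩ C (e 1)).Nonempty →
        (C (s (j + 1)) ∩ C (e 1)).Nonempty → False) →
      P b + E (h + 1) ≤ 2 * A + P a + E c := by
    intro a b c hb hab hc hch hcond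
    have := pack (fun S => (∑ j ∈ Finset.Ico a b, if s j = S then 1 else 0) +
      ∑ j ∈ Finset.Ico c (h + 1), if e j = S then 1 else 0) (fun w => by
      simp_rw [add_mul]
      rw [Finset.sum_add_distrib, sum_count_mul _ s, sum_count_mul _ e,
        ← Finset.card_filter, ← Finset.card_filter]
      set J := (Finset.Ico a b).filter fun j => w ∈ C (s j) with hJ
      set K := (Finset.Ico c (h + 1)).filter fun j => w ∈ C (e j) with hK
      have hJm : ∀ j, j ∈ J ↔ (a ≤ j ∧ j < b) ∧ w ∈ C (s j) := fun j => by simp [hJ]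
      have hKm : ∀ j, j ∈ K ↔ (c ≤ j ∧ j < h + 1) ∧ w ∈ C (e j) := fun j => by simp [hK]
      have hJ2 : ∀ i ∈ J, ∀ j ∈ J, j ≤ i + 1 := fun i hi j hj => by
        rw [hJm] at hi hj
        exact hsclose i (by omega) j (by omega) ⟨w, hi.2, hj.2⟩
      have hK2 : ∀ i ∈ K, ∀ j ∈ K, j ≤ i + 1 := fun i hi j hj => by
        rw [hKm] at hi hj
        exact heclose i (by omega) j (by omega) ⟨w, hi.2, hj.2⟩
      rcases J.eq_empty_or_nonempty with hJe | ⟨j₀, hj₀⟩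
      · rw [hJe, Finset.card_empty, zero_add]
        exact card_le_two_of_close K hK2
      rcases K.eq_empty_or_nonempty with hKe | ⟨m₀, hm₀⟩
      · rw [hKe, Finset.card_empty, add_zero]
        exact card_le_two_of_close J hJ2
      -- If `w` lies both on the spine part and on the branch part, its only branch member is `e 1`.
      -- Then `c = 1`, and `hcond` allows just one spine member that contains `w`.
      have hK1 : ∀ m ∈ K, m = 1 := fun m hm => by
        rw [hKm] at hm
        rw [hJm] at hj₀
        have := hse j₀ (by omega) m (by omega) ⟨w, hj₀.2, hm.2⟩
        omega
      have hw1 : w ∈ C (e 1) ∧ c = 1 := by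
        have h1 := hK1 _ hm₀
        rw [hKm, h1] at hm₀
        exact ⟨hm₀.2, by omega⟩
      have hh1 : 1 ≤ h := by rw [hKm] at hm₀; omega
      have hJ1 : J.card ≤ 1 := by
        refine Finset.card_le_one.2 fun p hp q hq => ?_
        have hpq := hJ2 p hp q hq
        have hqp := hJ2 q hq p hp
        rw [hJm] at hp hq
        by_contra hne'
        rcases Nat.lt_or_gt_of_ne hne' with hlt | hlt
        · obtain rfl : q = p + 1 := by omega
          exact hcond hw1.2 hh1 p hp.1.1 hq.1.2 ⟨w, hp.2, hw1.1⟩ ⟨w, hq.2, hw1.1⟩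
        · obtain rfl : p = q + 1 := by omega
          exact hcond hw1.2 hh1 q hq.1.1 hp.1.2 ⟨w, hq.2, hw1.1⟩ ⟨w, hp.2, hw1.1⟩
      have hK1' : K.card ≤ 1 := Finset.card_le_one.2 fun p hp q hq => by
        rw [hK1 p hp, hK1 q hq]
      omega)
    simp_rw [add_mul] at this
    rw [Finset.sum_add_distrib, sum_count_mul _ s, sum_count_mul _ e] at this
    have h1 := hIco a b hab
    have h2 := hEIco c (h + 1) hch
    omega
  -- With `c = h + 1` the branch is empty, so the spine alone is packed.
  have hMtwo : P (l + 1) ≤ 2 * A := by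
    have := hpack 0 (l + 1) (h + 1) le_rfl (by omega) (by omega) le_rfl
      (fun h1 h2 => absurd h2 (by omega))
    omega
  -- If the branch has length zero, the witness lies on the spine. The whole spine has length at
  -- most `4 * A` and at least `A` lies on either side of the center of `s i`, so the witness is
  -- within `3 * A`.
  rcases Nat.eq_zero_or_pos h with hh0 | hh1
  · have hY : s x = Y := by rw [← he0, ← heh, hh0]
    rw [← hY] at hv
    rcases lt_trichotomy x i with hxi | rfl | hxi
    · have := hleft i x hxi hil v hv
      omega
    · have := hC _ v hv
      have := hrad (s x)
      omega
    · have h1 := hright i x hxi hx v hv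
      have h2 := hPmono (show x + 1 ≤ l + 1 by omega)
      rw [hPs i] at h1
      omega
  have hE2 : E 2 = E 1 + rad (e 1) := hEs 1
  -- From `e 2` on the branch avoids the spine, so it can be packed together with all of the spine.
  -- By `hM` the branch beyond `e 1` therefore has length less than `A - rad T₀`.
  have hg : P (l + 1) + E (h + 1) ≤ 2 * A + E 2 := by
    have := hpack 0 (l + 1) 2 le_rfl (by omega) (by omega) (by omega) (fun h1 => by omega)
    omega
  have hbranch : ∀ q ∈ C (e 1), d q v + 2 * E 1 ≤ 2 * E (h + 1) := fun q hq =>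
    chain_dist_le tri hdiam e hh1 (fun j _ hj => hemeet j hj) q hq v (by rw [heh]; exact hv)
  have hE12 := hEmono (show 2 ≤ h + 1 by omega)
  have hYT := hT₀ (e 1)
  have hYA := hrad (e 1)
  have hiT := hT₀ (s i)
  -- The direct route costs `rad (s i)`, the diameter of `e 1`, and less than `A - rad T₀` for the
  -- rest of the branch. As all radii are at most `rad T₀ ≤ A`, this is less than `3 * A`.
  have hnoti : ¬ (C (s i) ∩ C (e 1)).Nonempty := by
    rintro ⟨z, hz, hz'⟩
    have h1 := hC _ z hz
    have h2 := hbranch z hz'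
    have h3 := tri (cen (s i)) z v
    omega
  have hrouteL : ∀ j < i, (C (s j) ∩ C (e 1)).Nonempty →
      d (cen (s i)) v + 2 * P j + 2 * E 1 ≤ rad (s i) + 2 * P i + 2 * E (h + 1) := by
    rintro j hj ⟨z, hz, hz'⟩
    have h1 := hleft i j hj hil z hz
    have h2 := hbranch z hz'
    have h3 := tri (cen (s i)) z v
    omega
  have hrouteR : ∀ j, i < j → j ≤ l → (C (s j) ∩ C (e 1)).Nonempty →
      d (cen (s i)) v + 2 * P (i + 1) + 2 * E 1 ≤
        rad (s i) + 2 * P (j + 1) + 2 * E (h + 1) := by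
    rintro j hj hjl ⟨z, hz, hz'⟩
    have h1 := hright i j hj hjl z hz
    have h2 := hbranch z hz'
    have h3 := tri (cen (s i)) z v
    omega
  have hxt : (C (s x) ∩ C (e 1)).Nonempty := by
    have := hemeet 0 hh1
    rwa [he0] at this
  have hPi := hPs i
  have hL : (∀ j < i, ¬ (C (s j) ∩ C (e 1)).Nonempty) ∨
      ∃ a < i, (C (s a) ∩ C (e 1)).Nonempty ∧
        ∀ j < i, (C (s j) ∩ C (e 1)).Nonempty → j ≤ a := by
    rcases ((Finset.range i).filter fun j => (C (s j) ∩ C (e 1)).Nonempty).eq_empty_or_nonempty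
      with h0 | h0
    · left
      intro j hj hj'
      have : j ∈ (∅ : Finset ℕ) := h0 ▸ Finset.mem_filter.2 ⟨Finset.mem_range.2 hj, hj'⟩
      simp at this
    · right
      obtain ⟨a, ha, hamax⟩ := Finset.exists_max_image _ (fun j => j) h0
      rw [Finset.mem_filter, Finset.mem_range] at ha
      exact ⟨a, ha.1, ha.2, fun j hj hj' =>
        hamax j (Finset.mem_filter.2 ⟨Finset.mem_range.2 hj, hj'⟩)⟩
  have hR : (∀ j, i < j → j ≤ l → ¬ (C (s j) ∩ C (e 1)).Nonempty) ∨
      ∃ b, i < b ∧ b ≤ l ∧ (C (s b) ∩ C (e 1)).Nonempty ∧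
        ∀ j, i < j → j ≤ l → (C (s j) ∩ C (e 1)).Nonempty → b ≤ j := by
    rcases ((Finset.Ioc i l).filter fun j => (C (s j) ∩ C (e 1)).Nonempty).eq_empty_or_nonempty
      with h0 | h0
    · left
      intro j hj hjl hj'
      have : j ∈ (∅ : Finset ℕ) := h0 ▸ Finset.mem_filter.2 ⟨Finset.mem_Ioc.2 ⟨hj, hjl⟩, hj'⟩
      simp at this
    · right
      obtain ⟨b, hb, hbmin⟩ := Finset.exists_min_image _ (fun j => j) h0
      rw [Finset.mem_filter, Finset.mem_Ioc] at hb
      exact ⟨b, hb.1.1, hb.1.2, hb.2, fun j hj hjl hj' =>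
        hbmin j (Finset.mem_filter.2 ⟨Finset.mem_Ioc.2 ⟨hj, hjl⟩, hj'⟩)⟩
  -- Let `a` and `b` be the members closest to `i` on its two sides that meet `e 1`, as far as they
  -- exist. Between them nothing meets `e 1`, so the stretch of the spine bounded by them may be
  -- packed with the branch from `e 1` on. The set `s x` meets `e 1`, so at least one of `a` and `b`
  -- exists.
  rcases hL with hL | ⟨a, hai, hat, hamax⟩ <;> rcases hR with hR | ⟨b, hib, hbl, hbt, hbmin⟩
  · rcases lt_trichotomy x i with hxi | rfl | hxi
    · exact hL x hxi hxt
    · exact hnoti hxt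
    · exact hR x hxi hx hxt
  · have h1 := hrouteR b hib hbl hbt
    have h2 := hpack 0 (b + 1) 1 (by omega) (by omega) le_rfl (by omega)
      (fun _ _ j _ hj hj1 _ => by
        rcases lt_trichotomy j i with hji | rfl | hji
        · exact hL j hji hj1
        · exact hnoti hj1
        · have := hbmin j hji (by omega) hj1
          omega)
    omega
  · have h1 := hrouteL a hai hat
    have h2 := hpack a (l + 1) 1 (by omega) (by omega) le_rfl (by omega)
      (fun _ _ j hj hjl _ hj1 => by
        rcases lt_trichotomy (j + 1) i with hji | hji | hji
        · have := hamax (j + 1) hji hj1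
          omega
        · exact hnoti (hji ▸ hj1)
        · exact hR (j + 1) hji (by omega) hj1)
    omega
  -- Neither route need suffice by itself. Their average is bounded by `2 * A` from the packing plus
  -- the length of half the branch from `e 1` on, which `hg`, `hM` and `rad (e 1) ≤ rad T₀` keep
  -- below `A`.
  · have h1 := hrouteL a hai hat
    have h2 := hrouteR b hib hbl hbt
    have h3 := hpack a (b + 1) 1 (by omega) (by omega) le_rfl (by omega)
      (fun _ _ j hj hjl hj1 hj2 => by
        rcases lt_trichotomy (j + 1) i with hji | hji | hji
        · have := hamax (j + 1) hji hj2
          omega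
        · exact hnoti (hji ▸ hj2)
        · rcases Nat.lt_or_ge i j with hij | hij
          · have := hbmin j hij (by omega) hj1
            omega
          · obtain rfl : j = i := by omega
            exact hnoti hj1)
    omega

open Classical in
/-- The version of `exists_center_of_packing` for a set spanned by a finite family. -/
theorem exists_center_of_span (d : V → V → ℕ) (d_self : ∀ u, d u u = 0)
    (symm : ∀ u v, d u v = d v u) (tri : ∀ u v w, d u w ≤ d u v + d v w)
    (F : Finset ι) (C : ι → Set V) (cen : ι → V) (rad : ι → ℕ)
    (hcen : ∀ S ∈ F, cen S ∈ C S)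
    (hC : ∀ S ∈ F, ∀ v ∈ C S, d (cen S) v ≤ rad S) (A : ℕ) (X : Set V) (hX : X.Nonempty)
    (hFX : ∀ S ∈ F, C S ⊆ X)
    (hspan : ∀ u ∈ X, ∀ v ∈ X,
      Relation.ReflTransGen (fun u v => ∃ S ∈ F, u ∈ C S ∧ v ∈ C S) u v)
    (pack : ∀ φ : ι → ℕ, (∀ v, ∑ S ∈ F, φ S * (if v ∈ C S then 1 else 0) ≤ 2) →
      ∑ S ∈ F, φ S * rad S ≤ 2 * A) :
    ∃ c ∈ X, ∀ v ∈ X, d c v ≤ 3 * A := by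
  -- Without any set the chains of `hspan` are trivial, so `X` is a single point.
  rcases F.eq_empty_or_nonempty with rfl | ⟨S₀, hS₀⟩
  · obtain ⟨u, hu⟩ := hX
    refine ⟨u, hu, fun v hv => ?_⟩
    have := hspan u hu v hv
    rcases Relation.ReflTransGen.cases_tail this with h | ⟨b, -, S, hS, -⟩
    · rw [h, d_self]; exact Nat.zero_le _
    · simp at hS
  let H : SimpleGraph F :=
    { Adj := fun S T => S ≠ T ∧ (C S ∩ C T).Nonempty
      symm := ⟨fun S T h => ⟨h.1.symm, by rw [Set.inter_comm]; exact h.2⟩⟩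
      loopless := ⟨fun S h => h.1 rfl⟩ }
  have hreach : ∀ S T : F, (C S ∩ C T).Nonempty → H.Reachable S T := by
    intro S T h
    by_cases hST : S = T
    · rw [hST]
    · exact SimpleGraph.Adj.reachable (show H.Adj S T from ⟨hST, h⟩)
  have hpath : ∀ u v, Relation.ReflTransGen (fun u v => ∃ S ∈ F, u ∈ C S ∧ v ∈ C S) u v →
      ∀ S T : F, u ∈ C S → v ∈ C T → H.Reachable S T := by
    intro u v h
    induction h with
    | refl => exact fun S T hS hT => hreach S T ⟨u, hS, hT⟩
    | tail _ h ih =>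
      obtain ⟨S', hS', hb, hc⟩ := h
      exact fun S T hS hT => (ih S ⟨S', hS'⟩ hS hb).trans (hreach _ _ ⟨_, hc, hT⟩)
  have hconn : H.Connected :=
    { preconnected := fun S T => hpath (cen S) (cen T)
        (hspan _ (hFX _ S.2 (hcen _ S.2)) _ (hFX _ T.2 (hcen _ T.2))) S T
        (hcen _ S.2) (hcen _ T.2)
      nonempty := ⟨⟨S₀, hS₀⟩⟩ }
  obtain ⟨T, hT⟩ := exists_center_of_packing d symm tri (fun S : F => C S) (fun S => cen S)
    (fun S => rad S) (fun S => hC S S.2) A (fun φ hφ => by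
      have := pack (fun S => if h : S ∈ F then φ ⟨S, h⟩ else 0) (fun v => by
        rw [← Finset.sum_coe_sort F]
        simpa using hφ v)
      rw [← Finset.sum_coe_sort F] at this
      simpa using this) H hconn (fun S T => Iff.rfl)
  refine ⟨cen T, hFX _ T.2 (hcen _ T.2), fun v hv => ?_⟩
  have hv' := hspan (cen S₀) (hFX _ hS₀ (hcen _ hS₀)) v hv
  rcases Relation.ReflTransGen.cases_tail hv' with h | ⟨b, -, S, hS, -, hvS⟩
  · exact hT ⟨S₀, hS₀⟩ v (by rw [h]; exact hcen _ hS₀)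
  · exact hT ⟨S, hS⟩ v hvS

end CenterLemma

end ConnectedMSR

namespace ConnectedMSR


/-! ### Dual values and the packing invariant of the classes. -/

section PrimalDual

open Classical in
/-- The vertices that can be reached from `c` inside the ball of radius `r` around `c`. -/
def cball {V : Type*} (G : SimpleGraph V) (d : V → V → ℕ) (c : V) (r : ℕ) : Set V :=
  {v | Relation.ReflTransGen (fun u v => G.Adj u v ∧ d c v ≤ r) c v}

variable {V : Type*} {G : SimpleGraph V} {d : V → V → ℕ}

/-- The connected ball given by a center and a vertex on its boundary. -/
abbrev pball (G : SimpleGraph V) (d : V → V → ℕ) (S : V × V) : Set V := cball G d S.1 (d S.1 S.2)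

theorem self_mem_cball (c : V) (r : ℕ) : c ∈ cball G d c r := Relation.ReflTransGen.refl

theorem dist_le_of_mem_cball (d_self : ∀ u, d u u = 0) {c v : V} {r : ℕ} (h : v ∈ cball G d c r) :
    d c v ≤ r := by
  rcases Relation.ReflTransGen.cases_tail h with h | ⟨b, -, h⟩
  · rw [h, d_self]; exact Nat.zero_le _
  · exact h.2

variable [Fintype V] [DecidableEq V]

open Classical in
/-- The price of a class that contains no guessed cluster. -/
noncomputable def price (V₀ : Set V) (lam : ℕ) (l : V) : ℕ := if l ∈ V₀ then 0 else lam

open Classical in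
/-- The invariant of the primal-dual algorithm: the classes of `comp` are spanned by a family of
connected balls that pack well with respect to the dual values `gam`. -/
def Spanned (G : SimpleGraph V) (d : V → V → ℕ) (V₀ : Set V) (gam : V → ℕ) (lam : ℕ)
    (comp : V → V) (F : Finset (V × V)) : Prop :=
  (∀ S ∈ F, ∀ u ∈ pball G d S, comp u = comp S.1) ∧
  (∀ u v, comp u = comp v →
    Relation.ReflTransGen (fun u v => ∃ S ∈ F, u ∈ pball G d S ∧ v ∈ pball G d S) u v) ∧
  -- The function `f` stands for balls that will be added later and `j` for the largest number of
  -- times that they cover a vertex. The plain packing bound is the case `f = 0`, `j = 0`. The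
  -- general form is the one that survives merging.
  ∀ l, comp l = l → ∀ (φ : V × V → ℕ) (f : V → ℕ) (j : ℕ), j ≤ 2 → (∀ v, f v ≤ j) →
    (∀ v, comp v = l → ∑ S ∈ F, φ S * (if v ∈ pball G d S then 1 else 0) + f v ≤ 2) →
    ∑ S ∈ F with comp S.1 = l, φ S * d S.1 S.2 + ∑ v with comp v = l, gam v * f v
      + (2 - j) * price V₀ lam l ≤ 2 * ∑ v with comp v = l, gam v

/-- Merging the classes with labels in `J` into one class with label `l`. -/
def regroup (comp : V → V) (J : Finset V) (l : V) (v : V) : V := if comp v ∈ J then l else comp v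

theorem regroup_eq_iff {comp : V → V} {J : Finset V} {l : V} (hl : l ∈ J) (v : V) :
    regroup comp J l v = l ↔ comp v ∈ J := by
  unfold regroup
  split_ifs with h
  · simp [h]
  · exact ⟨fun h' => absurd (h' ▸ hl) h, fun h' => absurd h' h⟩

theorem regroup_eq_iff_of_ne {comp : V → V} {J : Finset V} {l l' : V}
    (hne : l' ≠ l) (hl' : regroup comp J l l' = l') (v : V) :
    (regroup comp J l v = l' ↔ comp v = l') ∧ comp l' = l' := by
  unfold regroup at *
  split_ifs at hl' with h
  · exact absurd hl'.symm hne
  · rw [hl'] at h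
    refine ⟨?_, hl'⟩
    split_ifs with h'
    · exact ⟨fun h2 => absurd h2.symm hne, fun h2 => absurd (h2 ▸ h') h⟩
    · rfl

theorem regroup_congr {comp : V → V} (J : Finset V) (l : V) {u v : V} (h : comp u = comp v) :
    regroup comp J l u = regroup comp J l v := by unfold regroup; rw [h]

theorem sum_filter_mem_fiber {α : Type*} (s : Finset α) (g : α → V) (J : Finset V) (x : α → ℕ) :
    ∑ a ∈ s with g a ∈ J, x a = ∑ l ∈ J, ∑ a ∈ s with g a = l, x a := by
  rw [← Finset.sum_fiberwise_of_maps_to (t := J) (g := g) (fun a ha => (Finset.mem_filter.1 ha).2)]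
  refine Finset.sum_congr rfl fun l hl => Finset.sum_congr ?_ fun _ _ => rfl
  ext a
  simp only [Finset.mem_filter]
  constructor
  · rintro ⟨⟨h1, h2⟩, h3⟩; exact ⟨h1, h3⟩
  · rintro ⟨h1, rfl⟩; exact ⟨⟨h1, hl⟩, rfl⟩

theorem price_le_sum (V₀ : Set V) (lam : ℕ) {J : Finset V} {l : V} (hl : l ∈ J) :
    price V₀ lam l ≤ ∑ l ∈ J, price V₀ lam l :=
  Finset.single_le_sum (f := price V₀ lam) (fun _ _ => Nat.zero_le _) hl

theorem Spanned.init (V₀ : Set V) (gam : V → ℕ) : Spanned G d V₀ gam 0 id ∅ := by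
  refine ⟨by simp, fun u v h => ?_, ?_⟩
  · rw [show u = v from h]
  · intro l _ φ f j hj _ hf
    have : price V₀ 0 l = 0 := by unfold price; split_ifs <;> rfl
    rw [this]
    simp only [Finset.filter_empty, Finset.sum_empty, zero_add, mul_zero, add_zero, Finset.mul_sum]
    refine Finset.sum_le_sum fun v hv => ?_
    have := hf v (Finset.mem_filter.1 hv).2
    simp only [Finset.sum_empty, zero_add] at this
    rw [mul_comm]
    exact Nat.mul_le_mul_right _ this

open Classical in
-- For a free class the left side grows by `f l` through the dual of its label and by `2 - j`
-- through its price. As `f l ≤ j`, this is at most the growth `2` of the right side. For the other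
-- classes nothing changes.
theorem Spanned.raise {V₀ : Set V} {gam : V → ℕ} {lam : ℕ} {comp : V → V} {F : Finset (V × V)}
    (h : Spanned G d V₀ gam lam comp F) :
    Spanned G d V₀ (fun v => gam v + if comp v = v ∧ v ∉ V₀ then 1 else 0) (lam + 1) comp F := by
  refine ⟨h.1, h.2.1, fun l hl φ f j hj hfj hf => ?_⟩
  have h1 := h.2.2 l hl φ f j hj hfj hf
  have key : ∀ g : V → ℕ, ∑ v with comp v = l, (if comp v = v ∧ v ∉ V₀ then 1 else 0) * g v =
      if l ∈ V₀ then 0 else g l := by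
    intro g
    rw [Finset.sum_filter, Finset.sum_eq_single l]
    · simp only [hl, if_true]
      split_ifs <;> simp_all
    · intro v _ hv
      split_ifs with h1 h2
      · exact absurd (h2.1.symm.trans h1) hv
      · simp
      · rfl
    · simp
  have key1 := key fun _ => 1
  have key2 := key f
  simp only [mul_one] at key1
  simp_rw [add_mul]
  rw [Finset.sum_add_distrib, Finset.sum_add_distrib, key1, key2]
  have := hfj l
  unfold price at h1 ⊢
  by_cases hlV : l ∈ V₀
  · simp only [hlV, if_true] at h1 ⊢
    omega
  · simp only [hlV, if_false] at h1 ⊢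
    rw [mul_add]
    omega

open Classical in
-- The copies of `T` are shifted into the vertex function: the bounds of the merged classes are
-- applied with `f` increased by `φ T` on the ball `T`, whose values are at most `min 2 (j + φ T)`.
-- Their sum contains `φ T` times the dual value of `T`, and by tightness this pays for the radius
-- of each copy and for one price. Together with the price retained in the bound for `l` this leaves
-- `2 - j` prices.
theorem Spanned.regroup {V₀ : Set V} {gam : V → ℕ} {lam : ℕ} {comp : V → V} {F : Finset (V × V)}
    (h : Spanned G d V₀ gam lam comp F) (J : Finset V) (l : V) (hl : l ∈ J)
    (hJ : ∀ l ∈ J, comp l = l) (T : V × V) (hT : ∀ v ∈ pball G d T, comp v ∈ J)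
    (hit : ∀ l ∈ J, ∃ v ∈ pball G d T, comp v = l)
    (tight : d T.1 T.2 + price V₀ lam l ≤ ∑ v with v ∈ pball G d T, gam v) :
    Spanned G d V₀ gam lam (regroup comp J l) (insert T F) := by
  obtain ⟨mono, span, claim⟩ := h
  have hTc : ∀ v ∈ pball G d T, ConnectedMSR.regroup comp J l v = l := fun v hv =>
    (regroup_eq_iff hl v).2 (hT v hv)
  have hT1 : T.1 ∈ pball G d T := self_mem_cball _ _
  refine ⟨?_, ?_, ?_⟩
  · intro S hS u hu
    rcases Finset.mem_insert.1 hS with rfl | hS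
    · rw [hTc u hu, hTc _ hT1]
    · exact regroup_congr J l (mono S hS u hu)
  · have span' : ∀ u v, comp u = comp v → Relation.ReflTransGen
        (fun u v => ∃ S ∈ insert T F, u ∈ pball G d S ∧ v ∈ pball G d S) u v := fun u v huv =>
      Relation.ReflTransGen.mono
        (fun a b ⟨S, hS, hab⟩ => ⟨S, Finset.mem_insert_of_mem hS, hab⟩) _ _ (span u v huv)
    intro u v huv
    by_cases hu : comp u ∈ J
    · have hv : comp v ∈ J := by
        rw [← regroup_eq_iff hl, ← huv, regroup_eq_iff hl]; exact hu
      obtain ⟨a, ha, hau⟩ := hit _ hu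
      obtain ⟨b, hb, hbv⟩ := hit _ hv
      exact ((span' u a hau.symm).tail ⟨T, Finset.mem_insert_self _ _, ha, hb⟩).trans
        (span' b v hbv)
    · have hv : comp v ∉ J := by
        rw [← regroup_eq_iff hl, ← huv, regroup_eq_iff hl]; exact hu
      refine span' u v ?_
      unfold ConnectedMSR.regroup at huv
      rwa [if_neg hu, if_neg hv] at huv
  · intro l' hl' φ f j hj hfj hf
    -- The ball `T` may already belong to `F`, so its multiplicity is removed there and accounted
    -- for separately.
    set φ' : V × V → ℕ := Function.update φ T 0 with hφ'
    have hsplit : ∀ x : V × V → ℕ, ∑ S ∈ insert T F, φ S * x S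
        = φ T * x T + ∑ S ∈ F, φ' S * x S := by
      intro x
      rw [← Finset.insert_erase (Finset.mem_insert_self T F), Finset.erase_insert_eq_erase,
        Finset.sum_insert (Finset.notMem_erase _ _)]
      congr 1
      rw [← Finset.sum_erase F (a := T) (by simp [hφ'])]
      refine Finset.sum_congr rfl fun S hS => ?_
      rw [hφ', Function.update_of_ne (Finset.ne_of_mem_erase hS)]
    have hsum : ∀ m : V, ∑ S ∈ insert T F with ConnectedMSR.regroup comp J l S.1 = m,
        φ S * d S.1 S.2 = (if ConnectedMSR.regroup comp J l T.1 = m then φ T * d T.1 T.2 else 0) +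
          ∑ S ∈ F with ConnectedMSR.regroup comp J l S.1 = m, φ' S * d S.1 S.2 := by
      intro m
      have := hsplit fun S => if ConnectedMSR.regroup comp J l S.1 = m then d S.1 S.2 else 0
      simp only [mul_ite, mul_zero] at this
      rw [Finset.sum_filter, Finset.sum_filter]
      exact this
    simp_rw [hsplit] at hf
    rw [hsum]
    by_cases hll : l' = l
    · subst hll
      rw [if_pos (hTc _ hT1)]
      set f' : V → ℕ := fun v => f v + φ T * (if v ∈ pball G d T then 1 else 0) with hf'
      have hbd : ∀ i ∈ J, _ := fun i hi => claim i (hJ i hi) φ' f' (min 2 (j + φ T))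
        (min_le_left _ _) (fun v => by
          refine le_min ?_ ?_
          · by_cases hv : v ∈ pball G d T
            · have := hf v (hTc v hv)
              simp only [hf']
              omega
            · have := hfj v
              simp only [hf', if_neg hv]
              omega
          · have := hfj v
            simp only [hf']
            split_ifs <;> omega)
        (fun v hv => by
          have := hf v ((regroup_eq_iff hl v).2 (hv ▸ hi))
          simp only [hf']
          omega)
      have hbd' := Finset.sum_le_sum hbd
      rw [Finset.sum_add_distrib, Finset.sum_add_distrib, ← Finset.mul_sum, ← Finset.mul_sum,
        ← sum_filter_mem_fiber F (fun S => comp S.1) J,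
        ← sum_filter_mem_fiber Finset.univ comp J, ← sum_filter_mem_fiber Finset.univ comp J] at hbd'
      simp_rw [regroup_eq_iff hl]
      have hγ : ∑ v with comp v ∈ J, gam v * f' v = ∑ v with comp v ∈ J, gam v * f v +
          φ T * ∑ v with v ∈ pball G d T, gam v := by
        simp only [hf', mul_add, Finset.sum_add_distrib]
        congr 1
        rw [Finset.mul_sum, Finset.sum_filter, Finset.sum_filter]
        refine Finset.sum_congr rfl fun v _ => ?_
        by_cases hv : v ∈ pball G d T
        · simp only [hv, hT v hv, if_true, mul_one]
          ring
        · simp [hv]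
      rw [hγ] at hbd'
      have hpr := price_le_sum V₀ lam hl
      have h1 := Nat.mul_le_mul_left (φ T) tight
      have h2 := Nat.mul_le_mul_left (2 - min 2 (j + φ T)) hpr
      have h3 : (2 - j) * price V₀ lam l' ≤
          φ T * price V₀ lam l' + (2 - min 2 (j + φ T)) * price V₀ lam l' := by
        rw [← add_mul]
        exact Nat.mul_le_mul_right _ (by omega)
      rw [mul_add] at h1
      omega
    · have hiff := regroup_eq_iff_of_ne hll hl'
      rw [if_neg (by rw [hTc _ hT1]; exact Ne.symm hll), zero_add]
      simp_rw [fun v => (hiff v).1]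
      refine claim l' (hiff l').2 φ' f j hj hfj fun v hv => ?_
      have := hf v ((hiff v).1.2 hv)
      omega

end PrimalDual

end ConnectedMSR

namespace ConnectedMSR


/-! ### A center for each class, and for classes joined by one more ball. -/

section Centers

variable {V : Type*} [Fintype V] [DecidableEq V] {G : SimpleGraph V} {d : V → V → ℕ}
  {V₀ : Set V} {gam : V → ℕ} {lam : ℕ} {comp : V → V} {F : Finset (V × V)}

/-- Each ball of the family lies in a single class, so a chain of balls never leaves the class in
which it starts. -/
theorem Spanned.span_class (h : Spanned G d V₀ gam lam comp F) {u v : V} (huv : comp u = comp v) :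
    Relation.ReflTransGen (fun a b => comp a = comp u ∧ comp b = comp u ∧
      ∃ S ∈ F, comp S.1 = comp u ∧ a ∈ pball G d S ∧ b ∈ pball G d S) u v := by
  have key : ∀ w, Relation.ReflTransGen (fun a b => ∃ S ∈ F, a ∈ pball G d S ∧ b ∈ pball G d S) u w →
      comp w = comp u ∧ Relation.ReflTransGen (fun a b => comp a = comp u ∧ comp b = comp u ∧
      ∃ S ∈ F, comp S.1 = comp u ∧ a ∈ pball G d S ∧ b ∈ pball G d S) u w := by
    intro w hw
    induction hw with
    | refl => exact ⟨rfl, .refl⟩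
    | tail _ hbc ih =>
      obtain ⟨S, hS, hb, hc⟩ := hbc
      have hb' := h.1 S hS _ hb
      have hc' := h.1 S hS _ hc
      exact ⟨by rw [hc', ← hb', ih.1], ih.2.tail
        ⟨ih.1, by rw [hc', ← hb', ih.1], S, hS, by rw [← hb', ih.1], hb, hc⟩⟩
  exact (key v (h.2.1 u v huv)).2

/-- The case `f = 0`, `j = 0` of the invariant: the packing hypothesis of the center lemma, with `A`
the dual value of the class minus its price. -/
theorem Spanned.packing (h : Spanned G d V₀ gam lam comp F) {l : V} (hl : comp l = l)
    (φ : V × V → ℕ) (hφ : ∀ v, comp v = l → 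
      ∑ S ∈ F, φ S * (open Classical in if v ∈ pball G d S then 1 else 0) ≤ 2) :
    ∑ S ∈ F with comp S.1 = l, φ S * d S.1 S.2 + 2 * price V₀ lam l
      ≤ 2 * ∑ v with comp v = l, gam v := by
  have := h.2.2 l hl φ (fun _ => 0) 0 (by omega) (fun _ => le_rfl) (fun v hv => by
    simpa using hφ v hv)
  simpa using this

/-- The empty packing. It shows that the dual value minus the price is not a truncated subtraction.
-/
theorem Spanned.price_le (h : Spanned G d V₀ gam lam comp F) {l : V} (hl : comp l = l) :
    price V₀ lam l ≤ ∑ v with comp v = l, gam v := by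
  have := h.packing hl (fun _ => 0) (fun v _ => by simp)
  simp only [zero_mul, Finset.sum_const_zero, zero_add] at this
  omega

variable (d_self : ∀ u, d u u = 0) (symm : ∀ u v, d u v = d v u)
  (tri : ∀ u v w, d u w ≤ d u v + d v w)

include d_self symm tri

open Classical in
-- Serves the merge that is interrupted when enough classes have been joined. The ball `T` may then
-- stick out of the union of the classes, and tightness cannot be used. The balls are cut down to
-- the union, and the radius of `T` is paid for in full, by adding it to `A`.
theorem Spanned.exists_center_group (h : Spanned G d V₀ gam lam comp F) (J : Finset V) (l : V)
    (hl : l ∈ J) (hJ : ∀ l ∈ J, comp l = l) (T : V × V) (hT1 : comp T.1 ∈ J)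
    (hit : ∀ l ∈ J, ∃ v ∈ pball G d T, comp v = l) :
    ∃ c, comp c ∈ J ∧ ∀ v, comp v ∈ J →
      d c v + 3 * price V₀ lam l ≤ 3 * (∑ v with comp v ∈ J, gam v + d T.1 T.2) := by
  set F₁ := insert T (F.filter fun S => comp S.1 ∈ J) with hF₁
  set X : Set V := {v | comp v ∈ J} with hX
  have hFX : ∀ S ∈ F, comp S.1 ∈ J → pball G d S ⊆ X := fun S hS hSJ v hv => by
    rw [hX, Set.mem_ofPred_eq, h.1 S hS v hv]; exact hSJ
  have hprice : price V₀ lam l ≤ ∑ v with comp v ∈ J, gam v := by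
    refine (h.price_le (hJ l hl)).trans (Finset.sum_le_sum_of_subset fun v hv => ?_)
    rw [Finset.mem_filter] at hv ⊢
    exact ⟨hv.1, hv.2 ▸ hl⟩
  have hcls : ∀ u v, u ∈ X → comp u = comp v → Relation.ReflTransGen
      (fun u v => ∃ S ∈ F₁, u ∈ pball G d S ∩ X ∧ v ∈ pball G d S ∩ X) u v := by
    intro u v hu huv
    refine Relation.ReflTransGen.mono ?_ _ _ (h.span_class huv)
    rintro a b ⟨ha, hb, S, hS, hSu, haS, hbS⟩
    refine ⟨S, Finset.mem_insert_of_mem (Finset.mem_filter.2 ⟨hS, hSu ▸ hu⟩), ⟨haS, ?_⟩, hbS, ?_⟩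
    · rw [hX, Set.mem_ofPred_eq, ha]; exact hu
    · rw [hX, Set.mem_ofPred_eq, hb]; exact hu
  have hcenF : ∀ S ∈ F₁, comp S.1 ∈ J := by
    intro S hS
    rcases Finset.mem_insert.1 hS with rfl | hS
    · exact hT1
    · exact (Finset.mem_filter.1 hS).2
  obtain ⟨c, hc, hcv⟩ := exists_center_of_span d d_self symm tri F₁ (fun S => pball G d S ∩ X)
    Prod.fst (fun S => d S.1 S.2) (fun S hS => ⟨self_mem_cball _ _, hcenF S hS⟩)
    (fun S _ v hv => dist_le_of_mem_cball d_self hv.1)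
    (∑ v with comp v ∈ J, gam v + d T.1 T.2 - price V₀ lam l) X ⟨l, by
      rw [hX, Set.mem_ofPred_eq, hJ l hl]; exact hl⟩ (fun S _ => Set.inter_subset_right)
    (fun u hu v hv => by
      obtain ⟨a, ha, hau⟩ := hit _ hu
      obtain ⟨b, hb, hbv⟩ := hit _ hv
      refine ((hcls u a hu hau.symm).tail ⟨T, Finset.mem_insert_self _ _, ⟨ha, ?_⟩, hb, ?_⟩).trans
        (hcls b v ?_ hbv)
      · rw [hX, Set.mem_ofPred_eq, hau]; exact hu
      · rw [hX, Set.mem_ofPred_eq, hbv]; exact hv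
      · rw [hX, Set.mem_ofPred_eq, hbv]; exact hv)
    (fun φ hφ => by
      -- The ball `T` covers its own center, where the total multiplicity is at most two.
      have hφT : φ T ≤ 2 := by
        have h1 := hφ T.1
        have h2 := Finset.single_le_sum (f := fun S => φ S * if T.1 ∈ pball G d S ∩ X then 1 else 0)
          (fun _ _ => Nat.zero_le _) (show T ∈ F₁ from Finset.mem_insert_self _ _)
        have h3 : T.1 ∈ pball G d T ∩ X := ⟨self_mem_cball _ _, hT1⟩
        simp only [if_pos h3, mul_one] at h2
        refine le_trans (le_trans h2 (le_of_eq ?_)) h1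
        congr!
      have h1 : ∑ S ∈ F₁, φ S * d S.1 S.2 ≤ φ T * d T.1 T.2 +
          ∑ S ∈ F with comp S.1 ∈ J, φ S * d S.1 S.2 := by
        by_cases hTF : T ∈ F.filter fun S => comp S.1 ∈ J
        · rw [hF₁, Finset.insert_eq_of_mem hTF]; omega
        · rw [hF₁, Finset.sum_insert hTF]
      have h2 : ∀ i ∈ J, _ := fun i hi => h.packing (hJ i hi) φ (fun v hv => by
        have hvX : v ∈ X := by rw [hX, Set.mem_ofPred_eq, hv]; exact hi
        refine le_trans ?_ (hφ v)
        rw [← Finset.sum_subset (Finset.filter_subset (fun S => comp S.1 ∈ J) F)]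
        · refine le_trans (le_of_eq ?_) (Finset.sum_le_sum_of_subset (Finset.subset_insert T _))
          refine Finset.sum_congr rfl fun S _ => ?_
          by_cases hvS : v ∈ pball G d S <;> simp [hvS, hvX]
        · intro S hS hS'
          rw [Finset.mem_filter, not_and] at hS'
          rw [if_neg, mul_zero]
          intro hvS
          refine hS' hS ?_
          rw [← h.1 S hS v hvS, hv]
          exact hi)
      have h3 := Finset.sum_le_sum h2
      rw [Finset.sum_add_distrib, ← Finset.mul_sum, ← Finset.mul_sum,
        ← sum_filter_mem_fiber F (fun S => comp S.1) J,
        ← sum_filter_mem_fiber Finset.univ comp J] at h3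
      have h4 := price_le_sum V₀ lam hl
      have h5 := Nat.mul_le_mul_right (d T.1 T.2) hφT
      omega)
  refine ⟨c, hc, fun v hv => ?_⟩
  have := hcv v hv
  omega

/-- The group consists of one class, joined by the ball of radius zero around its label. -/
theorem Spanned.exists_center_class (h : Spanned G d V₀ gam lam comp F) {l : V} (hl : comp l = l) :
    ∃ c, comp c = l ∧ ∀ v, comp v = l →
      d c v + 3 * price V₀ lam l ≤ 3 * ∑ v with comp v = l, gam v := by
  obtain ⟨c, hc, hcv⟩ := h.exists_center_group d_self symm tri {l} l (by simp) (by simpa using hl)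
    (l, l) (by simpa using hl) (fun m hm => ⟨l, self_mem_cball _ _, by simp_all⟩)
  simp only [Finset.mem_singleton, d_self, add_zero] at hc hcv
  exact ⟨c, hc, hcv⟩

end Centers

end ConnectedMSR

namespace ConnectedMSR


/-! ### Labellings, merging of classes, and interrupted growth along a ball. -/

section States

variable {V : Type*} [Fintype V] [DecidableEq V]

/-- `comp` maps each vertex to the label of its class, the classes are connected, and the label of
a class that meets `V₀` belongs to `V₀`. -/
structure Labelling (G : SimpleGraph V) (V₀ : Set V) (comp : V → V) : Prop where
  idem : ∀ v, comp (comp v) = comp v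
  mem : ∀ v ∈ V₀, comp v ∈ V₀
  conn : ∀ u v, comp u = comp v →
    Relation.ReflTransGen (fun a b => G.Adj a b ∧ comp a = comp b) u v

open Classical in
/-- The number of classes that do not meet `V₀`. -/
noncomputable def freeCount (V₀ : Set V) (comp : V → V) : ℕ :=
  (Finset.univ.filter fun v => comp v = v ∧ v ∉ V₀).card

open Classical in
/-- The label of the union of the classes with labels `l₁` and `l₂`. -/
noncomputable def newLabel (V₀ : Set V) (l₁ l₂ : V) : V := if l₁ ∉ V₀ ∧ l₂ ∈ V₀ then l₂ else l₁

/-- Merging two classes. -/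
noncomputable def merge (V₀ : Set V) (comp : V → V) (l₁ l₂ : V) : V → V :=
  regroup comp {l₁, l₂} (newLabel V₀ l₁ l₂)

variable {G : SimpleGraph V} {V₀ : Set V} {comp : V → V}

theorem newLabel_mem (l₁ l₂ : V) : newLabel V₀ l₁ l₂ ∈ ({l₁, l₂} : Finset V) := by
  unfold newLabel; split_ifs <;> simp

theorem Labelling.id (G : SimpleGraph V) (V₀ : Set V) : Labelling G V₀ id :=
  ⟨fun _ => rfl, fun _ h => h, fun u v h => by rw [show u = v from h]⟩

/-- The choice in `newLabel` is what preserves `mem`: a class that meets `V₀` has its label in `V₀`,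
and the union keeps such a label if there is one. -/
theorem Labelling.merge (h : Labelling G V₀ comp) {u v : V} (huv : G.Adj u v) :
    Labelling G V₀ (merge V₀ comp (comp u) (comp v)) := by
  have hmem := newLabel_mem (V₀ := V₀) (comp u) (comp v)
  set l := newLabel V₀ (comp u) (comp v) with hl
  have hcl : comp l = l := by
    rw [Finset.mem_insert, Finset.mem_singleton] at hmem
    rcases hmem with h' | h' <;> rw [h', h.idem]
  refine ⟨fun x => ?_, fun x hx => ?_, fun a b hab => ?_⟩
  · unfold ConnectedMSR.merge
    by_cases hx : comp x ∈ ({comp u, comp v} : Finset V)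
    · rw [(regroup_eq_iff hmem x).2 hx]
      exact (regroup_eq_iff hmem _).2 (by rw [hcl]; exact hmem)
    · have : regroup comp {comp u, comp v} l x = comp x := if_neg hx
      rw [this]
      unfold regroup
      rw [h.idem, if_neg hx]
  · unfold ConnectedMSR.merge
    by_cases hx' : comp x ∈ ({comp u, comp v} : Finset V)
    · rw [(regroup_eq_iff hmem x).2 hx']
      have := h.mem x hx
      rw [Finset.mem_insert, Finset.mem_singleton] at hx'
      rw [hl]
      unfold newLabel
      split_ifs with h1
      · exact h1.2
      · rcases hx' with h2 | h2
        · rwa [← h2]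
        · by_contra h3
          exact h1 ⟨h3, h2 ▸ this⟩
    · rw [show regroup comp {comp u, comp v} (newLabel V₀ (comp u) (comp v)) x = comp x from
        if_neg hx']
      exact h.mem x hx
  · have lift : ∀ a b, comp a = comp b → Relation.ReflTransGen (fun a b => G.Adj a b ∧
        ConnectedMSR.merge V₀ comp (comp u) (comp v) a =
          ConnectedMSR.merge V₀ comp (comp u) (comp v) b) a b := fun a b hab =>
      Relation.ReflTransGen.mono (fun x y hxy => ⟨hxy.1, regroup_congr _ _ hxy.2⟩) _ _
        (h.conn a b hab)
    have huv' : ConnectedMSR.merge V₀ comp (comp u) (comp v) u =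
          ConnectedMSR.merge V₀ comp (comp u) (comp v) v := by
      unfold ConnectedMSR.merge
      rw [(regroup_eq_iff hmem u).2 (by simp), (regroup_eq_iff hmem v).2 (by simp)]
    by_cases ha : comp a ∈ ({comp u, comp v} : Finset V)
    · have hb : comp b ∈ ({comp u, comp v} : Finset V) := by
        rw [← regroup_eq_iff hmem]
        exact hab.symm.trans ((regroup_eq_iff hmem a).2 ha)
      rw [Finset.mem_insert, Finset.mem_singleton] at ha hb
      rcases ha with ha | ha <;> rcases hb with hb | hb
      · exact lift a b (ha.trans hb.symm)
      · exact ((lift a u ha).tail ⟨huv, huv'⟩).trans (lift v b hb.symm)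
      · exact ((lift a v ha).tail ⟨huv.symm, huv'.symm⟩).trans (lift u b hb.symm)
      · exact lift a b (ha.trans hb.symm)
    · have hb : comp b ∉ ({comp u, comp v} : Finset V) := by
        rw [← regroup_eq_iff hmem]
        exact fun hb => ha ((regroup_eq_iff hmem a).1 (hab.trans hb))
      refine lift a b ?_
      unfold ConnectedMSR.merge regroup at hab
      rwa [if_neg ha, if_neg hb] at hab

open Classical in
-- At most one label disappears in a merge. Hence the number of free classes never skips a value,
-- and merging can be stopped at exactly `K`.
theorem freeCount_merge {l₁ l₂ : V} (h₁ : comp l₁ = l₁) (h₂ : comp l₂ = l₂) :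
    freeCount V₀ (merge V₀ comp l₁ l₂) ≤ freeCount V₀ comp ∧
      freeCount V₀ comp ≤ freeCount V₀ (merge V₀ comp l₁ l₂) + 1 := by
  have hmem := newLabel_mem (V₀ := V₀) l₁ l₂
  set l := newLabel V₀ l₁ l₂ with hl
  obtain ⟨o, ho⟩ : ∃ o, ({l₁, l₂} : Finset V) = {l, o} := by
    rw [Finset.mem_insert, Finset.mem_singleton] at hmem
    rcases hmem with h | h
    · exact ⟨l₂, by rw [h]⟩
    · exact ⟨l₁, by rw [h, Finset.pair_comm]⟩
  have hiff : ∀ v, merge V₀ comp l₁ l₂ v = v → comp v = v := by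
    intro v hv
    unfold merge regroup at hv
    split_ifs at hv with h'
    · rw [← hv, ← hl]
      rw [Finset.mem_insert, Finset.mem_singleton] at hmem
      rcases hmem with h | h <;> rw [h] <;> assumption
    · exact hv
  have hiff' : ∀ v, comp v = v → v ≠ o → merge V₀ comp l₁ l₂ v = v := by
    intro v hv hvo
    unfold merge regroup
    rw [hv, ← hl, ho]
    split_ifs with h'
    · rw [Finset.mem_insert, Finset.mem_singleton] at h'
      exact (h'.resolve_right hvo).symm
    · rfl
  constructor
  · refine Finset.card_le_card fun v hv => ?_
    rw [Finset.mem_filter] at hv ⊢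
    exact ⟨hv.1, hiff v hv.2.1, hv.2.2⟩
  · refine (Finset.card_le_card (t := insert o
      (Finset.univ.filter fun v => merge V₀ comp l₁ l₂ v = v ∧ v ∉ V₀)) fun v hv => ?_).trans
      (Finset.card_insert_le _ _)
    rw [Finset.mem_filter] at hv
    rw [Finset.mem_insert, Finset.mem_filter]
    by_cases hvo : v = o
    · exact Or.inl hvo
    · exact Or.inr ⟨hv.1, hiff' v hv.2.1 hvo, hv.2.2⟩

/-- `comp` arises from `comp₀` by merging some of the classes that meet the ball `T` with the class
of its center, and at least `K` free classes are left if anything was merged. -/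
def Grown (G : SimpleGraph V) (d : V → V → ℕ) (V₀ : Set V) (K : ℤ) (comp₀ : V → V) (T : V × V)
    (comp : V → V) : Prop :=
  Labelling G V₀ comp ∧ ∃ (J : Finset V) (l : V), l ∈ J ∧ comp₀ T.1 ∈ J ∧
    (∀ l ∈ J, comp₀ l = l) ∧ (∀ l ∈ J, ∃ v ∈ pball G d T, comp₀ v = l) ∧
    comp = regroup comp₀ J l ∧ (comp = comp₀ ∨ K ≤ freeCount V₀ comp)

variable {d : V → V → ℕ}

theorem Grown.refl (h : Labelling G V₀ comp) (K : ℤ) (T : V × V) :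
    Grown G d V₀ K comp T comp := by
  have : comp = regroup comp {comp T.1} (comp T.1) := by
    funext v
    unfold regroup
    split_ifs with hv
    · exact Finset.mem_singleton.1 hv
    · rfl
  refine ⟨h, {comp T.1}, comp T.1, by simp, by simp, by simp [h.idem], ?_, this, Or.inl rfl⟩
  intro l hl
  exact ⟨T.1, self_mem_cball _ _, (Finset.mem_singleton.1 hl).symm⟩

/-- The class of `v` joins the group `J`. The free count exceeds `K` before the merge and drops by
at most one, so at least `K` free classes remain. -/
theorem Grown.step {K : ℤ} {comp₀ : V → V} {T : V × V} (h : Grown G d V₀ K comp₀ T comp)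
    (h₀ : Labelling G V₀ comp₀)
    {u v : V} (hv : v ∈ pball G d T) (huv : G.Adj u v)
    (hu' : comp u = comp T.1) (hv' : comp v ≠ comp T.1) (hK : K < freeCount V₀ comp) :
    Grown G d V₀ K comp₀ T (merge V₀ comp (comp T.1) (comp v)) := by
  obtain ⟨hlab, J, l, hl, hTJ, hJ, hit, rfl, hor⟩ := h
  have hTl : regroup comp₀ J l T.1 = l := (regroup_eq_iff hl _).2 hTJ
  have hvJ : comp₀ v ∉ J := fun hvJ => hv' (by rw [hTl]; exact (regroup_eq_iff hl v).2 hvJ)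
  have hvl : regroup comp₀ J l v = comp₀ v := if_neg hvJ
  rw [hTl, hvl]
  have hmem := newLabel_mem (V₀ := V₀) l (comp₀ v)
  have hmerge := hlab.merge huv
  have hcnt := freeCount_merge (V₀ := V₀) (hlab.idem u) (hlab.idem v)
  rw [hu', hTl, hvl] at hmerge hcnt
  refine ⟨hmerge, insert (comp₀ v) J, newLabel V₀ l (comp₀ v), ?_, Finset.mem_insert_of_mem hTJ,
    ?_, ?_, ?_, Or.inr (by omega)⟩
  · rw [Finset.mem_insert, Finset.mem_singleton] at hmem
    rcases hmem with h | h <;> rw [h]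
    · exact Finset.mem_insert_of_mem hl
    · exact Finset.mem_insert_self _ _
  · intro m hm
    rcases Finset.mem_insert.1 hm with rfl | hm
    · exact h₀.idem v
    · exact hJ m hm
  · intro m hm
    rcases Finset.mem_insert.1 hm with rfl | hm
    · exact ⟨v, hv, rfl⟩
    · exact hit m hm
  · funext x
    unfold merge
    by_cases hx : comp₀ x ∈ insert (comp₀ v) J
    · rw [show regroup comp₀ (insert (comp₀ v) J) (newLabel V₀ l (comp₀ v)) x = _ from if_pos hx]
      rw [regroup_eq_iff hmem]
      rcases Finset.mem_insert.1 hx with hx | hx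
      · have : regroup comp₀ J l x = comp₀ x := if_neg (by rw [hx]; exact hvJ)
        rw [this, hx]; simp
      · rw [(regroup_eq_iff hl x).2 hx]; simp
    · rw [show regroup comp₀ (insert (comp₀ v) J) (newLabel V₀ l (comp₀ v)) x = _ from if_neg hx]
      rw [Finset.mem_insert, not_or] at hx
      have : regroup comp₀ J l x = comp₀ x := if_neg hx.2
      have hx' : regroup comp₀ J l x ∉ ({l, comp₀ v} : Finset V) := by
        rw [this, Finset.mem_insert, Finset.mem_singleton]
        rintro (h | h)
        · exact hx.2 (h ▸ hl)
        · exact hx.1 h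
      rw [show regroup (regroup comp₀ J l) {l, comp₀ v} (newLabel V₀ l (comp₀ v)) x = _ from
        if_neg hx', this]

/-- Each class can be covered from a center of its own, at a cost that is bounded by the value of
the dual solution. -/
def Outcome (d : V → V → ℕ) (V₀ : Set V) (gam : V → ℕ) (lam : ℕ) (comp : V → V) (ρ : ℕ) : Prop :=
  ∃ (cen : V → V) (e : V → ℕ), (∀ l, comp l = l → comp (cen l) = l ∧
      ∀ v, comp v = l → d (cen l) v ≤ e l) ∧
    ∑ l with comp l = l, (e l + 3 * price V₀ lam l) ≤ 3 * ∑ v, gam v + 3 * ρ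

theorem sum_labels (hidem : ∀ v, comp (comp v) = comp v) (x : V → ℕ) :
    ∑ l with comp l = l, ∑ v with comp v = l, x v = ∑ v, x v :=
  Finset.sum_fiberwise_of_maps_to (fun v _ => by simp [hidem]) x

open Classical in
theorem sum_price (V₀ : Set V) (lam : ℕ) :
    ∑ l with comp l = l, price V₀ lam l = freeCount V₀ comp * lam := by
  unfold price freeCount
  rw [← Finset.filter_filter, ← smul_eq_mul, ← Finset.sum_const, Finset.sum_filter (s := Finset.filter _ _)]
  refine Finset.sum_congr rfl fun l _ => ?_
  by_cases h : l ∈ V₀ <;> simp [h]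

variable (d_self : ∀ u, d u u = 0) (symm : ∀ u v, d u v = d v u)
  (tri : ∀ u v w, d u w ≤ d u v + d v w) {gam : V → ℕ} {lam : ℕ} {F : Finset (V × V)}

include d_self symm tri

/-- Only the new class pays for the radius of `T`. All other classes are old ones and get their
centers from `exists_center_class`. -/
theorem Spanned.outcome_group (h : Spanned G d V₀ gam lam comp F)
    (hidem : ∀ v, comp (comp v) = comp v) (J : Finset V) (l : V) (hl : l ∈ J)
    (hJ : ∀ l ∈ J, comp l = l) (T : V × V) (hT1 : comp T.1 ∈ J)
    (hit : ∀ l ∈ J, ∃ v ∈ pball G d T, comp v = l) :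
    Outcome d V₀ gam lam (ConnectedMSR.regroup comp J l) (d T.1 T.2) := by
  set comp' := ConnectedMSR.regroup comp J l with hcomp'
  have hidem' : ∀ v, comp' (comp' v) = comp' v := by
    intro v
    by_cases hv : comp v ∈ J
    · rw [show comp' v = l from (regroup_eq_iff hl v).2 hv]
      exact (regroup_eq_iff hl l).2 (by rw [hJ l hl]; exact hl)
    · have : comp' v = comp v := if_neg hv
      rw [this]
      show ConnectedMSR.regroup comp J l (comp v) = comp v
      unfold ConnectedMSR.regroup
      rw [hidem, if_neg hv]
  have hex : ∀ m, comp' m = m → ∃ c, comp' c = m ∧ ∀ v, comp' v = m →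
      d c v + 3 * price V₀ lam m ≤ 3 * (∑ v with comp' v = m, gam v +
        if m = l then d T.1 T.2 else 0) := by
    intro m hm
    by_cases hml : m = l
    · subst hml
      simp_rw [hcomp', regroup_eq_iff hl, if_pos]
      exact h.exists_center_group d_self symm tri J m hl hJ T hT1 hit
    · have hiff := regroup_eq_iff_of_ne hml hm
      rw [← hcomp'] at hiff
      simp_rw [fun v => (hiff v).1, if_neg hml, add_zero]
      exact h.exists_center_class d_self symm tri (hiff m).2
  choose! cen hcen using hex
  refine ⟨cen, fun m => 3 * (∑ v with comp' v = m, gam v + if m = l then d T.1 T.2 else 0)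
    - 3 * price V₀ lam m, fun m hm => ⟨(hcen m hm).1, fun v hv => ?_⟩, ?_⟩
  · have := (hcen m hm).2 v hv
    dsimp only
    omega
  · have h1 : ∀ m ∈ Finset.univ.filter fun l => comp' l = l,
        3 * (∑ v with comp' v = m, gam v + if m = l then d T.1 T.2 else 0)
        - 3 * price V₀ lam m + 3 * price V₀ lam m =
        3 * (∑ v with comp' v = m, gam v + if m = l then d T.1 T.2 else 0) := by
      intro m hm
      rw [Finset.mem_filter] at hm
      have := (hcen m hm.2).2 (cen m) (hcen m hm.2).1
      omega
    rw [Finset.sum_congr rfl h1, ← Finset.mul_sum, Finset.sum_add_distrib, sum_labels hidem',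
      Finset.sum_ite_eq']
    split_ifs <;> omega

theorem Spanned.outcome (h : Spanned G d V₀ gam lam comp F) (hidem : ∀ v, comp (comp v) = comp v) :
    Outcome d V₀ gam lam comp 0 := by
  have hex : ∀ m, comp m = m → ∃ c, comp c = m ∧ ∀ v, comp v = m →
      d c v + 3 * price V₀ lam m ≤ 3 * ∑ v with comp v = m, gam v :=
    fun m hm => h.exists_center_class d_self symm tri hm
  choose! cen hcen using hex
  refine ⟨cen, fun m => 3 * ∑ v with comp v = m, gam v - 3 * price V₀ lam m,
    fun m hm => ⟨(hcen m hm).1, fun v hv => ?_⟩, ?_⟩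
  · have := (hcen m hm).2 v hv
    dsimp only
    omega
  · have h1 : ∀ m ∈ Finset.univ.filter fun l => comp l = l,
        3 * ∑ v with comp v = m, gam v - 3 * price V₀ lam m + 3 * price V₀ lam m =
        3 * ∑ v with comp v = m, gam v := by
      intro m hm
      rw [Finset.mem_filter] at hm
      have := (hcen m hm.2).2 (cen m) (hcen m hm.2).1
      omega
    rw [Finset.sum_congr rfl h1, ← Finset.mul_sum, sum_labels hidem]
    omega

end States

end ConnectedMSR

namespace ConnectedMSR


/-! ### The states of the primal-dual method, weak duality and the cost bound. -/

section Machine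

variable {V : Type*} [Fintype V] [DecidableEq V]

/-- The vertices covered by the guessed balls. -/
def bigSet (G : SimpleGraph V) (d : V → V → ℕ) (g : ℕ → V × V) (b : ℕ) : Set V :=
  {v | ∃ j < b, v ∈ pball G d (g j)}

/-- The dual budget paid for the guessed balls. -/
def budget (d : V → V → ℕ) (g : ℕ → V × V) (b : ℕ) (v : V) : ℕ :=
  ∑ j ∈ Finset.range b with (g j).1 = v, d (g j).1 (g j).2

/-- The state after the first `j` guessed balls have been merged. -/
structure BigState (G : SimpleGraph V) (d : V → V → ℕ) (g : ℕ → V × V) (b j : ℕ) (comp : V → V) :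
    Prop where
  part : Labelling G (bigSet G d g b) comp
  bigs : ∀ i < j, ∀ v ∈ pball G d (g i), comp v = comp (g i).1
  span : ∃ F, Spanned G d (bigSet G d g b) (budget d g b) 0 comp F

open Classical in
/-- The states of the main phase of the primal-dual algorithm. -/
structure PDState (G : SimpleGraph V) (d : V → V → ℕ) (g : ℕ → V × V) (b ρ K : ℕ) (α : V → ℕ)
    (lam : ℕ) (comp : V → V) : Prop where
  part : Labelling G (bigSet G d g b) comp
  bigs : ∀ i < b, ∀ v ∈ pball G d (g i), comp v = comp (g i).1
  zero : ∀ v ∈ bigSet G d g b, α v = 0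
  -- In a single round a ball that is not yet tight may gain one unit from each of several labels.
  -- The summand `Fintype.card V` absorbs this overshoot.
  feas : ∀ S : V × V, d S.1 S.2 ≤ ρ →
    ∑ v with v ∈ pball G d S, α v ≤ d S.1 S.2 + lam + Fintype.card V
  -- Every round so far has raised the duals of more than `K` free classes.
  rounds : K < freeCount (bigSet G d g b) comp → (K + 1) * lam ≤ ∑ v, α v
  above : K < freeCount (bigSet G d g b) comp →
    ∃ F, Spanned G d (bigSet G d g b) (fun v => α v + budget d g b v) lam comp F
  -- The alternative `lam = 0` is needed when the guessed balls alone leave at most `K` free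
  -- classes. There is then no price to cancel.
  below : freeCount (bigSet G d g b) comp ≤ K →
    Outcome d (bigSet G d g b) (fun v => α v + budget d g b v) lam comp ρ ∧
      (freeCount (bigSet G d g b) comp = K ∨ lam = 0)

variable {G : SimpleGraph V} {d : V → V → ℕ} {g : ℕ → V × V} {b ρ K lam : ℕ} {α : V → ℕ}
  {comp comp₀ : V → V}

theorem price_le (V₀ : Set V) (lam : ℕ) (l : V) : price V₀ lam l ≤ lam := by
  unfold price; split_ifs <;> omega

theorem sum_budget (d : V → V → ℕ) (g : ℕ → V × V) (b : ℕ) :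
    ∑ v, budget d g b v = ∑ j ∈ Finset.range b, d (g j).1 (g j).2 := by
  unfold budget
  exact Finset.sum_fiberwise_of_maps_to (fun _ _ => Finset.mem_univ _) _

theorem Outcome.mono {V₀ : Set V} {gam : V → ℕ} {lam ρ ρ' : ℕ}
    (h : Outcome d V₀ gam lam comp ρ) (hρ : ρ ≤ ρ') : Outcome d V₀ gam lam comp ρ' := by
  obtain ⟨cen, e, h1, h2⟩ := h
  exact ⟨cen, e, h1, by omega⟩

theorem BigState.init : BigState G d g b 0 id :=
  ⟨Labelling.id _ _, fun _ h => absurd h (Nat.not_lt_zero _), ∅, Spanned.init _ _⟩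

open Classical in
-- A guessed ball is tight from the start: its radius is deposited as budget at its center, and the
-- price is still zero.
theorem BigState.grow {j : ℕ} (h : BigState G d g b j comp₀) (hj : j < b) {K : ℤ}
    (hg : Grown G d (bigSet G d g b) K comp₀ (g j) comp)
    (mono : ∀ v ∈ pball G d (g j), comp v = comp (g j).1) : BigState G d g b (j + 1) comp := by
  obtain ⟨hlab, J, l, hl, hTJ, hJ, hit, rfl, -⟩ := hg
  obtain ⟨F, hF⟩ := h.span
  refine ⟨hlab, fun i hi v hv => ?_, insert (g j) F, ?_⟩
  · rcases Nat.lt_succ_iff_lt_or_eq.1 hi with hi | rfl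
    · exact regroup_congr _ _ (h.bigs i hi v hv)
    · exact mono v hv
  · refine hF.regroup J l hl hJ (g j) (fun v hv => ?_) hit ?_
    · rw [← regroup_eq_iff hl, mono v hv, regroup_eq_iff hl]
      exact hTJ
    · have h1 : price (bigSet G d g b) 0 l = 0 := Nat.le_zero.1 (price_le _ _ _)
      rw [h1, add_zero]
      refine le_trans ?_ (Finset.single_le_sum (f := budget d g b) (fun _ _ => Nat.zero_le _)
        (show (g j).1 ∈ _ from Finset.mem_filter.2 ⟨Finset.mem_univ _, self_mem_cball _ _⟩))
      exact Finset.single_le_sum (f := fun j => d (g j).1 (g j).2) (fun _ _ => Nat.zero_le _)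
        (Finset.mem_filter.2 ⟨Finset.mem_range.2 hj, rfl⟩)

section Metric

variable (d_self : ∀ u, d u u = 0) (symm : ∀ u v, d u v = d v u)
  (tri : ∀ u v w, d u w ≤ d u v + d v w)

include d_self symm tri

theorem PDState.init (h : BigState G d g b b comp) (ρ K : ℕ) :
    PDState G d g b ρ K (fun _ => 0) 0 comp := by
  obtain ⟨F, hF⟩ := h.span
  refine ⟨h.part, h.bigs, fun _ _ => rfl, by simp, by simp, fun _ => ⟨F, by simpa using hF⟩,
    fun _ => ⟨?_, Or.inr rfl⟩⟩
  simp only [zero_add]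
  exact (hF.outcome d_self symm tri h.part.idem).mono (Nat.zero_le _)

open Classical in
-- If more than `K` free classes remain, the ball has been absorbed entirely and tightness extends
-- the packing invariant. Otherwise the growth was stopped at exactly `K` free classes; the
-- invariant is given up, and the centers are fixed at an extra cost of at most `3 * ρ`.
theorem PDState.grow (h : PDState G d g b ρ K α lam comp₀)
    (hK : K < freeCount (bigSet G d g b) comp₀) {T : V × V} (hρ : d T.1 T.2 ≤ ρ)
    (tight : d T.1 T.2 + lam ≤ ∑ v with v ∈ pball G d T, α v)
    (hg : Grown G d (bigSet G d g b) K comp₀ T comp)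
    (mono : K < freeCount (bigSet G d g b) comp → ∀ v ∈ pball G d T, comp v = comp T.1) :
    PDState G d g b ρ K α lam comp := by
  obtain ⟨hlab, J, l, hl, hTJ, hJ, hit, rfl, hor⟩ := hg
  obtain ⟨F, hF⟩ := h.above hK
  refine ⟨hlab, fun i hi v hv => regroup_congr _ _ (h.bigs i hi v hv), h.zero, h.feas,
    fun _ => h.rounds hK, fun hK' => ⟨insert T F, ?_⟩, fun hK' => ⟨?_, Or.inl ?_⟩⟩
  · refine hF.regroup J l hl hJ T (fun v hv => ?_) hit ?_
    · rw [← regroup_eq_iff hl, mono hK' v hv, regroup_eq_iff hl]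
      exact hTJ
    · rw [Finset.sum_add_distrib]
      have := price_le (bigSet G d g b) lam l
      omega
  · exact (hF.outcome_group d_self symm tri h.part.idem J l hl hJ T hTJ hit).mono hρ
  · rcases hor with hor | hor
    · rw [hor] at hK'; omega
    · omega

end Metric

open Classical in
-- Near feasibility survives for two reasons. A tight ball lies in one class by `mono`, so it
-- contains at most one label and gains at most one unit, as does `lam`. A ball that is not tight
-- lies strictly below `d + lam` and gains at most the number of vertices.
theorem PDState.raise (h : PDState G d g b ρ K α lam comp)
    (hK : K < freeCount (bigSet G d g b) comp)
    (mono : ∀ T : V × V, d T.1 T.2 ≤ ρ → d T.1 T.2 + lam ≤ ∑ v with v ∈ pball G d T, α v →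
      ∀ v ∈ pball G d T, comp v = comp T.1) :
    PDState G d g b ρ K (fun v => α v + if comp v = v ∧ v ∉ bigSet G d g b then 1 else 0)
      (lam + 1) comp := by
  obtain ⟨F, hF⟩ := h.above hK
  refine ⟨h.part, h.bigs, fun v hv => by simp [h.zero v hv, hv], fun S hS => ?_, fun _ => ?_,
    fun _ => ⟨F, ?_⟩, fun hK' => absurd hK' (by omega)⟩
  · rw [Finset.sum_add_distrib]
    have h1 := h.feas S hS
    by_cases ht : d S.1 S.2 + lam ≤ ∑ v with v ∈ pball G d S, α v
    · have h2 : ∑ v with v ∈ pball G d S, (if comp v = v ∧ v ∉ bigSet G d g b then 1 else 0) ≤ 1 := by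
        rw [← Finset.card_filter, Finset.card_le_one]
        intro u hu v hv
        simp only [Finset.mem_filter, Finset.mem_univ, true_and] at hu hv
        rw [← hu.2.1, ← hv.2.1, mono S hS ht u hu.1, mono S hS ht v hv.1]
      omega
    · have h2 : ∑ v with v ∈ pball G d S, (if comp v = v ∧ v ∉ bigSet G d g b then 1 else 0) ≤
          Fintype.card V := by
        rw [← Finset.card_filter]
        exact Finset.card_le_univ _
      omega
  · have := h.rounds hK
    rw [Finset.sum_add_distrib, mul_add]
    unfold freeCount at hK
    rw [← Finset.card_filter]
    omega
  · convert hF.raise using 2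
    omega

/-- Each guessed ball lies in one class, so at most `b` labels belong to the vertices covered by
guessed balls. With `K = k - b` this leaves at most `k` clusters. -/
theorem PDState.card_labels_le (h : PDState G d g b ρ K α lam comp) :
    (Finset.univ.filter fun v => comp v = v).card ≤ freeCount (bigSet G d g b) comp + b := by
  classical
  have h1 : (Finset.univ.filter fun v => comp v = v) ⊆
      (Finset.univ.filter fun v => comp v = v ∧ v ∉ bigSet G d g b) ∪
        (Finset.range b).image fun j => comp (g j).1 := by
    intro v hv
    rw [Finset.mem_filter] at hv
    by_cases hvb : v ∈ bigSet G d g b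
    · obtain ⟨j, hj, hvj⟩ := hvb
      exact Finset.mem_union_right _ (Finset.mem_image.2 ⟨j, Finset.mem_range.2 hj, by
        rw [← h.bigs j hj v hvj, hv.2]⟩)
    · exact Finset.mem_union_left _ (Finset.mem_filter.2 ⟨hv.1, hv.2, hvb⟩)
  refine (Finset.card_le_card h1).trans ((Finset.card_union_le _ _).trans ?_)
  have h2 := (Finset.card_image_le (s := Finset.range b) (f := fun j => comp (g j).1))
  rw [Finset.card_range] at h2
  unfold freeCount
  convert Nat.add_le_add_left h2 _

/-- Weak duality. The balls `T i` stand for the clusters of an optimal solution that were not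
guessed; vertices in guessed balls have dual value zero and need no cover. -/
theorem PDState.sum_le (h : PDState G d g b ρ K α lam comp) {ι : Type*} (I : Finset ι)
    (T : ι → V × V) (hT : ∀ i ∈ I, d (T i).1 (T i).2 ≤ ρ)
    (cover : ∀ v ∉ bigSet G d g b, ∃ i ∈ I, v ∈ pball G d (T i)) :
    ∑ v, α v ≤ ∑ i ∈ I, d (T i).1 (T i).2 + I.card * (lam + Fintype.card V) := by
  classical
  have h1 : ∑ v, α v ≤ ∑ i ∈ I, ∑ v with v ∈ pball G d (T i), α v := by
    simp_rw [Finset.sum_filter]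
    rw [Finset.sum_comm]
    refine Finset.sum_le_sum fun v _ => ?_
    by_cases hv : v ∈ bigSet G d g b
    · rw [h.zero v hv]; exact Nat.zero_le _
    · obtain ⟨i, hi, hvi⟩ := cover v hv
      refine le_trans ?_ (Finset.single_le_sum (fun _ _ => Nat.zero_le _) hi)
      rw [if_pos hvi]
  have h2 : ∑ i ∈ I, ∑ v with v ∈ pball G d (T i), α v ≤
      ∑ i ∈ I, (d (T i).1 (T i).2 + (lam + Fintype.card V)) :=
    Finset.sum_le_sum fun i hi => by
      have := h.feas (T i) (hT i hi)
      rw [← add_assoc]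
      convert this using 1
  rw [Finset.sum_add_distrib, Finset.sum_const, smul_eq_mul] at h2
  exact h1.trans h2

/-- With more than `K` free classes the duals are at least `(K + 1) * lam`, while weak duality
bounds them by `K * ρ + K * (lam + n)`, where `n` is the number of vertices. Hence `lam ≤ K * (ρ +
n)`, which bounds the number of rounds that are needed. -/
theorem PDState.freeCount_le (h : PDState G d g b ρ K α lam comp) {ι : Type*} (I : Finset ι)
    (T : ι → V × V) (hI : I.card = K) (hT : ∀ i ∈ I, d (T i).1 (T i).2 ≤ ρ)
    (cover : ∀ v ∉ bigSet G d g b, ∃ i ∈ I, v ∈ pball G d (T i))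
    (hlam : K * (ρ + Fintype.card V) < lam) : freeCount (bigSet G d g b) comp ≤ K := by
  by_contra hK
  have h1 := h.rounds (not_le.1 hK)
  have h2 := h.sum_le I T hT cover
  have h3 := Finset.sum_le_card_nsmul I (fun i => d (T i).1 (T i).2) ρ hT
  rw [hI] at h2 h3
  rw [smul_eq_mul] at h3
  rw [mul_add] at hlam h2
  rw [add_mul] at h1
  omega

/-- The `K` free classes are credited with `3 * K * lam` in the outcome, and weak duality charges
exactly this amount, so the price drops out. The guessed radii enter through the budget. -/
theorem PDState.centers (h : PDState G d g b ρ K α lam comp) {ι : Type*} (I : Finset ι)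
    (T : ι → V × V) (hI : I.card = K) (hT : ∀ i ∈ I, d (T i).1 (T i).2 ≤ ρ)
    (cover : ∀ v ∉ bigSet G d g b, ∃ i ∈ I, v ∈ pball G d (T i))
    (hK : freeCount (bigSet G d g b) comp ≤ K) :
    ∃ (cen : V → V) (e : V → ℕ), (∀ l, comp l = l → comp (cen l) = l ∧
      ∀ v, comp v = l → d (cen l) v ≤ e l) ∧
      ∑ l with comp l = l, e l ≤ 3 * (∑ j ∈ Finset.range b, d (g j).1 (g j).2 +
        ∑ i ∈ I, d (T i).1 (T i).2) + 3 * ρ + 3 * (K * Fintype.card V) := by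
  obtain ⟨⟨cen, e, hcen, hsum⟩, hor⟩ := h.below hK
  refine ⟨cen, e, hcen, ?_⟩
  have h2 := h.sum_le I T hT cover
  rw [Finset.sum_add_distrib, ← Finset.mul_sum, sum_price, Finset.sum_add_distrib,
    sum_budget] at hsum
  rw [hI, mul_add] at h2
  rcases hor with hor | hor
  · rw [hor] at hsum
    omega
  · rw [hor, mul_zero] at h2 hsum
    omega

end Machine

end ConnectedMSR

namespace ConnectedMSR


/-! ### Rescaled distances and the guess taken from an optimal solution. -/

section Scaling

variable {V : Type*}

/-- The distances, rescaled from `R` to `N` and rounded up. -/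
def scaled (D : V → V → ℕ) (N R : ℕ) (u v : V) : ℕ := (D u v * N + (R - 1)) / R

variable {D : V → V → ℕ} {N R : ℕ}

theorem scaled_mono {u v u' v' : V} (h : D u v ≤ D u' v') : scaled D N R u v ≤ scaled D N R u' v' :=
  Nat.div_le_div_right (Nat.add_le_add_right (Nat.mul_le_mul_right _ h) _)

theorem mul_le_mul_scaled (hR : 0 < R) (u v : V) : D u v * N ≤ R * scaled D N R u v := by
  have := Nat.lt_mul_div_succ (D u v * N + (R - 1)) hR
  rw [Nat.mul_add_one] at this
  unfold scaled
  omega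

theorem mul_scaled_le (u v : V) : R * scaled D N R u v ≤ D u v * N + (R - 1) :=
  Nat.mul_div_le _ _

theorem scaled_le (h : D u v ≤ R) : scaled D N R u v ≤ N := by
  rcases Nat.eq_zero_or_pos R with rfl | hR
  · simp [scaled]
  · refine Nat.lt_succ_iff.1 ((Nat.div_lt_iff_lt_mul hR).2 ?_)
    have := Nat.mul_le_mul_right N h
    rw [Nat.succ_mul, mul_comm N R]
    omega

theorem scaled_self (d_self : ∀ u, D u u = 0) (u : V) : scaled D N R u u = 0 := by
  unfold scaled
  rw [d_self, zero_mul, zero_add]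
  rcases Nat.eq_zero_or_pos R with rfl | hR
  · rfl
  · exact Nat.div_eq_of_lt (by omega)

theorem scaled_symm (symm : ∀ u v, D u v = D v u) (u v : V) :
    scaled D N R u v = scaled D N R v u := by
  unfold scaled; rw [symm]

/-- Rounding up is subadditive, whereas rounding down would destroy the triangle inequality. For `R
= 0` all rescaled distances are zero. -/
theorem scaled_tri (tri : ∀ u v w, D u w ≤ D u v + D v w) (u v w : V) :
    scaled D N R u w ≤ scaled D N R u v + scaled D N R v w := by
  rcases Nat.eq_zero_or_pos R with rfl | hR
  · simp [scaled]
  · refine Nat.lt_succ_iff.1 ((Nat.div_lt_iff_lt_mul hR).2 ?_)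
    have h1 := mul_le_mul_scaled (D := D) (N := N) hR u v
    have h2 := mul_le_mul_scaled (D := D) (N := N) hR v w
    have h3 := Nat.mul_le_mul_right N (tri u v w)
    rw [add_mul] at h3
    rw [Nat.succ_mul, mul_comm _ R, mul_add]
    omega

variable [Fintype V] [DecidableEq V]

/-- The radius of the class with label `l`, measured from `c`. -/
def classRadius (D : V → V → ℕ) (comp : V → V) (l c : V) : ℕ :=
  (Finset.univ.filter fun v => comp v = l).sup fun v => D c v

/-- A path inside the connected cluster never leaves the ball around the center. -/
theorem Solution.subset_cball {G : SimpleGraph V} {k : ℕ} (S : Solution G k) {d : V → V → ℕ}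
    {i : Fin k} {r : ℕ} (h : ∀ v, S.label v = i → d (S.center i) v ≤ r) {v : V}
    (hv : S.label v = i) : v ∈ cball G d (S.center i) r := by
  have h1 := (S.connected i).preconnected ⟨S.center i, S.center_mem i⟩ ⟨v, hv⟩
  rw [SimpleGraph.reachable_iff_reflTransGen] at h1
  have h2 := Relation.ReflTransGen.lift (p := fun u v => G.Adj u v ∧ d (S.center i) v ≤ r)
    (fun x : {v | S.label v = i} => (x : V)) (fun x y hxy => ⟨hxy, h y y.2⟩) _ _ h1
  exact h2

theorem Solution.card_le {G : SimpleGraph V} {k : ℕ} (S : Solution G k) : k ≤ Fintype.card V := by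
  have : Function.Injective S.center := fun i j h => by
    rw [← S.center_mem i, h, S.center_mem]
  simpa using Fintype.card_le_of_injective _ this

/-- The threshold for the radii that are not guessed. -/
def threshold (d : V → V → ℕ) (g : ℕ → V × V) (b k : ℕ) : ℕ :=
  if 0 < k - b then d (g (b - 1)).1 (g (b - 1)).2 else 0

/-- The guess lists the clusters of `S` by decreasing radius, each as its center with a farthest
vertex. Thus `R = D (g 0).1 (g 0).2` is the largest radius, and the threshold is the rescaled radius
of the last guessed cluster. The first conclusion says how many rounds are enough. In the second, `3
* C` is the price of the threshold, which is at most `1 / L` of the cost of `S` before rounding. The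
term `9 * L` collects the rounding of radii and threshold and the overshoot of the duals. -/
theorem exists_guess {G : SimpleGraph V}
    {k L C : ℕ} (hk : 2 ≤ k) (hL : 1 ≤ L) (S : Solution G k) :
    ∃ g : ℕ → V × V, ∀ α lam comp,
      PDState G (scaled D (C * Fintype.card V ^ 2) (D (g 0).1 (g 0).2)) g (min L k)
        (threshold (scaled D (C * Fintype.card V ^ 2) (D (g 0).1 (g 0).2)) g (min L k) k)
        (k - min L k) α lam comp →
      (Fintype.card V * (C * Fintype.card V ^ 2 + Fintype.card V) < lam →
        freeCount (bigSet G (scaled D (C * Fintype.card V ^ 2) (D (g 0).1 (g 0).2)) g (min L k))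
          comp ≤ k - min L k) ∧
      (freeCount (bigSet G (scaled D (C * Fintype.card V ^ 2) (D (g 0).1 (g 0).2)) g (min L k))
          comp ≤ k - min L k →
        ∃ cen : V → V, (∀ l, comp l = l → comp (cen l) = l) ∧
          ((∃ i v, S.label v = i ∧ 0 < D (S.center i) v) → C * L * ∑ l with comp l = l, classRadius D comp l (cen l) ≤
            (3 * C * L + 3 * C + 9 * L) * ∑ i, classRadius D (fun v => S.center (S.label v))
              (S.center i) (S.center i))) := by
  set n := Fintype.card V with hn
  set N := C * n ^ 2 with hN
  have hkn : k ≤ n := S.card_le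
  set b := min L k with hb
  have hb1 : 1 ≤ b := by omega
  have hinj : ∀ v i, S.center (S.label v) = S.center i ↔ S.label v = i := fun v i =>
    ⟨fun h => by rw [← S.center_mem i, ← h, S.center_mem], fun h => by rw [h]⟩
  have hwit : ∀ i, ∃ w, S.label w = i ∧ ∀ v, S.label v = i → D (S.center i) v ≤ D (S.center i) w := by
    intro i
    obtain ⟨w, hw, hw'⟩ := Finset.exists_max_image (Finset.univ.filter fun v => S.label v = i)
      (fun v => D (S.center i) v) ⟨S.center i, by simp [S.center_mem]⟩
    exact ⟨w, (Finset.mem_filter.1 hw).2, fun v hv => hw' v (by simp [hv])⟩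
  choose w hw hwmax using hwit
  set r : Fin k → ℕ := fun i => D (S.center i) (w i) with hr
  have hrad : ∀ i, classRadius D (fun v => S.center (S.label v)) (S.center i) (S.center i) = r i := by
    intro i
    unfold classRadius
    simp_rw [hinj]
    refine le_antisymm (Finset.sup_le fun v hv => hwmax i v (Finset.mem_filter.1 hv).2) ?_
    exact Finset.le_sup (f := fun v => D (S.center i) v) (by simp [hw])
  set σ : Equiv.Perm (Fin k) := Tuple.sort fun i => OrderDual.toDual (r i) with hσ
  have hmono : ∀ i j, i ≤ j → r (σ j) ≤ r (σ i) := fun i j hij =>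
    Tuple.monotone_sort (fun i => OrderDual.toDual (r i)) hij
  set T : Fin k → V × V := fun i => (S.center (σ i), w (σ i)) with hT
  -- The values from index `k` on are never used.
  set g : ℕ → V × V := fun j => if h : j < k then T ⟨j, h⟩ else T ⟨0, by omega⟩ with hg
  have hgT : ∀ j (h : j < k), g j = T ⟨j, h⟩ := fun j h => dif_pos h
  set x : ℕ → ℕ := fun j => D (g j).1 (g j).2 with hx
  have hxr : ∀ j (h : j < k), x j = r (σ ⟨j, h⟩) := fun j h => by
    rw [hx]; dsimp only; rw [hgT j h]
  have hanti : ∀ i j, i ≤ j → j < k → x j ≤ x i := fun i j hij hj => by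
    rw [hxr j hj, hxr i (by omega)]; exact hmono _ _ hij
  have hsumx : ∑ j ∈ Finset.range k, x j = ∑ i, r i := by
    rw [Finset.sum_range, ← Equiv.sum_comp σ r]
    exact Finset.sum_congr rfl fun i _ => hxr i i.2
  set R := x 0 with hR
  have hRsum : R ≤ ∑ i, r i := by
    rw [← hsumx]
    exact Finset.single_le_sum (f := x) (fun _ _ => Nat.zero_le _) (Finset.mem_range.2 (by omega))
  refine ⟨g, fun α lam comp hst => ?_⟩
  change PDState G (scaled D N R) g b _ _ α lam comp at hst
  change (_ → freeCount (bigSet G (scaled D N R) g b) comp ≤ _) ∧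
    (freeCount (bigSet G (scaled D N R) g b) comp ≤ _ → _)
  change PDState G (scaled D N R) g b (threshold (scaled D N R) g b k) _ α lam comp at hst
  have hthr : ∀ j ∈ Finset.Ico b k, scaled D N R (g j).1 (g j).2 ≤
      threshold (scaled D N R) g b k := by
    intro j hj
    rw [Finset.mem_Ico] at hj
    unfold threshold
    rw [if_pos (by omega)]
    exact scaled_mono (hanti (b - 1) j (by omega) hj.2)
  have hcov : ∀ v ∉ bigSet G (scaled D N R) g b,
      ∃ j ∈ Finset.Ico b k, v ∈ pball G (scaled D N R) (g j) := by
    -- A vertex outside the guessed balls belongs to a cluster of index at least `b`, since each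
    -- cluster is contained in its connected ball.
    intro v hv
    have hvj : v ∈ pball G (scaled D N R) (g (σ.symm (S.label v))) := by
      rw [hgT _ (σ.symm (S.label v)).2, hT]
      simp only [Fin.eta, Equiv.apply_symm_apply]
      exact S.subset_cball (fun u hu => scaled_mono (hwmax _ u hu)) rfl
    refine ⟨σ.symm (S.label v), Finset.mem_Ico.2 ⟨?_, (σ.symm (S.label v)).2⟩, hvj⟩
    by_contra hlt
    exact hv ⟨_, not_le.1 hlt, hvj⟩
  have hcard : (Finset.Ico b k).card = k - b := Nat.card_Ico _ _
  have hthrN : threshold (scaled D N R) g b k ≤ N := by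
    unfold threshold
    split_ifs with h
    · exact scaled_le (hanti 0 (b - 1) (Nat.zero_le _) (by omega))
    · exact Nat.zero_le _
  constructor
  · intro hlam
    refine hst.freeCount_le (Finset.Ico b k) g hcard hthr hcov (lt_of_le_of_lt ?_ hlam)
    exact Nat.mul_le_mul (by omega) (Nat.add_le_add_right hthrN _)
  · intro hq
    obtain ⟨cen, e, hcen, hsum⟩ := hst.centers (Finset.Ico b k) g hcard hthr hcov hq
    refine ⟨cen, fun l hl => (hcen l hl).1, fun hpos => ?_⟩
    have hRpos : 0 < R := by
      obtain ⟨i, v, hv, hpos⟩ := hpos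
      have h1 : r i ≤ R := by
        have h2 := hmono ⟨0, by omega⟩ (σ.symm i) (Fin.mk_le_of_le_val (Nat.zero_le _))
        rw [σ.apply_symm_apply] at h2
        exact h2.trans (hxr 0 (by omega)).ge
      exact lt_of_lt_of_le hpos ((hwmax i v hv).trans h1)
    simp_rw [hrad]
    rw [Finset.sum_range_add_sum_Ico (fun j => scaled D N R (g j).1 (g j).2)
      (Nat.min_le_right L k : b ≤ k)] at hsum
    have h1 : N * ∑ l with comp l = l, classRadius D comp l (cen l) ≤
        R * ∑ l with comp l = l, e l := by
      rw [Finset.mul_sum, Finset.mul_sum]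
      refine Finset.sum_le_sum fun l hl => ?_
      obtain ⟨v, hv, hv'⟩ := Finset.exists_mem_eq_sup (Finset.univ.filter fun v => comp v = l)
        ⟨l, by simpa using hl⟩ (fun v => D (cen l) v)
      unfold classRadius
      rw [hv', mul_comm N]
      refine (mul_le_mul_scaled hRpos _ _).trans (Nat.mul_le_mul_left _ ?_)
      exact (hcen l (by simpa using hl)).2 v (by simpa using hv)
    have h2 : R * ∑ j ∈ Finset.range k, scaled D N R (g j).1 (g j).2 ≤
        N * (∑ i, r i) + k * R := by
      rw [← hsumx, Finset.mul_sum, Finset.mul_sum]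
      have : ∑ j ∈ Finset.range k, (N * x j + R) = ∑ j ∈ Finset.range k, N * x j + k * R := by
        rw [Finset.sum_add_distrib, Finset.sum_const, Finset.card_range, smul_eq_mul]
      rw [← this]
      refine Finset.sum_le_sum fun j _ => (mul_scaled_le _ _).trans ?_
      rw [mul_comm N]
      exact Nat.add_le_add_left (by omega) _
    have h3 : L * (R * threshold (scaled D N R) g b k) ≤ N * ∑ i, r i + L * R := by
      unfold threshold
      split_ifs with h
      · have hbL : b = L := by omega
        -- The `L` largest radii are all at least the last one of them.
        have h4 : L * x (b - 1) ≤ ∑ i, r i := by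
          rw [← hsumx]
          have : ∑ j ∈ Finset.range b, x j ≤ ∑ j ∈ Finset.range k, x j :=
            Finset.sum_le_sum_of_subset (Finset.range_mono (by omega))
          refine le_trans ?_ this
          have h5 := Finset.card_nsmul_le_sum (Finset.range b) x (x (b - 1)) (fun j hj => by
            rw [Finset.mem_range] at hj
            exact hanti j (b - 1) (by omega) (by omega))
          rw [Finset.card_range, smul_eq_mul] at h5
          rwa [← hbL]
        have h5 : R * scaled D N R (g (b - 1)).1 (g (b - 1)).2 ≤ x (b - 1) * N + R :=
          (mul_scaled_le _ _).trans (Nat.add_le_add_left (by omega) _)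
        calc L * (R * scaled D N R (g (b - 1)).1 (g (b - 1)).2)
            ≤ L * (x (b - 1) * N + R) := Nat.mul_le_mul_left _ h5
          _ = N * (L * x (b - 1)) + L * R := by ring
          _ ≤ _ := Nat.add_le_add_right (Nat.mul_le_mul_left _ h4) _
      · rw [mul_zero, mul_zero]; exact Nat.zero_le _
    have hn2 : 2 ≤ n := by omega
    -- The error counted in units of the rescaled distances: one for each of the `k` radii, one for
    -- the threshold, and `n` for each cluster that is not guessed, all taken three times. A unit is
    -- worth `R / N`, hence at most the cost of `S` divided by `C * n ^ 2`.
    have h6 : 3 * k + 3 + 3 * ((k - b) * n) ≤ 9 * n ^ 2 := by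
      have : (k - b) * n ≤ n * n := Nat.mul_le_mul_right _ (by omega)
      nlinarith
    have h7 := Nat.mul_le_mul_left R hsum
    have h8 := Nat.mul_le_mul_left (L * R) h6
    have h9 : n ^ 2 * (C * L * ∑ l with comp l = l, classRadius D comp l (cen l)) ≤
        n ^ 2 * ((3 * C * L + 3 * C + 9 * L) * ∑ i, r i) := by
      calc n ^ 2 * (C * L * ∑ l with comp l = l, classRadius D comp l (cen l))
          = L * (N * ∑ l with comp l = l, classRadius D comp l (cen l)) := by rw [hN]; ring
        _ ≤ L * (R * (3 * (∑ j ∈ Finset.range k, scaled D N R (g j).1 (g j).2)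
            + 3 * threshold (scaled D N R) g b k + 3 * ((k - b) * n))) :=
            Nat.mul_le_mul_left _ (h1.trans h7)
        _ = 3 * (L * (R * ∑ j ∈ Finset.range k, scaled D N R (g j).1 (g j).2)) +
            3 * (L * (R * threshold (scaled D N R) g b k)) + L * R * (3 * ((k - b) * n)) := by ring
        _ ≤ 3 * (L * (N * (∑ i, r i) + k * R)) + 3 * (N * ∑ i, r i + L * R)
            + L * R * (3 * ((k - b) * n)) := by gcongr
        _ = 3 * L * N * (∑ i, r i) + 3 * N * (∑ i, r i) +
            L * R * (3 * k + 3 + 3 * ((k - b) * n)) := by ring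
        _ ≤ 3 * L * N * (∑ i, r i) + 3 * N * (∑ i, r i) + L * R * (9 * n ^ 2) := by gcongr
        _ ≤ 3 * L * N * (∑ i, r i) + 3 * N * (∑ i, r i) + L * (∑ i, r i) * (9 * n ^ 2) := by gcongr
        _ = _ := by rw [hN]; ring
    exact Nat.le_of_mul_le_mul_left h9 (by positivity)

end Scaling

end ConnectedMSR

/-! ### Programs with bounded loops, their semantics, translation and cost. -/

namespace RAM

/-- Programs with bounded loops: `loop x b p` repeats `p` as often as cell `0` of array `b` says,
while cell `0` of array `x` counts the rounds. -/
inductive Cmd where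
  | skip
  | store (a : ℕ) (i e : Expr)
  | seq (p q : Cmd)
  | ite (e : Expr) (p q : Cmd)
  | loop (x b : ℕ) (p : Cmd)

/-- The memory after `t` rounds of a loop with counter `x`. -/
def loopState (f : Memory → Memory) (x : ℕ) (m : Memory) : ℕ → Memory
  | 0 => m.write x 0 0
  | t + 1 => (f (loopState f x m t)).write x 0 (t + 1)

namespace Cmd

/-- The effect of a program. -/
def run : Cmd → Memory → Memory
  | skip, m => m
  | store a i e, m => m.write a (i.val m) (e.val m)
  | seq p q, m => q.run (p.run m)
  | ite e p q, m => if 0 < e.val m then p.run m else q.run m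
  | loop x b p, m => loopState p.run x m (m b 0).toNat

/-- The translation into programs of the machine. -/
def compile : Cmd → Program
  | skip => .skip
  | store a i e => .store a i e
  | seq p q => .seq p.compile q.compile
  | ite e p q => .ifPos e p.compile q.compile
  | loop x b p => .seq (.store x (.const 0) (.const 0))
      (.whilePos (.sub (.load b (.const 0)) (.load x (.const 0)))
        (.seq p.compile (.store x (.const 0) (.add (.load x (.const 0)) (.const 1)))))

/-- Whether a program writes to array `a`. -/
def wr : Cmd → ℕ → Bool
  | skip, _ => false
  | store b _ _, a => a == b
  | seq p q, a => p.wr a || q.wr a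
  | ite _ p q, a => p.wr a || q.wr a
  | loop x _ p, a => a == x || p.wr a

/-- The loops do not interfere with their counters and bounds. -/
def wf : Cmd → Bool
  | skip => true
  | store _ _ _ => true
  | seq p q => p.wf && q.wf
  | ite _ p q => p.wf && q.wf
  | loop x b p => !(x == b) && !p.wr x && !p.wr b && p.wf

end Cmd

theorem Memory.write_same (m : Memory) (a : ℕ) (i x : ℤ) : m.write a i x a i = x := by
  simp [Memory.write]

theorem Memory.write_ne (m : Memory) {a b : ℕ} (i x : ℤ) (h : b ≠ a) : m.write a i x b = m b := by
  funext j; simp [Memory.write, h]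

theorem Memory.write_cell_ne (m : Memory) (a : ℕ) {i j : ℤ} (x : ℤ) (h : j ≠ i) :
    m.write a i x a j = m a j := by
  simp [Memory.write, h]

namespace Cmd

theorem run_frame (c : Cmd) (m : Memory) {a : ℕ} (h : c.wr a = false) : c.run m a = m a := by
  induction c generalizing m with
  | skip => rfl
  | store b i e => exact Memory.write_ne _ _ _ (by simpa [wr] using h)
  | seq p q ihp ihq =>
    simp only [wr, Bool.or_eq_false_iff] at h
    exact (ihq _ h.2).trans (ihp _ h.1)
  | ite e p q ihp ihq =>
    simp only [wr, Bool.or_eq_false_iff] at h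
    simp only [run]
    split_ifs
    · exact ihp _ h.1
    · exact ihq _ h.2
  | loop x b p ih =>
    simp only [wr, Bool.or_eq_false_iff, beq_eq_false_iff_ne] at h
    simp only [run]
    induction (m b 0).toNat with
    | zero => exact Memory.write_ne _ _ _ h.1
    | succ t iht =>
      rw [loopState, Memory.write_ne _ _ _ h.1, ih _ h.2, iht]

/-- The invariant rule for loops. -/
theorem loopState_inv {x b : ℕ} {p : Cmd} {m : Memory} {I : ℕ → Memory → Prop} (T : ℕ)
    (h0 : I 0 m) (hx : ∀ t m' z, I t m' → I t (m'.write x 0 z))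
    (step : ∀ t < T, ∀ m' : Memory, (∀ a, (loop x b p).wr a = false → m' a = m a) → m' x 0 = t →
      I t m' → I (t + 1) (p.run m')) : ∀ t ≤ T,
    I t (loopState p.run x m t) ∧ loopState p.run x m t x 0 = t ∧
      ∀ a, (loop x b p).wr a = false → loopState p.run x m t a = m a := by
  intro t
  induction t with
  | zero =>
    intro _
    refine ⟨hx _ _ _ h0, Memory.write_same _ _ _ _, fun a ha => ?_⟩
    simp only [wr, Bool.or_eq_false_iff, beq_eq_false_iff_ne] at ha
    exact Memory.write_ne _ _ _ ha.1
  | succ t ih =>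
    intro ht
    obtain ⟨h1, h2, h3⟩ := ih (by omega)
    refine ⟨hx _ _ _ (step t (by omega) _ h3 h2 h1), ?_, fun a ha => ?_⟩
    · rw [loopState, Memory.write_same]; push_cast; rfl
    · have ha' := ha
      simp only [wr, Bool.or_eq_false_iff, beq_eq_false_iff_ne] at ha
      rw [loopState, Memory.write_ne _ _ _ ha.1, run_frame _ _ ha.2, h3 a ha']

theorem run_loop_inv {x b : ℕ} {p : Cmd} {m : Memory} {I : ℕ → Memory → Prop} (T : ℕ)
    (hT : m b 0 = T) (h0 : I 0 m) (hx : ∀ t m' z, I t m' → I t (m'.write x 0 z))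
    (step : ∀ t < T, ∀ m' : Memory, (∀ a, (loop x b p).wr a = false → m' a = m a) → m' x 0 = t →
      I t m' → I (t + 1) (p.run m')) : I T ((loop x b p).run m) := by
  have := (loopState_inv (b := b) T h0 hx step T le_rfl).1
  rwa [run, hT, Int.toNat_natCast]

end Cmd

/-! ### Running times -/

/-- A bound for the number of steps to evaluate an expression, if the operands of all
multiplications and divisions have bit length at most `W`. -/
def Expr.bound {R : Type*} [CommSemiring R] (W : R) : Expr → R
  | .const _ => 1
  | .load _ i => i.bound W + 1
  | .add e f => e.bound W + f.bound W + 1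
  | .sub e f => e.bound W + f.bound W + 1
  | .mul e f => e.bound W + f.bound W + W + W + 1
  | .div e f => e.bound W + f.bound W + W + W + 1

/-- The operands of all multiplications and divisions have bit length at most `W`. -/
def Expr.Cheap (W : ℕ) (m : Memory) : Expr → Prop
  | .const _ => True
  | .load _ i => i.Cheap W m
  | .add e f => e.Cheap W m ∧ f.Cheap W m
  | .sub e f => e.Cheap W m ∧ f.Cheap W m
  | .mul e f => e.Cheap W m ∧ f.Cheap W m ∧ bitLength (e.val m) ≤ W ∧ bitLength (f.val m) ≤ W
  | .div e f => e.Cheap W m ∧ f.Cheap W m ∧ bitLength (e.val m) ≤ W ∧ bitLength (f.val m) ≤ W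

/-- There are no multiplications and divisions. -/
def Expr.additive : Expr → Bool
  | .const _ => true
  | .load _ i => i.additive
  | .add e f => e.additive && f.additive
  | .sub e f => e.additive && f.additive
  | .mul _ _ => false
  | .div _ _ => false

theorem Expr.Cheap.steps_le {W : ℕ} {m : Memory} {e : Expr} (h : e.Cheap W m) :
    e.steps m ≤ e.bound W := by
  induction e with
  | const => exact le_rfl
  | load a i ih => exact Nat.add_le_add_right (ih h) 1
  | add e f ihe ihf | sub e f ihe ihf =>
    have := ihe h.1; have := ihf h.2
    simp only [Expr.steps, Expr.bound]; omega
  | mul e f ihe ihf | div e f ihe ihf =>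
    have := ihe h.1; have := ihf h.2.1; have := h.2.2
    simp only [Expr.steps, Expr.bound]; omega

theorem Expr.additive.cheap {e : Expr} (h : e.additive = true) (W : ℕ) (m : Memory) :
    e.Cheap W m := by
  induction e with
  | const => trivial
  | load a i ih => exact ih h
  | add e f ihe ihf | sub e f ihe ihf =>
    simp only [Expr.additive, Bool.and_eq_true] at h
    exact ⟨ihe h.1, ihf h.2⟩
  | mul | div => exact absurd h (by simp [Expr.additive])

/-- Bounds are formed over an arbitrary commutative semiring. Over `ℕ[X]` the bound is the
polynomial of the theorem, and evaluating it yields the numerical bound. -/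
theorem Expr.map_bound {R S : Type*} [CommSemiring R] [CommSemiring S] (f : R →+* S) (W : R)
    (e : Expr) : f (e.bound W) = e.bound (f W) := by
  induction e <;> simp_all [Expr.bound]

namespace Cmd

/-- A bound for the number of steps, if the loops are repeated at most `B` times. -/
def bound {R : Type*} [CommSemiring R] (B W : R) : Cmd → R
  | skip => 1
  | store _ i e => i.bound W + e.bound W + 1
  | seq p q => p.bound B W + q.bound B W
  | ite e p q => e.bound W + 1 + p.bound B W + q.bound B W
  | loop _ _ p => B * (p.bound B W + 12) + 9

/-- All loops are repeated at most `B` times, and the operands of all multiplications and divisions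
have bit length at most `W`. -/
def Cheap (B W : ℕ) : Cmd → Memory → Prop
  | skip, _ => True
  | store _ i e, m => i.Cheap W m ∧ e.Cheap W m
  | seq p q, m => p.Cheap B W m ∧ q.Cheap B W (p.run m)
  | ite e p q, m => e.Cheap W m ∧ if 0 < e.val m then p.Cheap B W m else q.Cheap B W m
  | loop x b p, m => (m b 0).toNat ≤ B ∧
      ∀ t < (m b 0).toNat, p.Cheap B W (loopState p.run x m t)

theorem map_bound {R S : Type*} [CommSemiring R] [CommSemiring S] (f : R →+* S) (B W : R)
    (c : Cmd) : f (c.bound B W) = c.bound (f B) (f W) := by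
  induction c with
  | loop x b p ih => simp only [bound, map_add, map_mul, ih]; congr <;> exact map_ofNat f _
  | _ => simp_all [bound, Expr.map_bound]

theorem exec_compile {B W : ℕ} {c : Cmd} (hc : c.wf = true) {m : Memory} (h : c.Cheap B W m) :
    ∃ t, Exec c.compile m t (c.run m) ∧ t ≤ c.bound B W := by
  induction c generalizing m with
  | skip => exact ⟨1, .skip m, le_rfl⟩
  | store a i e =>
    have := h.1.steps_le; have := h.2.steps_le
    exact ⟨_, .store m a i e, by simp only [bound]; omega⟩
  | seq p q ihp ihq =>
    simp only [wf, Bool.and_eq_true] at hc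
    obtain ⟨t, h1, h2⟩ := ihp hc.1 h.1
    obtain ⟨t', h1', h2'⟩ := ihq hc.2 h.2
    exact ⟨_, .seq h1 h1', Nat.add_le_add h2 h2'⟩
  | ite e p q ihp ihq =>
    simp only [wf, Bool.and_eq_true] at hc
    obtain ⟨he, h⟩ := h
    have := he.steps_le
    simp only [run]
    split_ifs at h ⊢ with hpos
    · obtain ⟨t, h1, h2⟩ := ihp hc.1 h
      exact ⟨_, .if_pos hpos h1, by simp only [bound]; omega⟩
    · obtain ⟨t, h1, h2⟩ := ihq hc.2 h
      exact ⟨_, .if_not_pos hpos h1, by simp only [bound]; omega⟩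
  | loop x b p ih =>
    simp only [wf, Bool.and_eq_true, Bool.not_eq_true', beq_eq_false_iff_ne] at hc
    obtain ⟨⟨⟨hxb, hx⟩, hb⟩, hp⟩ := hc
    obtain ⟨hB, h⟩ := h
    set T := (m b 0).toNat with hT
    have hst : ∀ t, loopState p.run x m t x 0 = t ∧ loopState p.run x m t b = m b := by
      intro t
      have := loopState_inv (x := x) (b := b) (p := p) (m := m) (I := fun _ _ => True) t trivial
        (fun _ _ _ _ => trivial) (fun _ _ _ _ _ _ => trivial) t le_rfl
      exact ⟨this.2.1, this.2.2 b (by simp [wr, hb, Ne.symm hxb])⟩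
    have hval : ∀ t, (Expr.sub (.load b (.const 0)) (.load x (.const 0))).val
        (loopState p.run x m t) = m b 0 - t := fun t => by
      simp only [Expr.val, (hst t).1, (hst t).2]
    -- Induction on the number of rounds that are left. The constant `12` is six steps for the test
    -- and six for advancing the counter; the last `6` is the test that fails.
    have key : ∀ j, j ≤ T → ∃ s, Exec (.whilePos (.sub (.load b (.const 0)) (.load x (.const 0)))
        (.seq p.compile (.store x (.const 0) (.add (.load x (.const 0)) (.const 1)))))
        (loopState p.run x m (T - j)) s (loopState p.run x m T) ∧ s ≤ j * (p.bound B W + 12) + 6 := by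
      intro j
      induction j with
      | zero =>
        intro _
        refine ⟨_, .while_not_pos ?_, by simp [Expr.steps]⟩
        rw [hval]
        omega
      | succ j ihj =>
        intro hj
        obtain ⟨s, h1, h2⟩ := ihj (by omega)
        obtain ⟨s', h1', h2'⟩ := ih hp (h (T - (j + 1)) (by omega))
        have h3 := Exec.store (p.run (loopState p.run x m (T - (j + 1)))) x (.const 0)
          (.add (.load x (.const 0)) (.const 1))
        have h4 : (p.run (loopState p.run x m (T - (j + 1)))).write x
            ((Expr.const 0).val (p.run (loopState p.run x m (T - (j + 1)))))
            ((Expr.add (.load x (.const 0)) (.const 1)).val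
              (p.run (loopState p.run x m (T - (j + 1))))) = loopState p.run x m (T - j) := by
          rw [show T - j = T - (j + 1) + 1 by omega, loopState]
          simp only [Expr.val]
          rw [run_frame _ _ hx, (hst _).1]
        rw [h4] at h3
        refine ⟨_, .while_pos ?_ (.seq h1' h3) h1, ?_⟩
        · rw [hval]; omega
        · simp only [Expr.steps]
          rw [add_mul, one_mul]
          omega
    obtain ⟨s, h1, h2⟩ := key T le_rfl
    rw [Nat.sub_self] at h1
    refine ⟨_, .seq (.store _ _ _ _) h1, ?_⟩
    simp only [Expr.steps, bound]
    have := Nat.mul_le_mul_right (p.bound B W + 12) hB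
    omega

/-- No multiplications and divisions, arrays below `lo` are written only if they are `1`, and the
loop bounds are in the other arrays below `lo`. -/
def plain (lo : ℕ) : Cmd → Bool
  | skip => true
  | store a i e => (lo ≤ a || a == 1) && i.additive && e.additive
  | seq p q => p.plain lo && q.plain lo
  | ite e p q => e.additive && p.plain lo && q.plain lo
  | loop x b p => (lo ≤ x || x == 1) && (b < lo && !(b == 1)) && !p.wr x && p.plain lo

theorem plain.wr_eq {lo : ℕ} {c : Cmd} (h : c.plain lo = true) {a : ℕ} (ha : a < lo) (ha1 : a ≠ 1) :
    c.wr a = false := by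
  induction c with
  | skip => rfl
  | store b i e =>
    simp only [plain, Bool.and_eq_true, Bool.or_eq_true, decide_eq_true_eq, beq_iff_eq] at h
    simp only [wr, beq_eq_false_iff_ne]
    omega
  | seq p q ihp ihq =>
    simp only [plain, Bool.and_eq_true] at h
    simp [wr, ihp h.1, ihq h.2]
  | ite e p q ihp ihq =>
    simp only [plain, Bool.and_eq_true] at h
    simp [wr, ihp h.1.2, ihq h.2]
  | loop x b p ih =>
    simp only [plain, Bool.and_eq_true, Bool.or_eq_true, decide_eq_true_eq, beq_iff_eq] at h
    simp only [wr, ih h.2, Bool.or_false, beq_eq_false_iff_ne]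
    omega

theorem plain.wf {lo : ℕ} {c : Cmd} (h : c.plain lo = true) : c.wf = true := by
  induction c with
  | skip => rfl
  | store b i e => rfl
  | seq p q ihp ihq =>
    simp only [plain, Bool.and_eq_true] at h
    simp [Cmd.wf, ihp h.1, ihq h.2]
  | ite e p q ihp ihq =>
    simp only [plain, Bool.and_eq_true] at h
    simp [Cmd.wf, ihp h.1.2, ihq h.2]
  | loop x b p ih =>
    simp only [plain, Bool.and_eq_true, Bool.or_eq_true, decide_eq_true_eq, beq_iff_eq,
      Bool.not_eq_true', beq_eq_false_iff_ne] at h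
    simp only [Cmd.wf, ih h.2, h.1.2, plain.wr_eq h.2 h.1.1.2.1 h.1.1.2.2, Bool.and_true,
      Bool.not_false, Bool.not_eq_true', beq_eq_false_iff_ne]
    omega

/-- Loop bounds are read from arrays that a plain program never writes, so inspecting the initial
memory bounds all nested loops. No multiplication or division occurs, so `W` is arbitrary. -/
theorem plain.cheap {lo : ℕ} {c : Cmd} (h : c.plain lo = true) {B : ℕ} {m : Memory}
    (hB : ∀ b < lo, b ≠ 1 → (m b 0).toNat ≤ B) (W : ℕ) : c.Cheap B W m := by
  induction c generalizing m with
  | skip => trivial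
  | store b i e =>
    simp only [plain, Bool.and_eq_true] at h
    exact ⟨Expr.additive.cheap h.1.2 _ _, Expr.additive.cheap h.2 _ _⟩
  | seq p q ihp ihq =>
    simp only [plain, Bool.and_eq_true] at h
    exact ⟨ihp h.1 hB, ihq h.2 fun b hb hb1 => by
      rw [run_frame _ _ (plain.wr_eq h.1 hb hb1)]; exact hB b hb hb1⟩
  | ite e p q ihp ihq =>
    simp only [plain, Bool.and_eq_true] at h
    refine ⟨Expr.additive.cheap h.1.1 _ _, ?_⟩
    split_ifs
    · exact ihp h.1.2 hB
    · exact ihq h.2 hB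
  | loop x b p ih =>
    have h' := h
    simp only [plain, Bool.and_eq_true, Bool.or_eq_true, decide_eq_true_eq, beq_iff_eq,
      Bool.not_eq_true', beq_eq_false_iff_ne] at h
    refine ⟨hB b h.1.1.2.1 h.1.1.2.2, fun t _ => ih h.2 fun a ha ha1 => ?_⟩
    have := (loopState_inv (x := x) (b := b) (p := p) (m := m) (I := fun _ _ => True) t trivial
        (fun _ _ _ _ => trivial) (fun _ _ _ _ _ _ => trivial) t le_rfl).2.2 a (plain.wr_eq h' ha ha1)
    rw [this]
    exact hB a ha ha1

/-- The invariant rule for the bounds of a loop. -/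
theorem cheap_loop {B W x b : ℕ} {p : Cmd} {m : Memory} {I : ℕ → Memory → Prop} (T : ℕ)
    (hT : m b 0 = T) (hB : T ≤ B) (h0 : I 0 m) (hx : ∀ t m' z, I t m' → I t (m'.write x 0 z))
    (step : ∀ t < T, ∀ m' : Memory, (∀ a, (loop x b p).wr a = false → m' a = m a) → m' x 0 = t →
      I t m' → p.Cheap B W m' ∧ I (t + 1) (p.run m')) :
    (loop x b p).Cheap B W m ∧ I T ((loop x b p).run m) := by
  have key := loopState_inv (b := b) T h0 hx fun t ht m' h1 h2 h3 => (step t ht m' h1 h2 h3).2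
  have hT' : (m b 0).toNat = T := by rw [hT, Int.toNat_natCast]
  refine ⟨⟨by omega, fun t ht => ?_⟩, ?_⟩
  · have := key t (by omega)
    exact (step t (by omega) _ this.2.2 this.2.1 this.1).1
  · rw [run, hT']
    exact (key T le_rfl).1

end Cmd

end RAM

/-! ### Derived commands and proof rules for loops. -/

namespace RAM

/-- The content of cell `0` of an array. -/
abbrev sc (a : ℕ) : Expr := .load a (.const 0)

namespace Cmd

/-- Sequential composition. -/
def block : List Cmd → Cmd
  | [] => skip
  | c :: cs => seq c (block cs)

/-- Assignment to cell `0` of an array. -/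
abbrev set (a : ℕ) (e : Expr) : Cmd := store a (.const 0) e

def ifLt (e f : Expr) (p q : Cmd) : Cmd := ite (.sub f e) p q

def ifEq (e f : Expr) (p q : Cmd) : Cmd := ite (.sub f e) q (ite (.sub e f) q p)

/-- Scan all pairs `(u, v)` over and over again. -/
def sweep (t u v b : ℕ) (p : Cmd) : Cmd := loop t b (loop u b (loop v b p))

theorem run_skip (m : Memory) : skip.run m = m := rfl

theorem run_store (a : ℕ) (i e : Expr) (m : Memory) :
    (store a i e).run m = m.write a (i.val m) (e.val m) := rfl

theorem run_block_nil (m : Memory) : (block []).run m = m := rfl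

theorem run_block_cons (c : Cmd) (cs : List Cmd) (m : Memory) :
    (block (c :: cs)).run m = (block cs).run (c.run m) := rfl

theorem run_ifLt (e f : Expr) (p q : Cmd) (m : Memory) :
    (ifLt e f p q).run m = if e.val m < f.val m then p.run m else q.run m := by
  simp only [ifLt, run, Expr.val, sub_pos]

theorem run_ifEq (e f : Expr) (p q : Cmd) (m : Memory) :
    (ifEq e f p q).run m = if e.val m = f.val m then p.run m else q.run m := by
  simp only [ifEq, run, Expr.val, sub_pos]
  split_ifs <;> first | rfl | omega

theorem run_ifLt_apply (e f : Expr) (p q : Cmd) (m : Memory) (a : ℕ) (j : ℤ) :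
    (ifLt e f p q).run m a j = if e.val m < f.val m then p.run m a j else q.run m a j := by
  rw [run_ifLt]; split_ifs <;> rfl

theorem run_ifEq_apply (e f : Expr) (p q : Cmd) (m : Memory) (a : ℕ) (j : ℤ) :
    (ifEq e f p q).run m a j = if e.val m = f.val m then p.run m a j else q.run m a j := by
  rw [run_ifEq]; split_ifs <;> rfl

theorem run_store_apply (a : ℕ) (i e : Expr) (m : Memory) (b : ℕ) (j : ℤ) :
    (store a i e).run m b j = if b = a ∧ j = i.val m then e.val m else m b j := rfl

theorem run_sum {x b s : ℕ} {p : Cmd} {m : Memory} {T : ℕ} (f : Fin T → ℤ) (hT : m b 0 = T)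
    (hxs : s ≠ x)
    (step : ∀ (t : Fin T) (m' : Memory), (∀ a, (loop x b p).wr a = false → m' a = m a) →
      m' x 0 = (t : ℕ) → p.run m' s 0 = m' s 0 + f t) :
    (loop x b p).run m s 0 = m s 0 + ∑ t, f t := by
  have := run_loop_inv (x := x) (b := b) (p := p) (m := m)
    (I := fun t m' => m' s 0 = m s 0 + ∑ i : Fin T with i.val < t, f i) T hT (by simp)
    (fun t m' z h => by rwa [Memory.write_ne _ _ _ hxs]) (fun t ht m' hfr hx hI => by
      rw [step ⟨t, ht⟩ m' hfr hx, hI, add_assoc]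
      congr 1
      have : (Finset.univ.filter fun i : Fin T => i.val < t + 1) =
          insert ⟨t, ht⟩ (Finset.univ.filter fun i : Fin T => i.val < t) := by
        ext i
        simp only [Finset.mem_filter, Finset.mem_univ, true_and, Finset.mem_insert, Fin.ext_iff]
        omega
      rw [this, Finset.sum_insert (by simp), add_comm])
  simpa using this

/-- For loops that fill or update a block of cells. The new value may depend on the old one, which
covers conditional updates. -/
theorem run_each {x b a : ℕ} {p : Cmd} {m : Memory} {T : ℕ} (off : ℤ) (F : Fin T → ℤ → ℤ)
    (hT : m b 0 = T) (hxa : a ≠ x)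
    (step : ∀ (t : Fin T) (m' : Memory), (∀ a, (loop x b p).wr a = false → m' a = m a) →
      m' x 0 = (t : ℕ) → ∀ j, p.run m' a j = if j = off + (t : ℕ) then F t (m' a j) else m' a j) :
    (∀ t : Fin T, (loop x b p).run m a (off + (t : ℕ)) = F t (m a (off + (t : ℕ)))) ∧
      ∀ j, (j < off ∨ off + T ≤ j) → (loop x b p).run m a j = m a j := by
  have := run_loop_inv (x := x) (b := b) (p := p) (m := m)
    (I := fun t m' => (∀ i : Fin T, m' a (off + (i : ℕ)) =
      if i.val < t then F i (m a (off + (i : ℕ))) else m a (off + (i : ℕ))) ∧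
      ∀ j, (j < off ∨ off + T ≤ j) → m' a j = m a j) T hT ⟨by simp, fun _ _ => rfl⟩
    (fun t m' z h => by rwa [Memory.write_ne _ _ _ hxa]) (fun t ht m' hfr hx hI => by
      have hs := step ⟨t, ht⟩ m' hfr hx
      refine ⟨fun i => ?_, fun j hj => ?_⟩
      · rw [hs, hI.1]
        dsimp only
        by_cases hit : i.val = t
        · have hi : i = ⟨t, ht⟩ := Fin.ext hit
          rw [if_pos (by omega), if_neg (by omega), if_pos (by omega), ← hi]
        · rw [if_neg (by omega)]
          by_cases hlt : i.val < t
          · rw [if_pos hlt, if_pos (by omega)]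
          · rw [if_neg hlt, if_neg (by omega)]
      · rw [hs, if_neg (by dsimp only; omega), hI.2 j hj])
  exact ⟨fun t => by rw [this.1, if_pos t.2], this.2⟩

/-- The rule for sweeps: the set `M` grows until it is closed under `R`. -/
theorem run_sweep {n t u v b : ℕ} {p : Cmd} {m : Memory} (hn : m b 0 = n)
    (hwr : (sweep t u v b p).wr b = false) (hvu : u ≠ v) (hpu : p.wr u = false)
    (P : Memory → Prop) (M : Memory → Set (Fin n)) (R : Fin n → Fin n → Prop)
    (hx : ∀ (m' : Memory) x z, x = t ∨ x = u ∨ x = v → P m' →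
      P (m'.write x 0 z) ∧ M (m'.write x 0 z) = M m')
    (step : ∀ (m' : Memory) (x y : Fin n),
      (∀ a, (sweep t u v b p).wr a = false → m' a = m a) → P m' →
      m' u 0 = (x : ℕ) → m' v 0 = (y : ℕ) →
      P (p.run m') ∧ M m' ⊆ M (p.run m') ∧ (R x y → x ∈ M m' → y ∈ M (p.run m')) ∧
        ((R x y → x ∈ M m' → y ∈ M m') → M (p.run m') = M m' ∨ M (p.run m') = Set.univ))
    (hP : P m) (hM : (M m).Nonempty) :
    P ((sweep t u v b p).run m) ∧ M m ⊆ M ((sweep t u v b p).run m) ∧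
      ∀ x ∈ M ((sweep t u v b p).run m), ∀ y, R x y → y ∈ M ((sweep t u v b p).run m) := by
  have fr₁ : ∀ {a}, (sweep t u v b p).wr a = false → (loop u b (loop v b p)).wr a = false := by
    intro a h
    simp only [sweep, wr, Bool.or_eq_false_iff] at h ⊢
    exact ⟨h.2.1, h.2.2⟩
  have fr₂ : ∀ {a}, (sweep t u v b p).wr a = false → (loop v b p).wr a = false := by
    intro a h
    simp only [sweep, wr, Bool.or_eq_false_iff] at h ⊢
    exact h.2.2
  set Cl : Memory → Prop := fun m' => ∀ x ∈ M m', ∀ y, R x y → y ∈ M m' with hCl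
  have hClx : ∀ (m' : Memory) x z, x = t ∨ x = u ∨ x = v → P m' →
      (Cl (m'.write x 0 z) ↔ Cl m') := fun m' x z h hP => by
    simp only [hCl, (hx m' x z h hP).2]
  have row : ∀ (m₂ : Memory) (x : Fin n), (∀ a, (sweep t u v b p).wr a = false → m₂ a = m a) →
      P m₂ → m₂ u 0 = (x : ℕ) → P ((loop v b p).run m₂) ∧ M m₂ ⊆ M ((loop v b p).run m₂) ∧
      (Cl m₂ → Cl ((loop v b p).run m₂)) ∧
      (x ∈ M m₂ → ∀ y, R x y → y ∈ M ((loop v b p).run m₂)) := by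
    intro m₂ x hfr hP₂ hux
    have := run_loop_inv (x := v) (b := b) (p := p) (m := m₂)
      (I := fun j m' => P m' ∧ M m₂ ⊆ M m' ∧ (Cl m₂ → Cl m') ∧
        (x ∈ M m₂ → ∀ y : Fin n, y.val < j → R x y → y ∈ M m')) n (by rw [hfr b hwr, hn])
      ⟨hP₂, subset_rfl, id, fun _ _ h => absurd h (Nat.not_lt_zero _)⟩
      (fun j m' z h => by
        rw [hClx m' v z (Or.inr (Or.inr rfl)) h.1, (hx m' v z (Or.inr (Or.inr rfl)) h.1).2]
        exact ⟨(hx m' v z (Or.inr (Or.inr rfl)) h.1).1, h.2⟩)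
      (fun j hj m' hfr' hv hI => by
        have hs := step m' x ⟨j, hj⟩ (fun a ha => (hfr' a (fr₂ ha)).trans (hfr a ha)) hI.1
          (by rw [hfr' u (by simp [wr, hpu, hvu]), hux]) hv
        refine ⟨hs.1, hI.2.1.trans hs.2.1, fun hcl => ?_, fun hxM y hy hR => ?_⟩
        · have hcl' := hI.2.2.1 hcl
          rcases hs.2.2.2 (fun hR hxM => hcl' x hxM _ hR) with h | h
          · simp only [hCl, h]; exact hcl'
          · simp only [hCl, h, Set.mem_univ, implies_true]
        · rcases Nat.lt_succ_iff_lt_or_eq.1 hy with hy | hy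
          · exact hs.2.1 (hI.2.2.2 hxM y hy hR)
          · have : y = ⟨j, hj⟩ := Fin.ext hy
            rw [this] at hR ⊢
            exact hs.2.2.1 hR (hI.2.1 hxM))
    exact ⟨this.1, this.2.1, this.2.2.1, fun hxM y => this.2.2.2 hxM y y.2⟩
  have round : ∀ (m₁ : Memory), (∀ a, (sweep t u v b p).wr a = false → m₁ a = m a) →
      P m₁ → P ((loop u b (loop v b p)).run m₁) ∧ M m₁ ⊆ M ((loop u b (loop v b p)).run m₁) ∧
      (Cl m₁ → Cl ((loop u b (loop v b p)).run m₁)) ∧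
      ∀ x ∈ M m₁, ∀ y, R x y → y ∈ M ((loop u b (loop v b p)).run m₁) := by
    intro m₁ hfr hP₁
    have := run_loop_inv (x := u) (b := b) (p := loop v b p) (m := m₁)
      (I := fun i m' => P m' ∧ M m₁ ⊆ M m' ∧ (Cl m₁ → Cl m') ∧
        ∀ x ∈ M m₁, x.val < i → ∀ y, R x y → y ∈ M m') n (by rw [hfr b hwr, hn])
      ⟨hP₁, subset_rfl, id, fun _ _ h => absurd h (Nat.not_lt_zero _)⟩
      (fun j m' z h => by
        rw [hClx m' u z (Or.inr (Or.inl rfl)) h.1, (hx m' u z (Or.inr (Or.inl rfl)) h.1).2]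
        exact ⟨(hx m' u z (Or.inr (Or.inl rfl)) h.1).1, h.2⟩)
      (fun i hi m' hfr' hu hI => by
        have hs := row m' ⟨i, hi⟩ (fun a ha => (hfr' a (fr₁ ha)).trans (hfr a ha)) hI.1 hu
        refine ⟨hs.1, hI.2.1.trans hs.2.1, hs.2.2.1 ∘ hI.2.2.1, fun x hxM hxi y hR => ?_⟩
        rcases Nat.lt_succ_iff_lt_or_eq.1 hxi with hxi | hxi
        · exact hs.2.1 (hI.2.2.2 x hxM hxi y hR)
        · have : x = ⟨i, hi⟩ := Fin.ext hxi
          rw [this] at hR hxM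
          exact hs.2.2.2 (hI.2.1 hxM) y hR)
    exact ⟨this.1, this.2.1, this.2.2.1, fun x hxM y => this.2.2.2 x hxM x.2 y⟩
  -- A pass adds all successors of the elements present at its beginning. So after `i` passes `M` is
  -- closed or has at least `i + 1` elements, and after `n` passes the latter is impossible.
  have := run_loop_inv (x := t) (b := b) (p := loop u b (loop v b p)) (m := m)
    (I := fun i m' => P m' ∧ M m ⊆ M m' ∧ (Cl m' ∨ i + 1 ≤ (M m').ncard)) n hn
    ⟨hP, subset_rfl, Or.inr ((Set.ncard_pos (Set.toFinite _)).2 hM)⟩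
    (fun j m' z h => by
      rw [hClx m' t z (Or.inl rfl) h.1, (hx m' t z (Or.inl rfl) h.1).2]
      exact ⟨(hx m' t z (Or.inl rfl) h.1).1, h.2⟩)
    (fun i _ m' hfr' _ hI => by
      have hs := round m' hfr' hI.1
      refine ⟨hs.1, hI.2.1.trans hs.2.1, ?_⟩
      rcases hI.2.2 with hcl | hcard
      · exact Or.inl (hs.2.2.1 hcl)
      · by_cases heq : M m' = M ((loop u b (loop v b p)).run m')
        · left
          simp only [hCl, ← heq]
          have := hs.2.2.2
          rwa [← heq] at this
        · right
          have hlt := Set.ncard_lt_ncard (hs.2.1.ssubset_of_ne heq) (Set.toFinite _)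
          omega)
  refine ⟨this.1, this.2.1, this.2.2.resolve_right fun h => ?_⟩
  have h2 := Set.ncard_le_card (M ((sweep t u v b p).run m))
  rw [Nat.card_fin] at h2
  have h3 : n + 1 ≤ n := le_trans h h2
  omega

end Cmd

end RAM

namespace ConnectedMSR

open RAM RAM.Cmd

/-! ### The memory layout -/

-- The numbering is used in the frame arguments. Apart from the input and output arrays `0` and `1`,
-- arrays below `20` hold parameters and tables that the search only reads. Arrays `20` to `23` hold
-- the best solution, `29` to `32` the data of a guess, and `33` to `39` the state of the main
-- phase. The arrays from `60` to `66` and from `100` on are counters.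
notation "aN" => 2
notation "aK" => 3
notation "aNN" => 4
notation "aB" => 5
notation "aRounds" => 6
notation "aRest" => 7
notation "aOff" => 8
notation "aOffPair" => 9
notation "aFst" => 10
notation "aDist" => 11
notation "aTable" => 12
notation "aHas" => 20
notation "aBest" => 21
notation "aBestComp" => 22
notation "aBestCen" => 23
notation "aGuess" => 29
notation "aScaled" => 30
notation "aBall" => 31
notation "aBig" => 32
notation "aComp" => 33
notation "aAlpha" => 34
notation "aLam" => 35
notation "aGoal" => 36
notation "aFree" => 37
notation "aSet" => 38
notation "aRho" => 39
notation "aSum" => 40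
notation "aFrom" => 41
notation "aInto" => 42
notation "aNew" => 43
notation "aCen" => 44
notation "aTotal" => 45
notation "aMin" => 46
notation "aRad" => 47
notation "iT" => 60
notation "iU" => 61
notation "iV" => 62
notation "iP" => 63
notation "iJ" => 64
notation "iR" => 65
notation "iW" => 66

/-- Cell `i` of array `a`, where `i` is in cell `0` of array `x`. -/
abbrev at_ (a x : ℕ) : Expr := .load a (sc x)

/-- The entry of the adjacency matrix for the vertices in `u` and `v`. -/
def adjE (u v : ℕ) : Expr := .load 0 (.add (.add (.const 3) (at_ aOff u)) (sc v))

/-- Whether the vertex in `v` belongs to the ball in `p`. -/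
def ballE (p v : ℕ) : Expr := .load aBall (.add (at_ aOff p) (sc v))

/-! ### The program for one guess -/

/-- Cell `0` of `aGuess` holds the first guessed pair, whose distance is the scale `R`. It selects
the block of the precomputed table. -/
def loadScaled : Cmd :=
  loop iP aNN (store aScaled (sc iP) (.load aTable (.add (at_ aOffPair aGuess) (sc iP))))

/-- On integers, a strict comparison with a value plus one expresses `≤`. -/
def growBallStep : Cmd :=
  ifEq (ballE iP iU) (.const 1) (ifEq (adjE iU iV) (.const 1)
    (ifLt (.load aScaled (.add (.load aOff (at_ aFst iP)) (sc iV))) (.add (at_ aScaled iP) (.const 1))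
      (store aBall (.add (at_ aOff iP) (sc iV)) (.const 1)) skip) skip) skip

def growBall : Cmd := sweep iT iU iV aN growBallStep

def computeBall : Cmd := block
  [loop iV aN (store aBall (.add (at_ aOff iP) (sc iV)) (.const 0)),
   store aBall (.add (at_ aOff iP) (at_ aFst iP)) (.const 1), growBall]

def computeBalls : Cmd := loop iP aNN computeBall

def computeBig : Cmd := block
  [loop iV aN (store aBig (sc iV) (.const 0)),
   loop iJ aB (loop iV aN (ifEq (.load aBall (.add (.load aOff (at_ aGuess iJ)) (sc iV))) (.const 1)
    (store aBig (sc iV) (.const 1)) skip))]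

def countFree : Cmd := block
  [set aFree (.const 0),
   loop iW aN (ifEq (at_ aComp iW) (sc iW) (ifEq (at_ aBig iW) (.const 0)
    (set aFree (.add (sc aFree) (.const 1))) skip) skip)]

/-- The two labels are copied beforehand because the loop overwrites the array from which they are
read. -/
def relabel : Cmd := block
  [set aFrom (.load aComp (at_ aFst aSet)), set aInto (at_ aComp iV), set aNew (sc aFrom),
   ifEq (at_ aBig aFrom) (.const 0) (ifEq (at_ aBig aInto) (.const 1) (set aNew (sc aInto)) skip) skip,
   loop iW aN (ifEq (at_ aComp iW) (sc aFrom) (store aComp (sc iW) (sc aNew))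
    (ifEq (at_ aComp iW) (sc aInto) (store aComp (sc iW) (sc aNew)) skip)),
   countFree]

/-- The outer test freezes the sweep once the free count has come down to the goal, possibly in the
middle of a ball. -/
def growStep : Cmd :=
  ifLt (sc aGoal) (sc aFree) (ifEq (ballE aSet iV) (.const 1) (ifEq (adjE iU iV) (.const 1)
    (ifEq (at_ aComp iU) (.load aComp (at_ aFst aSet))
      (ifEq (at_ aComp iV) (.load aComp (at_ aFst aSet)) skip relabel) skip) skip) skip) skip

def growSet : Cmd := sweep iT iU iV aN growStep

/-- The goal `-1` is never reached, so guessed balls are always merged completely. -/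
def initLabels : Cmd := block
  [loop iV aN (store aComp (sc iV) (sc iV)), loop iV aN (store aAlpha (sc iV) (.const 0)),
   set aLam (.const 0), set aGoal (.const (-1)), countFree]

def bigPhase : Cmd := loop iJ aB (block [set aSet (at_ aGuess iJ), growSet])

def setGoal : Cmd := block
  [set aGoal (sc aRest),
   ifLt (.const 0) (sc aRest)
    (set aRho (.load aScaled (.load aGuess (.sub (sc aB) (.const 1))))) (set aRho (.const 0))]

def tryPair : Cmd :=
  ifLt (sc aGoal) (sc aFree) (ifLt (at_ aScaled iP) (.add (sc aRho) (.const 1)) (block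
    [set aSum (.const 0),
     loop iV aN (ifEq (ballE iP iV) (.const 1) (set aSum (.add (sc aSum) (at_ aAlpha iV))) skip),
     ifLt (.add (at_ aScaled iP) (sc aLam)) (.add (sc aSum) (.const 1))
      (block [set aSet (sc iP), growSet]) skip]) skip) skip

def raise : Cmd :=
  ifLt (sc aGoal) (sc aFree) (block
    [loop iV aN (ifEq (at_ aComp iV) (sc iV) (ifEq (at_ aBig iV) (.const 0)
      (store aAlpha (sc iV) (.add (at_ aAlpha iV) (.const 1))) skip) skip),
     set aLam (.add (sc aLam) (.const 1))]) skip

def rounds : Cmd := loop iR aRounds (block [loop iP aNN tryPair, raise])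

/-- The radius of the class with its label in `iU` around the vertex in `iV`. -/
def evalCenter : Cmd := block
  [set aRad (.const 0),
   loop iW aN (ifEq (at_ aComp iW) (sc iU)
    (ifLt (sc aRad) (.load aDist (.add (at_ aOff iV) (sc iW)))
      (set aRad (.load aDist (.add (at_ aOff iV) (sc iW)))) skip) skip)]

/-- The value `-1` in `aMin` means that no center has been tried yet. -/
def evalClass : Cmd := block
  [set aMin (.const (-1)),
   loop iV aN (ifEq (at_ aComp iV) (sc iU) (block [evalCenter,
    ifLt (sc aMin) (.const 0) (block [set aMin (sc aRad), store aCen (sc iU) (sc iV)])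
     (ifLt (sc aRad) (sc aMin) (block [set aMin (sc aRad), store aCen (sc iU) (sc iV)]) skip)]) skip),
   set aTotal (.add (sc aTotal) (sc aMin))]

def evaluate : Cmd := block
  [set aTotal (.const 0), loop iU aN (ifEq (at_ aComp iU) (sc iU) evalClass skip)]

def keep : Cmd := block
  [set aHas (.const 1), set aBest (sc aTotal),
   loop iV aN (store aBestComp (sc iV) (at_ aComp iV)),
   loop iV aN (store aBestCen (sc iV) (at_ aCen iV))]

def select : Cmd :=
  ifLt (sc aRest) (sc aFree) skip (block [evaluate,
    ifEq (sc aHas) (.const 1) (ifLt (sc aTotal) (sc aBest) keep skip) keep])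

def tryGuess : Cmd := block
  [loadScaled, computeBalls, computeBig, initLabels, bigPhase, setGoal, rounds, select]

/-- Run `p` for all values of the first `l` guesses. -/
def guessLoop (p : Cmd) : ℕ → Cmd
  | 0 => p
  | l + 1 => loop (100 + l) aNN (block [store aGuess (.const l) (sc (100 + l)), guessLoop p l])

theorem plain_tryGuess : tryGuess.plain 20 = true := rfl

/-! ### The contents of the memory -/

/-- The position of a pair of vertices in a matrix. -/
def ix {n : ℕ} (S : Fin n × Fin n) : ℕ := n * S.1 + S.2

theorem ix_lt {n : ℕ} (S : Fin n × Fin n) : ix S < n * n := by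
  unfold ix
  have h1 := S.1.2
  have h2 := S.2.2
  calc n * S.1 + S.2 < n * S.1 + n := by omega
    _ = n * (S.1 + 1) := by ring
    _ ≤ n * n := Nat.mul_le_mul_left _ h1

theorem exists_ix {n : ℕ} (t : Fin (n * n)) : ∃ S : Fin n × Fin n, ix S = t := by
  refine ⟨finProdFinEquiv.symm t, ?_⟩
  conv_rhs => rw [← finProdFinEquiv.apply_symm_apply t]
  simp only [finProdFinEquiv_apply_val, ix]
  omega

theorem ix_inj {n : ℕ} {S T : Fin n × Fin n} (h : ix S = ix T) : S = T := by
  have : finProdFinEquiv S = finProdFinEquiv T := by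
    apply Fin.ext
    simp only [finProdFinEquiv_apply_val]
    unfold ix at h
    omega
  exact finProdFinEquiv.injective this

theorem row_disjoint {n a b : ℕ} (hab : a ≠ b) {v : ℕ} (hv : v < n) :
    n * a + v < n * b ∨ n * b + n ≤ n * a + v := by
  rcases Nat.lt_or_gt_of_ne hab with h | h
  · left
    have := Nat.mul_le_mul_left n (Nat.succ_le_of_lt h)
    rw [Nat.mul_succ] at this
    omega
  · right
    have := Nat.mul_le_mul_left n (Nat.succ_le_of_lt h)
    rw [Nat.mul_succ] at this
    omega

open Classical in
/-- The memory after preprocessing. -/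
structure Tables {n : ℕ} (G : SimpleGraph (Fin n)) (D : Fin n → Fin n → ℕ) (k b N Q : ℕ)
    (m : Memory) : Prop where
  card : m aN 0 = n
  pairs : m aNN 0 = (n * n : ℕ)
  big : m aB 0 = b
  rounds : m aRounds 0 = Q
  rest : m aRest 0 = (k - b : ℕ)
  off : ∀ p < n * n, m aOff (p : ℕ) = (n * p : ℕ)
  offPair : ∀ p < n * n, m aOffPair (p : ℕ) = (n * n * p : ℕ)
  fst : ∀ S : Fin n × Fin n, m aFst (ix S) = (S.1 : ℕ)
  dist : ∀ S : Fin n × Fin n, m aDist (ix S) = D S.1 S.2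
  table : ∀ S T : Fin n × Fin n,
    m aTable (n * n * ix S + ix T : ℕ) = scaled D N (D S.1 S.2) T.1 T.2
  -- The adjacency matrix starts at cell `3`, after the length of the word, `n` and `k`.
  adj : ∀ S : Fin n × Fin n, m 0 (3 + ix S : ℕ) = if G.Adj S.1 S.2 then 1 else 0

open Classical in
/-- The memory after the balls for a guess have been computed. -/
structure Balls {n : ℕ} (G : SimpleGraph (Fin n)) (D d : Fin n → Fin n → ℕ) (k b N Q : ℕ)
    (g : ℕ → Fin n × Fin n) (m : Memory) : Prop extends Tables G D k b N Q m where
  guess : ∀ j < b, m aGuess (j : ℕ) = ix (g j)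
  scaled : ∀ S : Fin n × Fin n, m aScaled (ix S) = d S.1 S.2
  ball : ∀ (S : Fin n × Fin n) (v : Fin n),
    m aBall (n * ix S + v : ℕ) = if v ∈ pball G d S then 1 else 0
  cover : ∀ v : Fin n, m aBig (v : ℕ) = if v ∈ bigSet G d g b then 1 else 0

variable {n : ℕ} {G : SimpleGraph (Fin n)} {D d : Fin n → Fin n → ℕ} {k b N Q : ℕ}
  {g : ℕ → Fin n × Fin n} {m m' : Memory}

theorem Tables.congr (h : Tables G D k b N Q m) (hm : ∀ a < 20, a ≠ 1 → m' a = m a) :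
    Tables G D k b N Q m' := by
  obtain ⟨h1, h2, h3, h4, h5, h6, h7, h8, h9, h10, h11⟩ := h
  constructor <;> rw [hm] <;> first | assumption | decide

theorem Balls.congr (h : Balls G D d k b N Q g m) (hm : ∀ a < 33, a ≠ 1 → m' a = m a) :
    Balls G D d k b N Q g m' := by
  obtain ⟨h0, h1, h2, h3, h4⟩ := h
  refine ⟨h0.congr fun a ha => hm a (by omega), ?_, ?_, ?_, ?_⟩ <;> rw [hm] <;>
    first | assumption | decide

theorem Tables.off_vertex (h : Tables G D k b N Q m) (v : Fin n) :
    m aOff (v : ℕ) = (n * v : ℕ) :=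
  h.off v (lt_of_lt_of_le v.2 (Nat.le_mul_self n))

end ConnectedMSR

/-! ### Correctness of the computation of balls for a guess. -/

namespace ConnectedMSR

open RAM RAM.Cmd

variable {n : ℕ} {G : SimpleGraph (Fin n)} {D d : Fin n → Fin n → ℕ} {k b N Q : ℕ}
  {g : ℕ → Fin n × Fin n} {m : Memory}

open Classical in
theorem Tables.adjE_val (h : Tables G D k b N Q m) {u v : ℕ} {x y : Fin n}
    (hu : m u 0 = (x : ℕ)) (hv : m v 0 = (y : ℕ)) :
    (adjE u v).val m = if G.Adj x y then 1 else 0 := by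
  simp only [adjE, Expr.val, hu, hv, h.off_vertex]
  rw [← h.adj (x, y)]
  congr 1
  unfold ix
  push_cast
  ring

theorem Tables.ballE_val (h : Tables G D k b N Q m) {p v : ℕ} {S : Fin n × Fin n} {y : Fin n}
    (hp : m p 0 = ix S) (hv : m v 0 = (y : ℕ)) :
    (ballE p v).val m = m aBall (n * ix S + y : ℕ) := by
  simp only [ballE, Expr.val, hp, hv, h.off _ (ix_lt S)]
  push_cast
  rfl

/-- Closure under steps into the ball is enough, which is what a sweep that only looks at vertices
of the ball provides. -/
theorem cball_subset_of_closed {M : Set (Fin n)} {c : Fin n} {r : ℕ} (hc : c ∈ M)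
    (h : ∀ x ∈ M, ∀ y, G.Adj x y ∧ y ∈ cball G d c r → y ∈ M) : cball G d c r ⊆ M := by
  intro v hv
  induction hv with
  | refl => exact hc
  | tail hb hbc ih => exact h _ ih _ ⟨hbc.1, hb.tail hbc⟩

theorem run_loadScaled (h : Tables G D k b N Q m) (S : Fin n × Fin n) (hg : m aGuess 0 = ix S)
    (T : Fin n × Fin n) :
    loadScaled.run m aScaled (ix T) = scaled D N (D S.1 S.2) T.1 T.2 := by
  have := (run_each (x := iP) (a := aScaled) (m := m)
    (p := store aScaled (sc iP) (.load aTable (.add (at_ aOffPair aGuess) (sc iP)))) 0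
    (fun t _ => m aTable (n * n * ix S + t : ℕ)) h.pairs (by decide) (fun t m' hfr hx j => by
      simp only [run_store, Expr.val, hx, hfr aGuess rfl, hg, hfr aOffPair rfl,
        h.offPair _ (ix_lt S), hfr aTable rfl, Memory.write]
      push_cast
      simp)).1 ⟨ix T, ix_lt T⟩
  rw [zero_add] at this
  exact this.trans (h.table S T)

/-- The sweep is applied with `M` the set of marked vertices. Soundness of the marks is carried
along as an invariant, and closure of `M` gives completeness. The second conclusion protects the
rows of other balls. -/
theorem run_computeBall (h : Tables G D k b N Q m)
    (hd : ∀ S : Fin n × Fin n, m aScaled (ix S) = d S.1 S.2) (S : Fin n × Fin n)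
    (hp : m iP 0 = ix S) :
    (∀ v : Fin n, computeBall.run m aBall (n * ix S + v : ℕ) =
      open Classical in if v ∈ pball G d S then 1 else 0) ∧
    ∀ j : ℤ, (j < (n * ix S : ℕ) ∨ (n * ix S + n : ℕ) ≤ j) →
      computeBall.run m aBall j = m aBall j := by
  have hoff := h.off _ (ix_lt S)
  have h1 := run_each (x := iV) (a := aBall) (m := m)
    (p := store aBall (.add (at_ aOff iP) (sc iV)) (.const 0)) (n * ix S : ℕ)
    (fun _ _ => 0) h.card (by decide) (fun t m' hfr hx j => by
      simp only [run_store, Expr.val, hx, hfr iP rfl, hp, hfr aOff rfl, hoff, Memory.write]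
      simp)
  set m₁ := (loop iV aN (store aBall (.add (at_ aOff iP) (sc iV)) (.const 0))).run m with hm₁
  have fr₁ : ∀ a, a ≠ iV → a ≠ aBall → m₁ a = m a := fun a ha hb =>
    run_frame _ _ (by simp [wr, ha, hb])
  set m₂ := m₁.write aBall (n * ix S + S.1 : ℕ) 1 with hm₂
  have hm₂' : computeBall.run m = growBall.run m₂ := by
    simp only [computeBall, run_block_cons, run_block_nil, ← hm₁, run_store, Expr.val]
    rw [fr₁ iP (by decide) (by decide), fr₁ aOff (by decide) (by decide),
      fr₁ aFst (by decide) (by decide), hp, hoff, h.fst, hm₂]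
    push_cast
    rfl
  have fr₂ : ∀ a, a ≠ iV → a ≠ aBall → m₂ a = m a := fun a ha hb => by
    rw [hm₂, Memory.write_ne _ _ _ hb, fr₁ a ha hb]
  have ht₂ : Tables G D k b N Q m₂ := h.congr fun a ha _ => fr₂ a (by omega) (by omega)
  have hcell : ∀ v : Fin n, m₂ aBall (n * ix S + v : ℕ) = if v = S.1 then 1 else 0 := by
    intro v
    have := h1.1 v
    rw [← Nat.cast_add] at this
    rw [hm₂, Memory.write, this]
    simp [Fin.ext_iff]
  have hcen : m₂ aBall (n * ix S + S.1 : ℕ) = 1 := by rw [hcell, if_pos rfl]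
  have key := run_sweep (t := iT) (u := iU) (v := iV) (b := aN) (p := growBallStep) (m := m₂)
    ht₂.card rfl (by decide) rfl
    (fun m' => (∀ v : Fin n, m' aBall (n * ix S + v : ℕ) = 1 → v ∈ pball G d S) ∧
      (∀ v : Fin n, m' aBall (n * ix S + v : ℕ) = 0 ∨ m' aBall (n * ix S + v : ℕ) = 1) ∧
      ∀ j : ℤ, (j < (n * ix S : ℕ) ∨ (n * ix S + n : ℕ) ≤ j) → m' aBall j = m aBall j)
    (fun m' => {v | m' aBall (n * ix S + v : ℕ) = 1})
    (fun u v => G.Adj u v ∧ d S.1 v ≤ d S.1 S.2)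
    (fun m' x z hx hP => by
      have : (m'.write x 0 z) aBall = m' aBall := Memory.write_ne _ _ _ (by omega)
      rw [this]
      exact ⟨hP, rfl⟩)
    (fun m' u v hfr hP hu hv => by
      have ht : Tables G D k b N Q m' := ht₂.congr fun a ha h1 =>
        hfr a (plain.wr_eq (lo := 20) rfl ha h1)
      have hp' : m' iP 0 = ix S := by rw [hfr iP rfl, fr₂ iP (by decide) (by decide), hp]
      have hsc' : m' aScaled = m aScaled := by
        rw [hfr aScaled rfl, fr₂ aScaled (by decide) (by decide)]
      have hix : (Expr.load aScaled (.add (.load aOff (at_ aFst iP)) (sc iV))).val m' =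
          d S.1 v := by
        simp only [Expr.val, hp', hv, ht.fst, ht.off_vertex]
        rw [← hd (S.1, v), hsc']
        unfold ix
        push_cast
        rfl
      have hst : (Expr.add (at_ aOff iP) (sc iV)).val m' = (n * ix S + v : ℕ) := by
        simp only [Expr.val, hp', hv, ht.off _ (ix_lt S)]
        push_cast
        rfl
      have hrun : growBallStep.run m' = open Classical in
          if m' aBall (n * ix S + u : ℕ) = 1 ∧ G.Adj u v ∧ d S.1 v ≤ d S.1 S.2 then
            m'.write aBall (n * ix S + v : ℕ) 1 else m' := by
        simp only [growBallStep, run_ifEq, run_ifLt, run_store, run_skip, ht.ballE_val hp' hu,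
          ht.adjE_val hu hv, hix, hst]
        simp only [Expr.val, hp', hsc', hd]
        by_cases h1 : m' aBall (n * ix S + u : ℕ) = 1
        · by_cases h2 : G.Adj u v
          · simp only [h1, h2, if_true, true_and, Int.lt_add_one_iff, Nat.cast_le]
          · simp only [h1, h2, if_true, if_false, true_and, false_and, zero_ne_one]
        · simp only [h1, if_false, false_and]
      rw [hrun]
      split_ifs with hc
      · have hvS : v ∈ pball G d S := (hP.1 u hc.1).tail hc.2
        have hw : ∀ w : Fin n, (m'.write aBall (n * ix S + v : ℕ) 1) aBall (n * ix S + w : ℕ) =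
            if w = v then 1 else m' aBall (n * ix S + w : ℕ) := by
          intro w
          simp [Memory.write, Fin.ext_iff]
        refine ⟨⟨fun w hw' => ?_, fun w => ?_, fun j hj => ?_⟩, fun w hw' => ?_, fun _ _ => ?_,
          fun hcl => Or.inl ?_⟩
        · rw [hw] at hw'
          split_ifs at hw' with hwv
          · rw [hwv]; exact hvS
          · exact hP.1 w hw'
        · rw [hw]
          split_ifs
          · exact Or.inr rfl
          · exact hP.2.1 w
        · rw [← hP.2.2 j hj]
          exact Memory.write_cell_ne _ _ _ (by push_cast at hj ⊢; have := v.2; omega)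
        · show _ = _
          rw [hw]
          split_ifs
          · rfl
          · exact hw'
        · show _ = _
          rw [hw, if_pos rfl]
        · have hv1 : m' aBall (n * ix S + v : ℕ) = 1 := hcl hc.2 hc.1
          ext w
          show _ = _ ↔ _ = _
          rw [hw]
          split_ifs with hwv
          · rw [hwv, hv1]
          · rfl
      · refine ⟨hP, subset_rfl, fun hR hx => absurd ⟨hx, hR⟩ hc,
          fun _ => Or.inl rfl⟩)
    ⟨fun v hv => ?_, fun v => ?_, fun j hj => ?_⟩ ⟨S.1, ?_⟩
  · obtain ⟨⟨hs1, hs2, hs3⟩, hs4, hs5⟩ := key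
    rw [hm₂']
    refine ⟨fun v => ?_, hs3⟩
    have hsub : ∀ v, v ∈ pball G d S → growBall.run m₂ aBall (n * ix S + v : ℕ) = 1 := by
      intro v hv
      induction hv with
      | refl => exact hs4 hcen
      | tail _ hbc ih => exact hs5 _ ih _ hbc
    split_ifs with hv
    · exact hsub v hv
    · exact (hs2 v).resolve_right fun h => hv (hs1 v h)
  · rw [hcell] at hv
    split_ifs at hv with hvS
    · rw [hvS]; exact self_mem_cball _ _
    · exact absurd hv (by decide)
  · rw [hcell]
    split_ifs <;> simp
  · rw [hm₂, Memory.write_cell_ne _ _ _ (by have := S.1.2; push_cast at hj ⊢; omega)]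
    exact h1.2 j (by push_cast at hj ⊢; exact hj)
  · exact hcen

theorem run_computeBalls (h : Tables G D k b N Q m)
    (hd : ∀ S : Fin n × Fin n, m aScaled (ix S) = d S.1 S.2) (S : Fin n × Fin n) (v : Fin n) :
    computeBalls.run m aBall (n * ix S + v : ℕ) =
      open Classical in if v ∈ pball G d S then 1 else 0 := by
  have := run_loop_inv (x := iP) (b := aNN) (p := computeBall) (m := m)
    (I := fun t m' => ∀ S : Fin n × Fin n, ix S < t → ∀ v : Fin n,
      m' aBall (n * ix S + v : ℕ) = open Classical in if v ∈ pball G d S then 1 else 0) (n * n)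
    h.pairs (fun _ h => absurd h (Nat.not_lt_zero _))
    (fun t m' z hI => by rwa [Memory.write_ne _ _ _ (by decide)])
    (fun t ht m' hfr hx hI S hS v => by
      obtain ⟨T, hT⟩ := exists_ix ⟨t, ht⟩
      have hT' : ix T = t := hT
      have := run_computeBall (d := d) (h.congr fun a ha h1 =>
        hfr a (plain.wr_eq (lo := 20) rfl ha h1)) (by rw [hfr aScaled rfl]; exact hd) T (by
          rw [hx, hT'])
      rcases Nat.lt_succ_iff_lt_or_eq.1 hS with hS | hS
      · rw [this.2, hI S hS v]
        have := row_disjoint (show ix S ≠ ix T by omega) v.2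
        push_cast at this ⊢
        omega
      · rw [ix_inj (hS.trans hT'.symm)]
        exact this.1 v)
  exact this S (ix_lt S) v

theorem run_computeBig (h : Tables G D k b N Q m) (hg : ∀ j < b, m aGuess (j : ℕ) = ix (g j))
    (hball : ∀ (S : Fin n × Fin n) (v : Fin n), m aBall (n * ix S + v : ℕ) =
      open Classical in if v ∈ pball G d S then 1 else 0) (v : Fin n) :
    computeBig.run m aBig (v : ℕ) =
      open Classical in if v ∈ bigSet G d g b then 1 else 0 := by
  classical
  have h1 := (run_each (x := iV) (a := aBig) (m := m) (p := store aBig (sc iV) (.const 0)) 0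
    (fun _ _ => 0) h.card (by decide) (fun t m' hfr hx j => by
      simp [run_store, Expr.val, hx, Memory.write])).1
  simp only [computeBig, run_block_cons, run_block_nil]
  set m₁ := (loop iV aN (store aBig (sc iV) (.const 0))).run m with hm₁
  have fr₁ : ∀ a, a ≠ iV → a ≠ aBig → m₁ a = m a := fun a ha hb =>
    run_frame _ _ (by simp [wr, ha, hb])
  have := run_loop_inv (x := iJ) (b := aB) (m := m₁)
    (p := loop iV aN (ifEq (.load aBall (.add (.load aOff (at_ aGuess iJ)) (sc iV))) (.const 1)
      (store aBig (sc iV) (.const 1)) skip))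
    (I := fun t m' => ∀ v : Fin n, m' aBig (v : ℕ) = if v ∈ bigSet G d g t then 1 else 0) b
    (by rw [fr₁ aB (by decide) (by decide), h.big]) (fun v => by
      have := h1 v
      rw [zero_add] at this
      rw [this]
      simp [bigSet])
    (fun t m' z hI => by rwa [Memory.write_ne _ _ _ (by decide)])
    (fun t ht m' hfr hx hI v => by
      have h2 := (run_each (x := iV) (b := aN) (a := aBig) (m := m')
        (p := ifEq (.load aBall (.add (.load aOff (at_ aGuess iJ)) (sc iV))) (.const 1)
          (store aBig (sc iV) (.const 1)) skip) 0
        (fun v o => if v ∈ pball G d (g t) then 1 else o)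
        (by rw [hfr aN rfl, fr₁ aN (by decide) (by decide), h.card]) (by decide)
        (fun v m'' hfr' hx' j => by
          have hval : (Expr.load aBall (.add (.load aOff (at_ aGuess iJ)) (sc iV))).val m'' =
              if v ∈ pball G d (g t) then 1 else 0 := by
            simp only [Expr.val, hx']
            rw [hfr' iJ rfl, hx, hfr' aGuess rfl, hfr aGuess rfl, fr₁ aGuess (by decide) (by decide),
              hg t ht, hfr' aOff rfl, hfr aOff rfl, fr₁ aOff (by decide) (by decide),
              h.off _ (ix_lt _), hfr' aBall rfl, hfr aBall rfl, fr₁ aBall (by decide) (by decide),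
              ← hball]
            push_cast
            rfl
          rw [run_ifEq, hval]
          by_cases hv : v ∈ pball G d (g t)
          · simp [hv, Expr.val, run_store, hx', Memory.write]
          · simp [hv, Expr.val, run_skip])).1 v
      rw [zero_add] at h2
      rw [h2, hI]
      have h3 : v ∈ bigSet G d g (t + 1) ↔ v ∈ pball G d (g t) ∨ v ∈ bigSet G d g t := by
        constructor
        · rintro ⟨j, hj, hv⟩
          rcases Nat.lt_succ_iff_lt_or_eq.1 hj with hj | rfl
          · exact Or.inr ⟨j, hj, hv⟩
          · exact Or.inl hv
        · rintro (hv | ⟨j, hj, hv⟩)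
          · exact ⟨t, Nat.lt_succ_self t, hv⟩
          · exact ⟨j, Nat.lt_succ_of_lt hj, hv⟩
      by_cases h4 : v ∈ pball G d (g t) <;> simp [h3, h4])
  exact this v

/-- The effect of the first part of the program for one guess. -/
theorem run_computeTables (h : Tables G D k b N Q m) (hb : 0 < b)
    (hg : ∀ j < b, m aGuess (j : ℕ) = ix (g j)) :
    Balls G D (scaled D N (D (g 0).1 (g 0).2)) k b N Q g
      (computeBig.run (computeBalls.run (loadScaled.run m))) := by
  have h₁ : Tables G D k b N Q (loadScaled.run m) := h.congr fun a ha h1 =>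
    run_frame _ _ (plain.wr_eq (lo := 20) rfl ha h1)
  have h₂ : Tables G D k b N Q (computeBalls.run (loadScaled.run m)) := h₁.congr fun a ha h1 =>
    run_frame _ _ (plain.wr_eq (lo := 20) rfl ha h1)
  have h₃ : Tables G D k b N Q (computeBig.run (computeBalls.run (loadScaled.run m))) :=
    h₂.congr fun a ha h1 => run_frame _ _ (plain.wr_eq (lo := 20) rfl ha h1)
  have hs := run_loadScaled h (g 0) (hg 0 hb)
  have hb := run_computeBalls h₁ hs
  refine ⟨h₃, ?_, ?_, ?_, ?_⟩
  · rw [run_frame computeBig _ (a := aGuess) rfl, run_frame computeBalls _ (a := aGuess) rfl,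
      run_frame loadScaled _ (a := aGuess) rfl]
    exact hg
  · rw [run_frame computeBig _ (a := aScaled) rfl, run_frame computeBalls _ (a := aScaled) rfl]
    exact hs
  · rw [run_frame computeBig _ (a := aBall) rfl]
    exact hb
  · refine run_computeBig h₂ ?_ hb
    rw [run_frame computeBalls _ (a := aGuess) rfl, run_frame loadScaled _ (a := aGuess) rfl]
    exact hg

end ConnectedMSR

/-! ### Correctness of merging classes along a ball. -/

namespace ConnectedMSR

open RAM RAM.Cmd

variable {n : ℕ} {G : SimpleGraph (Fin n)} {D d : Fin n → Fin n → ℕ} {k b N Q : ℕ}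
  {g : ℕ → Fin n × Fin n} {m : Memory} {comp : Fin n → Fin n}

/-- The memory holds the labels `comp`. -/
structure Labels (V₀ : Set (Fin n)) (comp : Fin n → Fin n) (m : Memory) : Prop where
  label : ∀ v : Fin n, m aComp (v : ℕ) = (comp v : ℕ)
  free : m aFree 0 = freeCount V₀ comp

theorem Labels.congr {V₀ : Set (Fin n)} {m' : Memory} (h : Labels V₀ comp m)
    (h1 : m' aComp = m aComp) (h2 : m' aFree = m aFree) : Labels V₀ comp m' :=
  ⟨by rw [h1]; exact h.label, by rw [h2]; exact h.free⟩

theorem Balls.run (h : Balls G D d k b N Q g m) {c : Cmd} (hc : c.plain 33 = true) :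
    Balls G D d k b N Q g (c.run m) :=
  h.congr fun _ ha h1 => run_frame _ _ (plain.wr_eq hc ha h1)

theorem cast_eq_cast_iff {u v : Fin n} : (((u : ℕ) : ℤ) = ((v : ℕ) : ℤ)) ↔ u = v := by
  rw [Nat.cast_inj, Fin.ext_iff]

open Classical in
theorem run_countFree (h : Balls G D d k b N Q g m)
    (hc : ∀ v : Fin n, m aComp (v : ℕ) = (comp v : ℕ)) :
    Labels (bigSet G d g b) comp (countFree.run m) := by
  refine ⟨by rw [run_frame countFree _ (a := aComp) rfl]; exact hc, ?_⟩
  simp only [countFree, run_block_cons, run_block_nil, run_store, Expr.val]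
  have := run_sum (x := iW) (b := aN) (s := aFree) (m := m.write aFree 0 0)
    (p := ifEq (at_ aComp iW) (sc iW) (ifEq (at_ aBig iW) (.const 0)
      (set aFree (.add (sc aFree) (.const 1))) skip) skip)
    (fun w => if comp w = w ∧ w ∉ bigSet G d g b then 1 else 0)
    (by rw [Memory.write_ne _ _ _ (by decide)]; exact h.card) (by decide)
    (fun w m' hfr hx => by
      have h1 : m' aComp = m aComp := by rw [hfr aComp rfl, Memory.write_ne _ _ _ (by decide)]
      have h2 : m' aBig = m aBig := by rw [hfr aBig rfl, Memory.write_ne _ _ _ (by decide)]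
      simp only [run_ifEq_apply, run_store_apply, run_skip, Expr.val, hx, h1, h2, hc, h.cover, cast_eq_cast_iff]
      by_cases h3 : comp w = w <;> by_cases h4 : w ∈ bigSet G d g b <;>
        simp [h3, h4])
  rw [this, Memory.write_same, zero_add, Finset.sum_boole]
  rfl

theorem run_relabel (h : Balls G D d k b N Q g m)
    (hc : ∀ v : Fin n, m aComp (v : ℕ) = (comp v : ℕ)) {T : Fin n × Fin n} {v : Fin n}
    (hT : m aSet 0 = ix T) (hv : m iV 0 = (v : ℕ)) :
    Labels (bigSet G d g b) (merge (bigSet G d g b) comp (comp T.1) (comp v)) (relabel.run m) := by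
  classical
  set m₁ := (((m.write aFrom 0 (comp T.1 : ℕ)).write aInto 0 (comp v : ℕ)).write aNew 0
    (newLabel (bigSet G d g b) (comp T.1) (comp v) : Fin n)) with hm₁
  have hrun : relabel.run m = countFree.run ((loop iW aN (ifEq (at_ aComp iW) (sc aFrom)
      (store aComp (sc iW) (sc aNew)) (ifEq (at_ aComp iW) (sc aInto)
        (store aComp (sc iW) (sc aNew)) skip))).run m₁) := by
    simp only [relabel, run_block_cons, run_block_nil]
    congr 2
    simp only [run_ifEq, run_store, run_skip, Expr.val]
    have e1 : m aComp (m aFst (m aSet 0)) = (comp T.1 : ℕ) := by rw [hT, h.fst, hc]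
    have e2 : m aComp (m iV 0) = (comp v : ℕ) := by rw [hv, hc]
    simp only [Memory.write_ne _ _ _ (show aComp ≠ aFrom by decide),
      Memory.write_ne _ _ _ (show iV ≠ aFrom by decide),
      Memory.write_ne _ _ _ (show aFrom ≠ aInto by decide),
      Memory.write_ne _ _ _ (show aFrom ≠ aNew by decide),
      Memory.write_ne _ _ _ (show aInto ≠ aNew by decide),
      Memory.write_ne _ _ _ (show aBig ≠ aNew by decide),
      Memory.write_ne _ _ _ (show aBig ≠ aInto by decide),
      Memory.write_ne _ _ _ (show aBig ≠ aFrom by decide), e1, e2, Memory.write_same, h.cover]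
    rw [hm₁]
    unfold newLabel
    by_cases h1 : comp T.1 ∈ bigSet G d g b
    · simp [h1]
    · by_cases h2 : comp v ∈ bigSet G d g b
      · simp only [h1, h2, if_true, if_false, not_false_eq_true, and_self]
        funext a j
        by_cases ha : a = aNew ∧ j = 0 <;> simp [Memory.write, ha]
      · simp [h1, h2]
  rw [hrun]
  have fr₁ : ∀ a, a ≠ aFrom → a ≠ aInto → a ≠ aNew → m₁ a = m a := fun a h1 h2 h3 => by
    rw [hm₁, Memory.write_ne _ _ _ h3, Memory.write_ne _ _ _ h2, Memory.write_ne _ _ _ h1]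
  have e1 : m₁ aFrom 0 = (comp T.1 : ℕ) := by simp [hm₁, Memory.write]
  have e2 : m₁ aInto 0 = (comp v : ℕ) := by simp [hm₁, Memory.write]
  have e3 : m₁ aNew 0 = (newLabel (bigSet G d g b) (comp T.1) (comp v) : Fin n) := by
    simp [hm₁, Memory.write]
  have hb₁ : Balls G D d k b N Q g m₁ := h.congr fun a ha _ => fr₁ a (by omega) (by omega) (by omega)
  refine run_countFree (hb₁.run rfl) fun w => ?_
  have := (run_each (x := iW) (b := aN) (a := aComp) (m := m₁)
    (p := ifEq (at_ aComp iW) (sc aFrom)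
      (store aComp (sc iW) (sc aNew)) (ifEq (at_ aComp iW) (sc aInto)
        (store aComp (sc iW) (sc aNew)) skip)) 0
    (fun w o => if o = (comp T.1 : ℕ) ∨ o = (comp v : ℕ) then
      ((newLabel (bigSet G d g b) (comp T.1) (comp v) : Fin n) : ℕ) else o) hb₁.card (by decide)
    (fun w m' hfr hx j => by
      simp only [run_ifEq_apply, run_store_apply, run_skip, Expr.val, hx, hfr aFrom rfl, hfr aInto rfl,
        hfr aNew rfl, e1, e2, e3, zero_add]
      by_cases hj : j = (w : ℕ)
      · subst hj
        by_cases h1 : m' aComp (w : ℕ) = (comp T.1 : ℕ)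
        · simp [h1]
        · by_cases h2 : m' aComp (w : ℕ) = (comp v : ℕ)
          · simp [h2]
          · simp [h1, h2]
      · simp [hj])).1 w
  rw [zero_add] at this
  rw [this, fr₁ aComp (by decide) (by decide) (by decide), hc]
  simp only [cast_eq_cast_iff, merge, regroup, Finset.mem_insert, Finset.mem_singleton]
  split_ifs <;> rfl

/-- The set handed to the sweep rule is the class of `T.1`, or everything as soon as the goal is
reached, so that a frozen sweep counts as closed. Hence closure shows that the ball lies in one
class exactly under the proviso that the free count is still above `K`. -/
theorem run_growSet (h : Balls G D d k b N Q g m) {K : ℤ}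
    (hc : Labels (bigSet G d g b) comp m) (hlab : Labelling G (bigSet G d g b) comp)
    {T : Fin n × Fin n} (hT : m aSet 0 = ix T) (hK : m aGoal 0 = K) :
    ∃ comp', Labels (bigSet G d g b) comp' (growSet.run m) ∧
      Grown G d (bigSet G d g b) K comp T comp' ∧
      (K < freeCount (bigSet G d g b) comp' → ∀ v ∈ pball G d T, comp' v = comp' T.1) := by
  classical
  obtain ⟨⟨comp', hc', hg'⟩, -, hcl⟩ := run_sweep (t := iT) (u := iU) (v := iV) (b := aN)
    (p := growStep) (m := m) h.card rfl (by decide) rfl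
    (fun m' => ∃ comp', Labels (bigSet G d g b) comp' m' ∧
      Grown G d (bigSet G d g b) K comp T comp')
    (fun m' => {v | m' aFree 0 ≤ K ∨ m' aComp (v : ℕ) = m' aComp (T.1 : ℕ)})
    (fun u v => G.Adj u v ∧ v ∈ pball G d T)
    (fun m' x z hx hP => by
      obtain ⟨comp', hc', hg'⟩ := hP
      have h1 : (m'.write x 0 z) aComp = m' aComp := Memory.write_ne _ _ _ (by omega)
      have h2 : (m'.write x 0 z) aFree = m' aFree := Memory.write_ne _ _ _ (by omega)
      exact ⟨⟨comp', hc'.congr h1 h2, hg'⟩, by rw [h1, h2]⟩)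
    (fun m' u v hfr hP hu hv => by
      obtain ⟨comp', hc', hg'⟩ := hP
      have hb' : Balls G D d k b N Q g m' := h.congr fun a ha h1 =>
        hfr a (plain.wr_eq (lo := 33) rfl ha h1)
      have hT' : m' aSet 0 = ix T := by rw [hfr aSet rfl, hT]
      have hgoal : m' aGoal 0 = K := by rw [hfr aGoal rfl, hK]
      have hrun : growStep.run m' = if K < freeCount (bigSet G d g b) comp' ∧ v ∈ pball G d T ∧
          G.Adj u v ∧ comp' u = comp' T.1 ∧ comp' v ≠ comp' T.1 then relabel.run m' else m' := by
        simp only [growStep, run_ifLt, run_ifEq, run_skip, hb'.ballE_val hT' hv, hb'.ball,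
          hb'.adjE_val hu hv]
        simp only [Expr.val, hgoal, hc'.free, hu, hv, hT', hb'.fst, hc'.label, cast_eq_cast_iff]
        by_cases h1 : K < freeCount (bigSet G d g b) comp' <;> by_cases h2 : v ∈ pball G d T <;>
          by_cases h3 : G.Adj u v <;> by_cases h4 : comp' u = comp' T.1 <;>
          by_cases h5 : comp' v = comp' T.1 <;> simp [h1, h2, h3, h4, h5]
      have hM : ∀ {m'' comp''}, Labels (bigSet G d g b) comp'' m'' →
          {v : Fin n | m'' aFree 0 ≤ K ∨ m'' aComp (v : ℕ) = m'' aComp (T.1 : ℕ)} =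
          {v | freeCount (bigSet G d g b) comp'' ≤ K ∨ comp'' v = comp'' T.1} := by
        intro m'' comp'' hc''
        simp only [hc''.free, hc''.label, cast_eq_cast_iff]
      rw [hrun]
      split_ifs with hcond
      · have hrel := run_relabel hb' hc'.label hT' hv
        have hstep := hg'.step hlab hcond.2.1 hcond.2.2.1 hcond.2.2.2.1 hcond.2.2.2.2 hcond.1
        have hcnt := (freeCount_merge (V₀ := bigSet G d g b) (comp := comp') (hg'.1.idem T.1)
          (hg'.1.idem v)).1
        have hmem := newLabel_mem (V₀ := bigSet G d g b) (comp' T.1) (comp' v)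
        have hm1 : merge (bigSet G d g b) comp' (comp' T.1) (comp' v) v =
            merge (bigSet G d g b) comp' (comp' T.1) (comp' v) T.1 := by
          unfold merge
          rw [(regroup_eq_iff hmem _).2 (by simp), (regroup_eq_iff hmem _).2 (by simp)]
        refine ⟨⟨_, hrel, hstep⟩, ?_, ?_, ?_⟩
        · rw [hM hc', hM hrel]
          rintro w (hw | hw)
          · left; omega
          · right; exact regroup_congr _ _ hw
        · intro _ _
          rw [hM hrel]
          exact Or.inr hm1
        · rw [hM hc']
          intro hcl
          rcases hcl ⟨hcond.2.2.1, hcond.2.1⟩ (Or.inr hcond.2.2.2.1) with h1 | h1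
          · exact absurd hcond.1 (not_lt.2 h1)
          · exact absurd h1 hcond.2.2.2.2
      · refine ⟨⟨comp', hc', hg'⟩, subset_rfl, ?_, fun _ => Or.inl rfl⟩
        rw [hM hc']
        rintro ⟨hadj, hvT⟩ (hx | hx)
        · exact Or.inl hx
        · by_contra hnot
          rw [Set.mem_ofPred_eq, not_or, not_le] at hnot
          exact hcond ⟨hnot.1, hvT, hadj, hx, hnot.2⟩)
    ⟨comp, hc, Grown.refl hlab K T⟩ ⟨T.1, Or.inr rfl⟩
  refine ⟨comp', hc', hg', fun hlt v hv => ?_⟩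
  have := cball_subset_of_closed (Or.inr rfl) hcl hv
  rw [Set.mem_ofPred_eq] at this
  change growSet.run m aFree 0 ≤ K ∨ growSet.run m aComp (v : ℕ) = growSet.run m aComp (T.1 : ℕ)
    at this
  rw [show growSet.run m aFree 0 = _ from hc'.free, show growSet.run m aComp (v : ℕ) = _ from
    hc'.label v, show growSet.run m aComp (T.1 : ℕ) = _ from hc'.label T.1, cast_eq_cast_iff] at this
  exact this.resolve_left (not_le.2 hlt)

end ConnectedMSR

/-! ### Correctness of the guessed phase and of the rounds. -/

namespace ConnectedMSR

open RAM RAM.Cmd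

variable {n : ℕ} {G : SimpleGraph (Fin n)} {D d : Fin n → Fin n → ℕ} {k b N Q ρ lam : ℕ}
  {g : ℕ → Fin n × Fin n} {m : Memory} {comp : Fin n → Fin n} {α : Fin n → ℕ}

/-- The memory during the main phase. -/
structure MainState (V₀ : Set (Fin n)) (ρ K : ℕ) (α : Fin n → ℕ) (lam : ℕ) (comp : Fin n → Fin n)
    (m : Memory) : Prop extends Labels V₀ comp m where
  alpha : ∀ v : Fin n, m aAlpha (v : ℕ) = α v
  lambda : m aLam 0 = lam
  goal : m aGoal 0 = K
  rho : m aRho 0 = ρ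

theorem MainState.congr {V₀ : Set (Fin n)} {K : ℕ} {m' : Memory}
    (h : MainState V₀ ρ K α lam comp m) (hm : ∀ a, 33 ≤ a → a ≤ 39 → m' a = m a) :
    MainState V₀ ρ K α lam comp m' := by
  obtain ⟨h0, h1, h2, h3, h4⟩ := h
  refine ⟨h0.congr (hm _ (by decide) (by decide)) (hm _ (by decide) (by decide)), ?_, ?_, ?_, ?_⟩ <;>
    rw [hm] <;> first | assumption | decide

theorem Grown.freeCount_le {V : Type*} [Fintype V] [DecidableEq V] {G : SimpleGraph V}
    {d : V → V → ℕ} {V₀ : Set V} {K : ℤ} {comp comp' : V → V} {T : V × V}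
    (h : Grown G d V₀ K comp T comp') :
    freeCount V₀ comp' ≤ freeCount V₀ comp := by
  classical
  obtain ⟨-, J, l, hl, -, hJ, -, rfl, -⟩ := h
  refine Finset.card_le_card fun v hv => ?_
  rw [Finset.mem_filter] at hv ⊢
  refine ⟨hv.1, ?_, hv.2.2⟩
  have := hv.2.1
  unfold regroup at this
  split_ifs at this
  · rw [← this]; exact hJ l hl
  · exact this

theorem Grown.congr {V : Type*} [Fintype V] [DecidableEq V] {G : SimpleGraph V}
    {d : V → V → ℕ} {V₀ : Set V} {K : ℤ} {comp comp' : V → V} {T : V × V}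
    (h : Grown G d V₀ K comp T comp') {u v : V} (huv : comp u = comp v) : comp' u = comp' v := by
  obtain ⟨-, J, l, -, -, -, -, rfl, -⟩ := h
  exact regroup_congr _ _ huv

theorem run_initLabels (h : Balls G D d k b N Q g m) :
    Labels (bigSet G d g b) id (initLabels.run m) ∧
      (∀ v : Fin n, initLabels.run m aAlpha (v : ℕ) = 0) ∧ initLabels.run m aLam 0 = 0 ∧
      initLabels.run m aGoal 0 = -1 := by
  set m₁ := (loop iV aN (store aComp (sc iV) (sc iV))).run m with hm₁
  set m₂ := (loop iV aN (store aAlpha (sc iV) (.const 0))).run m₁ with hm₂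
  set m₃ := (set aGoal (.const (-1))).run ((set aLam (.const 0)).run m₂) with hm₃
  have hrun : initLabels.run m = countFree.run m₃ := rfl
  have hb₁ : Balls G D d k b N Q g m₁ := h.run rfl
  have hb₂ : Balls G D d k b N Q g m₂ := hb₁.run rfl
  have hb₃ : Balls G D d k b N Q g m₃ := (hb₂.run (c := set aLam (.const 0)) rfl).run rfl
  have h1 := (run_each (x := iV) (a := aComp) (m := m) (p := store aComp (sc iV) (sc iV)) 0
    (fun v _ => (v : ℕ)) h.card (by decide) (fun t m' hfr hx j => by
      simp [run_store_apply, Expr.val, hx])).1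
  have h2 := (run_each (x := iV) (a := aAlpha) (m := m₁)
    (p := store aAlpha (sc iV) (.const 0)) 0 (fun _ _ => 0) hb₁.card (by decide)
    (fun t m' hfr hx j => by simp [run_store_apply, Expr.val, hx])).1
  have fr₃ : ∀ a, a ≠ aLam → a ≠ aGoal → m₃ a = m₂ a := fun a h1 h2 => by
    rw [hm₃, run_store, run_store, Memory.write_ne _ _ _ h2, Memory.write_ne _ _ _ h1]
  rw [hrun]
  refine ⟨run_countFree hb₃ fun v => ?_, fun v => ?_, ?_, ?_⟩
  · have := h1 v
    rw [zero_add] at this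
    rw [fr₃ aComp (by decide) (by decide), hm₂, run_frame _ _ rfl]
    exact this
  · have := h2 v
    rw [zero_add] at this
    rw [run_frame countFree _ (a := aAlpha) rfl, fr₃ aAlpha (by decide) (by decide)]
    exact this
  · rw [run_frame countFree _ (a := aLam) rfl]
    simp [hm₃, run_store_apply, Expr.val]
  · rw [run_frame countFree _ (a := aGoal) rfl]
    simp [hm₃, run_store_apply, Expr.val]

/-- With goal `-1` the proviso of `run_growSet` always holds, so every guessed ball ends up inside
one class. -/
theorem run_bigPhase (h : Balls G D d k b N Q g m) (hc : Labels (bigSet G d g b) id m)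
    (hgoal : m aGoal 0 = -1) :
    ∃ comp, Labels (bigSet G d g b) comp (bigPhase.run m) ∧ BigState G d g b b comp := by
  refine run_loop_inv (x := iJ) (b := aB) (m := m) (p := block [set aSet (at_ aGuess iJ), growSet])
    (I := fun t m' => ∃ comp, Labels (bigSet G d g b) comp m' ∧ BigState G d g b t comp) b h.big
    ⟨id, hc, BigState.init⟩ (fun t m' z hI => ?_) (fun t ht m' hfr hx hI => ?_)
  · obtain ⟨comp, h1, h2⟩ := hI
    exact ⟨comp, h1.congr (Memory.write_ne _ _ _ (by decide)) (Memory.write_ne _ _ _ (by decide)), h2⟩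
  · obtain ⟨comp, h1, h2⟩ := hI
    have hb' : Balls G D d k b N Q g m' := h.congr fun a ha h1 =>
      hfr a (plain.wr_eq (lo := 33) rfl ha h1)
    simp only [run_block_cons, run_block_nil]
    set m'' := (set aSet (at_ aGuess iJ)).run m' with hm''
    have hS : m'' aSet 0 = ix (g t) := by
      simp only [hm'', run_store_apply, Expr.val, and_self, if_true, hx]
      exact hb'.guess t ht
    obtain ⟨comp', hl, hgr, hmono⟩ := run_growSet (hb'.run (c := set aSet (at_ aGuess iJ)) rfl)
      (K := -1) (h1.congr (Memory.write_ne _ _ _ (by decide)) (Memory.write_ne _ _ _ (by decide)))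
      h2.part hS (by
        rw [run_store, Memory.write_ne _ _ _ (by decide), hfr aGoal rfl, hgoal])
    exact ⟨comp', hl, h2.grow ht hgr (hmono (by omega))⟩

theorem run_setGoal (h : Balls G D d k b N Q g m) (hb : 0 < b) :
    setGoal.run m aGoal 0 = (k - b : ℕ) ∧ setGoal.run m aRho 0 = threshold d g b k := by
  simp only [setGoal, run_block_cons, run_block_nil, run_ifLt_apply, run_store_apply]
  have h1 : ((set aGoal (sc aRest)).run m) aRest 0 = (k - b : ℕ) := by
    rw [run_store, Memory.write_ne _ _ _ (by decide)]; exact h.rest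
  simp only [Expr.val, h1, h.rest]
  constructor
  · simp
  · have h2 : ((set aGoal (sc aRest)).run m) aScaled (((set aGoal (sc aRest)).run m) aGuess
        (((set aGoal (sc aRest)).run m) aB 0 - 1)) =
        d (g (b - 1)).1 (g (b - 1)).2 := by
      simp only [run_store]
      rw [Memory.write_ne _ _ _ (show aScaled ≠ aGoal by decide),
        Memory.write_ne _ _ _ (show aGuess ≠ aGoal by decide),
        Memory.write_ne _ _ _ (show aB ≠ aGoal by decide), h.big,
        show (b : ℤ) - 1 = (b - 1 : ℕ) by omega, h.guess _ (by omega), h.scaled]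
    rw [h2]
    unfold threshold
    simp only [Nat.cast_pos, and_self, if_true]
    split_ifs <;> rfl

theorem run_tryPair (d_self : ∀ u, d u u = 0) (symm : ∀ u v, d u v = d v u)
    (tri : ∀ u v w, d u w ≤ d u v + d v w) (h : Balls G D d k b N Q g m) {K : ℕ}
    (hs : MainState (bigSet G d g b) ρ K α lam comp m)
    (hp : PDState G d g b ρ K α lam comp) {T : Fin n × Fin n} (hT : m iP 0 = ix T) :
    ∃ comp', MainState (bigSet G d g b) ρ K α lam comp' (tryPair.run m) ∧
      PDState G d g b ρ K α lam comp' ∧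
      freeCount (bigSet G d g b) comp' ≤ freeCount (bigSet G d g b) comp ∧
      (∀ u v, comp u = comp v → comp' u = comp' v) ∧
      (K < freeCount (bigSet G d g b) comp' → d T.1 T.2 ≤ ρ →
        d T.1 T.2 + lam ≤ (open Classical in ∑ v with v ∈ pball G d T, α v) →
        ∀ v ∈ pball G d T, comp' v = comp' T.1) := by
  classical
  -- Whenever one of the three tests fails, the labelling is unchanged and the last conclusion is
  -- vacuous.
  have hskip : (¬ (K < freeCount (bigSet G d g b) comp ∧ d T.1 T.2 ≤ ρ ∧
      d T.1 T.2 + lam ≤ ∑ v with v ∈ pball G d T, α v)) → ∀ m',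
      MainState (bigSet G d g b) ρ K α lam comp m' → tryPair.run m = m' →
      ∃ comp', MainState (bigSet G d g b) ρ K α lam comp' (tryPair.run m) ∧
      PDState G d g b ρ K α lam comp' ∧
      freeCount (bigSet G d g b) comp' ≤ freeCount (bigSet G d g b) comp ∧
      (∀ u v, comp u = comp v → comp' u = comp' v) ∧
      (K < freeCount (bigSet G d g b) comp' → d T.1 T.2 ≤ ρ →
        d T.1 T.2 + lam ≤ ∑ v with v ∈ pball G d T, α v →
        ∀ v ∈ pball G d T, comp' v = comp' T.1) := fun hcon m' hm' heq =>
    ⟨comp, heq ▸ hm', hp, le_rfl, fun _ _ h => h, fun h1 h2 h3 => absurd ⟨h1, h2, h3⟩ hcon⟩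
  have e1 : (at_ aScaled iP).val m = d T.1 T.2 := by simp only [Expr.val, hT, h.scaled]
  have hrun : tryPair.run m = _ := run_ifLt (sc aGoal) (sc aFree) (ifLt (at_ aScaled iP) (.add (sc aRho) (.const 1))
    (block [set aSum (.const 0),
     loop iV aN (ifEq (ballE iP iV) (.const 1) (set aSum (.add (sc aSum) (at_ aAlpha iV))) skip),
     ifLt (.add (at_ aScaled iP) (sc aLam)) (.add (sc aSum) (.const 1))
      (block [set aSet (sc iP), growSet]) skip]) skip) skip m
  rw [run_ifLt, e1] at hrun
  simp only [Expr.val, hs.goal, hs.free, hs.rho, run_skip, Nat.cast_lt, Int.lt_add_one_iff,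
    Nat.cast_le] at hrun
  by_cases h1 : K < freeCount (bigSet G d g b) comp
  swap
  · rw [if_neg h1] at hrun
    exact hskip (fun h => h1 h.1) m hs hrun
  by_cases h2 : d T.1 T.2 ≤ ρ
  swap
  · rw [if_pos h1, if_neg h2] at hrun
    exact hskip (fun h => h2 h.2.1) m hs hrun
  rw [if_pos h1, if_pos h2] at hrun
  set sumLoop := loop iV aN (ifEq (ballE iP iV) (.const 1)
    (set aSum (.add (sc aSum) (at_ aAlpha iV))) skip) with hsumLoop
  set m₁ := (set aSum (.const 0)).run m with hm₁
  set m₂ := sumLoop.run m₁ with hm₂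
  have fr₂ : ∀ a, a ≠ aSum → a ≠ iV → m₂ a = m a := fun a ha hb => by
    rw [hm₂, hsumLoop, run_frame _ _ (by simp [wr, ifEq, ha, hb]), hm₁, run_store,
      Memory.write_ne _ _ _ ha]
  have hs₂ : MainState (bigSet G d g b) ρ K α lam comp m₂ :=
    hs.congr fun a ha hb => fr₂ a (by omega) (by omega)
  have hb₂ : Balls G D d k b N Q g m₂ := h.congr fun a ha _ => fr₂ a (by omega) (by omega)
  have hT₂ : m₂ iP 0 = ix T := by rw [fr₂ iP (by decide) (by decide), hT]
  have hsum : m₂ aSum 0 = (∑ v with v ∈ pball G d T, α v : ℕ) := by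
    have := run_sum (x := iV) (b := aN) (s := aSum) (m := m₁)
      (p := ifEq (ballE iP iV) (.const 1) (set aSum (.add (sc aSum) (at_ aAlpha iV))) skip)
      (fun v => if v ∈ pball G d T then (α v : ℤ) else 0)
      (by rw [hm₁, run_store, Memory.write_ne _ _ _ (by decide)]; exact h.card) (by decide)
      (fun v m' hfr hx => by
        have hfr' : ∀ a, a ≠ aSum → a ≠ iV → m' a = m a := fun a ha hb => by
          rw [hfr a (by simp [wr, ifEq, ha, hb]), hm₁, run_store, Memory.write_ne _ _ _ ha]
        have hb' : Balls G D d k b N Q g m' :=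
          h.congr fun a ha _ => hfr' a (by omega) (by omega)
        have hT' : m' iP 0 = ix T := by rw [hfr' iP (by decide) (by decide), hT]
        rw [run_ifEq_apply, hb'.ballE_val hT' hx, hb'.ball, run_store_apply, run_skip]
        simp only [Expr.val, hx, hfr' aAlpha (by decide) (by decide), hs.alpha]
        by_cases hv : v ∈ pball G d T <;> simp [hv])
    have h0 : m₁ aSum 0 = 0 := by simp [hm₁, run_store_apply, Expr.val]
    rw [hm₂, hsumLoop, this, h0, zero_add, Finset.sum_filter]
    push_cast
    rfl
  have hrun' : tryPair.run m = if d T.1 T.2 + lam ≤ ∑ v with v ∈ pball G d T, α v then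
      growSet.run ((set aSet (sc iP)).run m₂) else m₂ := by
    refine hrun.trans ?_
    simp only [run_block_cons, run_block_nil, ← hm₁, ← hm₂, run_ifLt, run_skip]
    have e2 : (Expr.add (at_ aScaled iP) (sc aLam)).val m₂ = (d T.1 T.2 + lam : ℕ) := by
      simp only [Expr.val, hT₂, hb₂.scaled, hs₂.lambda]; push_cast; rfl
    have e3 : (Expr.add (sc aSum) (.const 1)).val m₂ =
        (∑ v with v ∈ pball G d T, α v : ℕ) + 1 := by
      simp only [Expr.val, hsum]
    rw [e2, e3]
    simp only [Int.lt_add_one_iff, Nat.cast_le]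
  by_cases h3 : d T.1 T.2 + lam ≤ ∑ v with v ∈ pball G d T, α v
  swap
  · rw [if_neg h3] at hrun'
    exact hskip (fun h => h3 h.2.2) m₂ hs₂ hrun'
  rw [if_pos h3] at hrun'
  rw [hrun']
  have hS : (set aSet (sc iP)).run m₂ aSet 0 = ix T := by
    simp only [run_store_apply, Expr.val, and_self, if_true, hT₂]
  obtain ⟨comp', hl, hgr, hmono⟩ := run_growSet (hb₂.run (c := set aSet (sc iP)) rfl)
    (K := K) (comp := comp) (hs₂.toLabels.congr (Memory.write_ne _ _ _ (by decide))
      (Memory.write_ne _ _ _ (by decide))) hp.part hS (by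
        rw [run_store, Memory.write_ne _ _ _ (by decide), hs₂.goal])
  have fr₃ : ∀ a, growSet.wr a = false → a ≠ aSet → growSet.run ((set aSet (sc iP)).run m₂) a = m₂ a :=
    fun a h1 h2 => by rw [run_frame _ _ h1, run_store, Memory.write_ne _ _ _ h2]
  refine ⟨comp', ⟨hl, ?_, ?_, ?_, ?_⟩, hp.grow d_self symm tri h1 h2 h3 hgr
    (fun hlt => hmono (by exact_mod_cast hlt)), hgr.freeCount_le, fun u v => hgr.congr,
    fun hlt _ _ => hmono (by exact_mod_cast hlt)⟩
  · rw [fr₃ aAlpha rfl (by decide)]; exact hs₂.alpha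
  · rw [fr₃ aLam rfl (by decide)]; exact hs₂.lambda
  · rw [fr₃ aGoal rfl (by decide)]; exact hs₂.goal
  · rw [fr₃ aRho rfl (by decide)]; exact hs₂.rho

theorem run_raise (h : Balls G D d k b N Q g m) {K : ℕ}
    (hs : MainState (bigSet G d g b) ρ K α lam comp m)
    (hp : PDState G d g b ρ K α lam comp)
    (mono : K < freeCount (bigSet G d g b) comp → ∀ T : Fin n × Fin n, d T.1 T.2 ≤ ρ →
      d T.1 T.2 + lam ≤ (open Classical in ∑ v with v ∈ pball G d T, α v) →
      ∀ v ∈ pball G d T, comp v = comp T.1) :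
    ∃ α' lam', MainState (bigSet G d g b) ρ K α' lam' comp (raise.run m) ∧
      PDState G d g b ρ K α' lam' comp ∧
      (K < freeCount (bigSet G d g b) comp → lam' = lam + 1) := by
  classical
  have hrun : raise.run m = _ := run_ifLt (sc aGoal) (sc aFree) (block
    [loop iV aN (ifEq (at_ aComp iV) (sc iV) (ifEq (at_ aBig iV) (.const 0)
      (store aAlpha (sc iV) (.add (at_ aAlpha iV) (.const 1))) skip) skip),
     set aLam (.add (sc aLam) (.const 1))]) skip m
  simp only [Expr.val, hs.goal, hs.free, run_skip, Nat.cast_lt] at hrun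
  by_cases hK : K < freeCount (bigSet G d g b) comp
  swap
  · rw [if_neg hK] at hrun
    exact ⟨α, lam, by rw [hrun]; exact hs, hp, fun h => absurd h hK⟩
  rw [if_pos hK] at hrun
  simp only [run_block_cons, run_block_nil] at hrun
  set m₁ := (loop iV aN (ifEq (at_ aComp iV) (sc iV) (ifEq (at_ aBig iV) (.const 0)
      (store aAlpha (sc iV) (.add (at_ aAlpha iV) (.const 1))) skip) skip)).run m with hm₁
  have fr₁ : ∀ a, a ≠ aAlpha → a ≠ iV → m₁ a = m a := fun a ha hb => by
    rw [hm₁, run_frame _ _ (by simp [wr, ifEq, ha, hb])]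
  have h1 := (run_each (x := iV) (b := aN) (a := aAlpha) (m := m)
    (p := ifEq (at_ aComp iV) (sc iV) (ifEq (at_ aBig iV) (.const 0)
      (store aAlpha (sc iV) (.add (at_ aAlpha iV) (.const 1))) skip) skip) 0
    (fun v o => o + if comp v = v ∧ v ∉ bigSet G d g b then 1 else 0) h.card (by decide)
    (fun v m' hfr hx j => by
      simp only [run_ifEq_apply, run_store_apply, run_skip, Expr.val, hx, hfr aComp rfl,
        hfr aBig rfl, hs.label, h.cover, cast_eq_cast_iff, zero_add]
      by_cases hj : j = (v : ℕ)
      · subst hj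
        by_cases h1 : comp v = v <;> by_cases h2 : v ∈ bigSet G d g b <;> simp [h1, h2]
      · simp [hj])).1
  refine ⟨_, lam + 1, ⟨⟨?_, ?_⟩, ?_, ?_, ?_, ?_⟩, hp.raise hK (mono hK), fun _ => rfl⟩
  all_goals rw [hrun]
  · rw [run_store, Memory.write_ne _ _ _ (by decide), fr₁ aComp (by decide) (by decide)]
    exact hs.label
  · rw [run_store, Memory.write_ne _ _ _ (by decide), fr₁ aFree (by decide) (by decide)]
    exact hs.free
  · intro v
    have := h1 v
    rw [zero_add, hs.alpha] at this
    rw [run_store, Memory.write_ne _ _ _ (by decide), hm₁, this]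
    push_cast
    rfl
  · simp only [run_store_apply, Expr.val, and_self, if_true, fr₁ aLam (by decide) (by decide),
      hs.lambda]
    push_cast
    rfl
  · rw [run_store, Memory.write_ne _ _ _ (by decide), fr₁ aGoal (by decide) (by decide)]
    exact hs.goal
  · rw [run_store, Memory.write_ne _ _ _ (by decide), fr₁ aRho (by decide) (by decide)]
    exact hs.rho

/-- Labels are only ever coarsened, so a ball that lies in one class continues to do so. After one
pass over all pairs every tight ball lies in one class, unless the goal has been reached; this is
what `PDState.raise` requires. While the goal is not reached, `lam` counts the rounds. -/
theorem run_rounds (d_self : ∀ u, d u u = 0) (symm : ∀ u v, d u v = d v u)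
    (tri : ∀ u v w, d u w ≤ d u v + d v w) (h : Balls G D d k b N Q g m) {K : ℕ}
    (hs : MainState (bigSet G d g b) ρ K α 0 comp m) (hp : PDState G d g b ρ K α 0 comp) :
    ∃ α' lam' comp', MainState (bigSet G d g b) ρ K α' lam' comp' (rounds.run m) ∧
      PDState G d g b ρ K α' lam' comp' ∧
      (K < freeCount (bigSet G d g b) comp' → lam' = Q) := by
  classical
  refine run_loop_inv (x := iR) (b := aRounds) (m := m) (p := block [loop iP aNN tryPair, raise])
    (I := fun t m' => ∃ α' lam' comp', MainState (bigSet G d g b) ρ K α' lam' comp' m' ∧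
      PDState G d g b ρ K α' lam' comp' ∧ (K < freeCount (bigSet G d g b) comp' → lam' = t)) Q
    h.rounds ⟨α, 0, comp, hs, hp, fun _ => rfl⟩ ?_ ?_
  · rintro t m' z ⟨α', lam', comp', h1, h2⟩
    exact ⟨α', lam', comp', h1.congr fun a _ _ => Memory.write_ne _ _ _ (by omega), h2⟩
  · rintro t ht m' hfr hx ⟨α', lam', comp', h1, h2, h3⟩
    have hb' : Balls G D d k b N Q g m' := h.congr fun a ha h1 =>
      hfr a (plain.wr_eq (lo := 33) rfl ha h1)
    simp only [run_block_cons, run_block_nil]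
    obtain ⟨comp₁, i1, i2, i3, i4⟩ := run_loop_inv (x := iP) (b := aNN) (m := m') (p := tryPair)
      (I := fun p m'' => ∃ comp₁, MainState (bigSet G d g b) ρ K α' lam' comp₁ m'' ∧
        PDState G d g b ρ K α' lam' comp₁ ∧
        freeCount (bigSet G d g b) comp₁ ≤ freeCount (bigSet G d g b) comp' ∧
        (K < freeCount (bigSet G d g b) comp₁ → ∀ T : Fin n × Fin n, ix T < p → d T.1 T.2 ≤ ρ →
          d T.1 T.2 + lam' ≤ ∑ v with v ∈ pball G d T, α' v →
          ∀ v ∈ pball G d T, comp₁ v = comp₁ T.1)) (n * n) hb'.pairs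
      ⟨comp', h1, h2, le_rfl, fun _ T hT => absurd hT (Nat.not_lt_zero _)⟩
      (by
        rintro p m'' z ⟨comp₁, j1, j2⟩
        exact ⟨comp₁, j1.congr fun a _ _ => Memory.write_ne _ _ _ (by omega), j2⟩)
      (by
        rintro p hp m'' hfr' hx' ⟨comp₁, j1, j2, j3, j4⟩
        obtain ⟨S, hS⟩ := exists_ix ⟨p, hp⟩
        have hS' : ix S = p := hS
        obtain ⟨comp₂, l1, l2, l3, l4, l5⟩ := run_tryPair d_self symm tri (hb'.congr fun a ha h1 =>
          hfr' a (plain.wr_eq (lo := 33) rfl ha h1)) j1 j2 (T := S) (by rw [hx', hS'])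
        refine ⟨comp₂, l1, l2, l3.trans j3, fun hK T hT hρ ht v hv => ?_⟩
        rcases Nat.lt_succ_iff_lt_or_eq.1 hT with hT | hT
        · exact l4 _ _ (j4 (lt_of_lt_of_le hK l3) T hT hρ ht v hv)
        · have : T = S := ix_inj (hT.trans hS'.symm)
          subst this
          exact l5 hK hρ ht v hv)
    obtain ⟨α₂, lam₂, l1, l2, l3⟩ := run_raise (hb'.run (c := loop iP aNN tryPair) rfl) i1 i2
      (fun hK T => i4 hK T (ix_lt T))
    exact ⟨α₂, lam₂, comp₁, l1, l2, fun hK => by rw [l3 hK, h3 (lt_of_lt_of_le hK i3)]⟩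

end ConnectedMSR

namespace ConnectedMSR

open RAM RAM.Cmd

variable {n : ℕ} {G : SimpleGraph (Fin n)} {D d : Fin n → Fin n → ℕ} {k b N Q : ℕ}
  {g : ℕ → Fin n × Fin n} {m m' : Memory} {comp cen : Fin n → Fin n}

/-! ### The value of a labelling -/

theorem Tables.run (h : Tables G D k b N Q m) {c : Cmd} (hc : c.plain 20 = true) :
    Tables G D k b N Q (c.run m) :=
  h.congr fun _ ha h1 => run_frame _ _ (plain.wr_eq hc ha h1)

theorem Tables.dist_val (h : Tables G D k b N Q m) {u v : ℕ} {x y : Fin n}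
    (hu : m u 0 = (x : ℕ)) (hv : m v 0 = (y : ℕ)) :
    (Expr.load aDist (.add (at_ aOff u) (sc v))).val m = D x y := by
  simp only [Expr.val, hu, hv, h.off_vertex]
  rw [← h.dist (x, y)]
  congr 1

theorem run_evalCenter (h : Tables G D k b N Q m)
    (hc : ∀ v : Fin n, m aComp (v : ℕ) = (comp v : ℕ)) {l c : Fin n}
    (hl : m iU 0 = (l : ℕ)) (hv : m iV 0 = (c : ℕ)) :
    evalCenter.run m aRad 0 = classRadius D comp l c := by
  simp only [evalCenter, run_block_cons, run_block_nil]
  set m₁ := (set aRad (.const 0)).run m with hm₁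
  have fr₁ : ∀ a, a ≠ aRad → m₁ a = m a := fun a ha => by
    rw [hm₁, run_store, Memory.write_ne _ _ _ ha]
  have := run_loop_inv (x := iW) (b := aN) (m := m₁) (p := ifEq (at_ aComp iW) (sc iU)
    (ifLt (sc aRad) (.load aDist (.add (at_ aOff iV) (sc iW)))
      (set aRad (.load aDist (.add (at_ aOff iV) (sc iW)))) skip) skip)
    (I := fun t m' => m' aRad 0 =
      ((Finset.univ.filter fun v : Fin n => comp v = l ∧ v.val < t).sup (D c) : ℕ)) n
    (by rw [fr₁ _ (by decide), h.card]) (by simp [hm₁, run_store_apply, Expr.val])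
    (fun t m' z hI => by rwa [Memory.write_ne _ _ _ (by decide)])
    (fun t ht m' hfr hx hI => by
      have hfr' : ∀ a, a ≠ aRad → a ≠ iW → m' a = m a := fun a h1 h2 => by
        rw [hfr a (by simp [wr, ifEq, ifLt, h1, h2]), fr₁ a h1]
      have ht' : Tables G D k b N Q m' := h.congr fun a ha _ => hfr' a (by omega) (by omega)
      have hset : (Finset.univ.filter fun v : Fin n => comp v = l ∧ v.val < t + 1) =
          if comp ⟨t, ht⟩ = l then
            insert ⟨t, ht⟩ (Finset.univ.filter fun v : Fin n => comp v = l ∧ v.val < t)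
          else (Finset.univ.filter fun v : Fin n => comp v = l ∧ v.val < t) := by
        ext v
        have hvt : v.val = t → v = ⟨t, ht⟩ := fun h => Fin.ext h
        split_ifs with hcl <;>
          simp only [Finset.mem_filter, Finset.mem_univ, true_and, Finset.mem_insert]
        · constructor
          · rintro ⟨h1, h2⟩
            by_cases h3 : v.val = t
            · exact Or.inl (hvt h3)
            · exact Or.inr ⟨h1, by omega⟩
          · rintro (rfl | ⟨h1, h2⟩)
            · exact ⟨hcl, Nat.lt_succ_self t⟩
            · exact ⟨h1, by omega⟩
        · constructor
          · rintro ⟨h1, h2⟩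
            refine ⟨h1, lt_of_le_of_ne (by omega) fun h3 => hcl ?_⟩
            rw [← hvt h3, h1]
          · rintro ⟨h1, h2⟩
            exact ⟨h1, by omega⟩
      have e1 := ht'.dist_val (u := iV) (v := iW) (x := c) (y := ⟨t, ht⟩)
        (by rw [hfr' _ (by decide) (by decide), hv]) hx
      have e2 : (at_ aComp iW).val m' = (comp ⟨t, ht⟩ : ℕ) := by
        simp only [Expr.val, hx, hfr' aComp (by decide) (by decide)]
        exact hc ⟨t, ht⟩
      have e3 : (sc iU).val m' = (l : ℕ) := by
        simp only [Expr.val, hfr' iU (by decide) (by decide), hl]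
      have e4 : (sc aRad).val m' = m' aRad 0 := rfl
      rw [run_ifEq_apply, run_ifLt_apply, run_store_apply, run_skip, e1, e2, e3, e4, hI, hset]
      by_cases hcl : comp ⟨t, ht⟩ = l
      · rw [if_pos (by rw [hcl]), if_pos hcl, Finset.sup_insert]
        split_ifs with h1 h2
        · rw [sup_eq_left.2 (by exact_mod_cast h1.le)]
        · exact absurd ⟨rfl, rfl⟩ h2
        · rw [sup_eq_right.2 (by exact_mod_cast not_lt.1 h1)]
      · rw [if_neg (by rwa [cast_eq_cast_iff]), if_neg hcl])
  rw [this]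
  simp only [Fin.is_lt, and_true]
  rfl

theorem run_evalClass (h : Tables G D k b N Q m)
    (hc : ∀ v : Fin n, m aComp (v : ℕ) = (comp v : ℕ)) {l : Fin n}
    (hl : m iU 0 = (l : ℕ)) (hll : comp l = l) :
    ∃ c, comp c = l ∧ (∀ c', comp c' = l → classRadius D comp l c ≤ classRadius D comp l c') ∧
      evalClass.run m aCen (l : ℕ) = (c : ℕ) ∧
      (∀ j : ℤ, j ≠ (l : ℕ) → evalClass.run m aCen j = m aCen j) ∧
      evalClass.run m aTotal 0 = m aTotal 0 + classRadius D comp l c := by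
  simp only [evalClass, run_block_cons, run_block_nil]
  set m₁ := (set aMin (.const (-1))).run m with hm₁
  have fr₁ : ∀ a, a ≠ aMin → m₁ a = m a := fun a ha => by
    rw [hm₁, run_store, Memory.write_ne _ _ _ ha]
  set body := ifEq (at_ aComp iV) (sc iU) (block [evalCenter,
    ifLt (sc aMin) (.const 0) (block [set aMin (sc aRad), store aCen (sc iU) (sc iV)])
     (ifLt (sc aRad) (sc aMin) (block [set aMin (sc aRad), store aCen (sc iU) (sc iV)]) skip)]) skip
    with hbody
  have hwr : ∀ a, a ≠ iV → a ≠ aMin → a ≠ aCen → a ≠ aRad → a ≠ iW →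
      (loop iV aN body).wr a = false := fun a h1 h2 h3 h4 h5 => by
    simp [hbody, wr, ifEq, ifLt, block, evalCenter, h1, h2, h3, h4, h5]
  have hI := run_loop_inv (x := iV) (b := aN) (m := m₁) (p := body)
    (I := fun t m' => (∀ j : ℤ, j ≠ (l : ℕ) → m' aCen j = m aCen j) ∧
      ((m' aMin 0 = -1 ∧ ∀ v : Fin n, comp v = l → t ≤ v.val) ∨
        ∃ c, comp c = l ∧ m' aMin 0 = classRadius D comp l c ∧ m' aCen (l : ℕ) = (c : ℕ) ∧
          ∀ c' : Fin n, comp c' = l → c'.val < t →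
            classRadius D comp l c ≤ classRadius D comp l c')) n
    (by rw [fr₁ _ (by decide), h.card])
    ⟨fun j _ => by rw [fr₁ _ (by decide)],
      Or.inl ⟨by simp [hm₁, run_store_apply, Expr.val], fun _ _ => Nat.zero_le _⟩⟩
    (fun t m' z hI => by
      rwa [Memory.write_ne _ _ _ (show aCen ≠ iV by decide),
        Memory.write_ne _ _ _ (show aMin ≠ iV by decide)])
    (fun t ht m' hfr hx hI => by
      have hfr' : ∀ a, a ≠ iV → a ≠ aMin → a ≠ aCen → a ≠ aRad → a ≠ iW → m' a = m a :=
        fun a h1 h2 h3 h4 h5 => by rw [hfr a (hwr a h1 h2 h3 h4 h5), fr₁ a h2]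
      have ht' : Tables G D k b N Q m' :=
        h.congr fun a ha _ => hfr' a (by omega) (by omega) (by omega) (by omega) (by omega)
      have hc' : ∀ v : Fin n, m' aComp (v : ℕ) = (comp v : ℕ) := by
        rw [hfr' aComp (by decide) (by decide) (by decide) (by decide) (by decide)]; exact hc
      have hl' : m' iU 0 = (l : ℕ) := by
        rw [hfr' iU (by decide) (by decide) (by decide) (by decide) (by decide), hl]
      have e2 : (at_ aComp iV).val m' = (comp ⟨t, ht⟩ : ℕ) := by
        simp only [Expr.val, hx]; exact hc' ⟨t, ht⟩
      have e3 : (sc iU).val m' = (l : ℕ) := hl'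
      rw [hbody, run_ifEq, e2, e3]
      by_cases hcl : comp ⟨t, ht⟩ = l
      swap
      · rw [if_neg (by rwa [cast_eq_cast_iff]), run_skip]
        refine ⟨hI.1, hI.2.imp (fun h => ⟨h.1, fun v hv => ?_⟩) ?_⟩
        · have := h.2 v hv
          refine lt_of_le_of_ne this fun h3 => hcl ?_
          rw [show (⟨t, ht⟩ : Fin n) = v from Fin.ext h3, hv]
        · rintro ⟨c, h1, h2, h3, h4⟩
          refine ⟨c, h1, h2, h3, fun c' hc hlt => h4 c' hc ?_⟩
          refine lt_of_le_of_ne (by omega) fun h3 => hcl ?_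
          rw [show (⟨t, ht⟩ : Fin n) = c' from Fin.ext h3.symm, hc]
      rw [if_pos (by rw [hcl])]
      simp only [run_block_cons, run_block_nil, run_ifLt, run_skip]
      set m₂ := evalCenter.run m' with hm₂
      have hrad : m₂ aRad 0 = classRadius D comp l ⟨t, ht⟩ := run_evalCenter ht' hc' hl' hx
      have f1 : m₂ aMin = m' aMin := run_frame evalCenter _ rfl
      have f2 : m₂ aCen = m' aCen := run_frame evalCenter _ rfl
      have f3 : m₂ iU = m' iU := run_frame evalCenter _ rfl
      have f4 : m₂ iV = m' iV := run_frame evalCenter _ rfl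
      set m₃ := (store aCen (sc iU) (sc iV)).run ((set aMin (sc aRad)).run m₂) with hm₃
      have e4 : (sc aMin).val m₂ = m' aMin 0 := by simp only [Expr.val, f1]
      have e5 : (sc aRad).val m₂ = classRadius D comp l ⟨t, ht⟩ := hrad
      have hm₃min : m₃ aMin 0 = classRadius D comp l ⟨t, ht⟩ := by
        rw [hm₃, run_store, Memory.write_ne _ _ _ (by decide), run_store, e5]
        exact Memory.write_same _ _ _ _
      have hm₃cen : ∀ j, m₃ aCen j = if j = (l : ℕ) then (t : ℤ) else m' aCen j := by
        intro j
        rw [hm₃, run_store_apply, run_store, Memory.write_ne _ _ _ (show aCen ≠ aMin by decide), f2]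
        simp only [Expr.val, Memory.write_ne _ _ _ (show iU ≠ aMin by decide),
          Memory.write_ne _ _ _ (show iV ≠ aMin by decide), f3, f4, hl', hx, true_and]
      rw [e4, e5]
      have new : (∀ j : ℤ, j ≠ (l : ℕ) → m₃ aCen j = m aCen j) := fun j hj => by
        rw [hm₃cen, if_neg hj, hI.1 j hj]
      have cen : m₃ aCen (l : ℕ) = ((⟨t, ht⟩ : Fin n) : ℕ) := by rw [hm₃cen, if_pos rfl]
      rcases hI.2 with ⟨h1, h2⟩ | ⟨c, h1, h2, h3, h4⟩
      · rw [h1, if_pos (by simp [Expr.val])]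
        refine ⟨new, Or.inr ⟨_, hcl, hm₃min, cen, fun c' hc hlt => ?_⟩⟩
        have := h2 c' hc
        rw [show c' = ⟨t, ht⟩ from Fin.ext (by dsimp only; omega)]
      · rw [h2, if_neg (by simp [Expr.val])]
        by_cases hlt : classRadius D comp l ⟨t, ht⟩ < classRadius D comp l c
        · rw [if_pos (by exact_mod_cast hlt)]
          refine ⟨new, Or.inr ⟨_, hcl, hm₃min, cen, fun c' hc hlt' => ?_⟩⟩
          rcases Nat.lt_succ_iff_lt_or_eq.1 hlt' with h5 | h5
          · exact hlt.le.trans (h4 c' hc h5)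
          · rw [show c' = ⟨t, ht⟩ from Fin.ext h5]
        · rw [if_neg (by exact_mod_cast hlt)]
          refine ⟨by rw [f2]; exact hI.1, Or.inr ⟨c, h1, by rw [f1, h2], by rw [f2, h3],
            fun c' hc hlt' => ?_⟩⟩
          rcases Nat.lt_succ_iff_lt_or_eq.1 hlt' with h5 | h5
          · exact h4 c' hc h5
          · rw [show c' = ⟨t, ht⟩ from Fin.ext h5]; exact not_lt.1 hlt)
  set m₂ := (loop iV aN body).run m₁ with hm₂
  have htot : m₂ aTotal = m aTotal := by
    rw [hm₂, run_frame _ _ (hwr _ (by decide) (by decide) (by decide) (by decide) (by decide)),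
      fr₁ _ (by decide)]
  rcases hI.2 with ⟨-, h2⟩ | ⟨c, h1, h2, h3, h4⟩
  · have := h2 l hll
    have := l.2
    omega
  · refine ⟨c, h1, fun c' hc => h4 c' hc c'.2, ?_, fun j hj => ?_, ?_⟩
    · rw [run_store, Memory.write_ne _ _ _ (by decide), h3]
    · rw [run_store, Memory.write_ne _ _ _ (by decide), hI.1 j hj]
    · simp only [run_store_apply, Expr.val, and_self, if_true, h2, htot]

theorem run_evaluate (h : Tables G D k b N Q m)
    (hc : ∀ v : Fin n, m aComp (v : ℕ) = (comp v : ℕ)) :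
    ∃ cen : Fin n → Fin n, (∀ l, comp l = l → comp (cen l) = l ∧
      evaluate.run m aCen (l : ℕ) = (cen l : ℕ) ∧
      ∀ c, comp c = l → classRadius D comp l (cen l) ≤ classRadius D comp l c) ∧
      evaluate.run m aTotal 0 = (∑ l with comp l = l, classRadius D comp l (cen l) : ℕ) := by
  simp only [evaluate, run_block_cons, run_block_nil]
  set m₁ := (set aTotal (.const 0)).run m with hm₁
  have fr₁ : ∀ a, a ≠ aTotal → m₁ a = m a := fun a ha => by
    rw [hm₁, run_store, Memory.write_ne _ _ _ ha]
  have := run_loop_inv (x := iU) (b := aN) (m := m₁)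
    (p := ifEq (at_ aComp iU) (sc iU) evalClass skip)
    (I := fun t m' => ∃ cen : Fin n → Fin n, (∀ l : Fin n, l.val < t → comp l = l →
      comp (cen l) = l ∧ m' aCen (l : ℕ) = (cen l : ℕ) ∧
      ∀ c, comp c = l → classRadius D comp l (cen l) ≤ classRadius D comp l c) ∧
      m' aTotal 0 = (∑ l with comp l = l ∧ l.val < t, classRadius D comp l (cen l) : ℕ)) n
    (by rw [fr₁ _ (by decide), h.card])
    ⟨id, fun l hl => absurd hl (Nat.not_lt_zero _), by simp [hm₁, run_store_apply, Expr.val]⟩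
    (fun t m' z hI => by
      rwa [Memory.write_ne _ _ _ (show aCen ≠ iU by decide),
        Memory.write_ne _ _ _ (show aTotal ≠ iU by decide)])
    (fun t ht m' hfr hx hI => by
      obtain ⟨cen, hI, htot⟩ := hI
      have ht' : Tables G D k b N Q m' := h.congr fun a ha ha1 => by
        rw [hfr a (plain.wr_eq (lo := 20) rfl ha ha1), fr₁ a (by omega)]
      have hc' : ∀ v : Fin n, m' aComp (v : ℕ) = (comp v : ℕ) := by
        rw [hfr aComp rfl, fr₁ _ (by decide)]; exact hc
      have e2 : (at_ aComp iU).val m' = (comp ⟨t, ht⟩ : ℕ) := by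
        simp only [Expr.val, hx]; exact hc' ⟨t, ht⟩
      have e3 : (sc iU).val m' = ((⟨t, ht⟩ : Fin n) : ℕ) := hx
      rw [run_ifEq, e2, e3]
      have hcase : ∀ l : Fin n, l.val < t + 1 → comp l = l → l.val < t ∨ l = ⟨t, ht⟩ :=
        fun l hl _ => (Nat.lt_succ_iff_lt_or_eq.1 hl).imp_right fun h => Fin.ext h
      by_cases hcl : comp ⟨t, ht⟩ = ⟨t, ht⟩
      swap
      · rw [if_neg (by rwa [cast_eq_cast_iff]), run_skip]
        refine ⟨cen, fun l hl hll => (hcase l hl hll).elim (fun h => hI l h hll)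
          fun h => absurd hll (h ▸ hcl), ?_⟩
        rw [htot]
        congr 2
        ext l
        simp only [Finset.mem_filter, Finset.mem_univ, true_and]
        refine and_congr_right fun hll => ⟨fun h => by omega, fun h => ?_⟩
        exact (hcase l h hll).resolve_right fun h => absurd hll (h ▸ hcl)
      rw [if_pos (by rw [hcl])]
      obtain ⟨c, h1, h2, h3, h4, h5⟩ := run_evalClass ht' hc' (l := ⟨t, ht⟩) hx hcl
      have hne : ∀ l : Fin n, l.val < t → l ≠ ⟨t, ht⟩ := fun l hl h => by
        rw [h] at hl; exact lt_irrefl _ hl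
      refine ⟨Function.update cen ⟨t, ht⟩ c, fun l hl hll => ?_, ?_⟩
      · rcases hcase l hl hll with h | rfl
        · rw [Function.update_of_ne (hne l h), h4 _ fun h' => hne l h (cast_eq_cast_iff.1 h')]
          exact hI l h hll
        · rw [Function.update_self]
          exact ⟨h1, h3, h2⟩
      · have hset : (Finset.univ.filter fun l : Fin n => comp l = l ∧ l.val < t + 1) =
            insert ⟨t, ht⟩ (Finset.univ.filter fun l : Fin n => comp l = l ∧ l.val < t) := by
          ext l
          simp only [Finset.mem_filter, Finset.mem_univ, true_and, Finset.mem_insert]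
          constructor
          · rintro ⟨h1, h2⟩
            exact (hcase l h2 h1).elim (fun h => Or.inr ⟨h1, h⟩) Or.inl
          · rintro (rfl | ⟨h1, h2⟩)
            · exact ⟨hcl, Nat.lt_succ_self t⟩
            · exact ⟨h1, by omega⟩
        rw [h5, htot, hset, Finset.sum_insert (by simp), Function.update_self]
        push_cast
        rw [add_comm]
        congr 1
        refine Finset.sum_congr rfl fun l hl => ?_
        rw [Function.update_of_ne (hne l (Finset.mem_filter.1 hl).2.2)])
  simpa using this

/-! ### The best solution found so far -/

/-- A clustering with at most `k` clusters of total radius `X`. -/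
structure Candidate (G : SimpleGraph (Fin n)) (D : Fin n → Fin n → ℕ) (k : ℕ)
    (comp cen : Fin n → Fin n) (X : ℕ) : Prop where
  idem : ∀ v, comp (comp v) = comp v
  conn : ∀ u v, comp u = comp v →
    Relation.ReflTransGen (fun a b => G.Adj a b ∧ comp a = comp b) u v
  card_le : (Finset.univ.filter fun v => comp v = v).card ≤ k
  center : ∀ l, comp l = l → comp (cen l) = l
  total : X = ∑ l with comp l = l, classRadius D comp l (cen l)

structure Stored (comp cen : Fin n → Fin n) (X : ℕ) (m : Memory) : Prop where
  has : m aHas 0 = 1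
  best : m aBest 0 = X
  label : ∀ v : Fin n, m aBestComp (v : ℕ) = (comp v : ℕ)
  center : ∀ l : Fin n, comp l = l → m aBestCen (l : ℕ) = (cen l : ℕ)

/-- The best solution found so far, if there is one. -/
def Kept (G : SimpleGraph (Fin n)) (D : Fin n → Fin n → ℕ) (k : ℕ) (m : Memory) : Prop :=
  m aHas 0 = 0 ∨ ∃ comp cen X, Candidate G D k comp cen X ∧ Stored comp cen X m

theorem Kept.congr (h : Kept G D k m) (hm : ∀ a, 20 ≤ a → a ≤ 23 → m' a = m a) :
    Kept G D k m' := by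
  rcases h with h | ⟨comp, cen, X, h1, ⟨h2, h3, h4, h5⟩⟩
  · exact Or.inl (by rw [hm _ (by decide) (by decide), h])
  · refine Or.inr ⟨comp, cen, X, h1, ⟨?_, ?_, ?_, ?_⟩⟩ <;> rw [hm _ (by decide) (by decide)] <;>
      assumption

/-- The best solution found so far does not get worse. -/
def Improves (m m' : Memory) : Prop :=
  m aHas 0 = 1 → m' aHas 0 = 1 ∧ m' aBest 0 ≤ m aBest 0

theorem Improves.trans {m'' : Memory} (h : Improves m m') (h' : Improves m' m'') :
    Improves m m'' := fun h1 =>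
  ⟨(h' (h h1).1).1, (h' (h h1).1).2.trans (h h1).2⟩

theorem Improves.of_eq (hm : ∀ a, 20 ≤ a → a ≤ 23 → m' a = m a) : Improves m m' := fun h => by
  rw [hm _ (by decide) (by decide), hm _ (by decide) (by decide)]
  exact ⟨h, le_rfl⟩

theorem run_keep (h : Tables G D k b N Q m) (hc : ∀ v : Fin n, m aComp (v : ℕ) = (comp v : ℕ))
    (hcen : ∀ l : Fin n, comp l = l → m aCen (l : ℕ) = (cen l : ℕ)) {X : ℕ}
    (hX : m aTotal 0 = X) : Stored comp cen X (keep.run m) := by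
  set m₁ := (set aBest (sc aTotal)).run ((set aHas (.const 1)).run m) with hm₁
  set m₂ := (loop iV aN (store aBestComp (sc iV) (at_ aComp iV))).run m₁ with hm₂
  have hrun : keep.run m = (loop iV aN (store aBestCen (sc iV) (at_ aCen iV))).run m₂ := rfl
  have fr₁ : ∀ a, a ≠ aBest → a ≠ aHas → m₁ a = m a := fun a h1 h2 => by
    rw [hm₁, run_store, run_store, Memory.write_ne _ _ _ h1, Memory.write_ne _ _ _ h2]
  have c1 : m₁ aN 0 = n := by rw [fr₁ _ (by decide) (by decide), h.card]
  have c2 : m₂ aN 0 = n := by rw [hm₂, run_frame _ _ rfl, c1]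
  have h1 := (run_each (x := iV) (a := aBestComp) (m := m₁)
    (p := store aBestComp (sc iV) (at_ aComp iV)) 0 (fun v _ => m aComp (v : ℕ)) c1 (by decide)
    (fun t m' hfr hx j => by
      simp [run_store_apply, Expr.val, hx, hfr aComp rfl, fr₁ aComp (by decide) (by decide)])).1
  have h2 := (run_each (x := iV) (a := aBestCen) (m := m₂)
    (p := store aBestCen (sc iV) (at_ aCen iV)) 0 (fun v _ => m aCen (v : ℕ)) c2 (by decide)
    (fun t m' hfr hx j => by
      have : m₂ aCen = m aCen := by
        rw [hm₂, run_frame _ _ rfl, fr₁ aCen (by decide) (by decide)]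
      simp [run_store_apply, Expr.val, hx, hfr aCen rfl, this])).1
  rw [hrun]
  refine ⟨?_, ?_, fun v => ?_, fun l hl => ?_⟩
  · rw [run_frame _ _ rfl, hm₂, run_frame _ _ rfl, hm₁, run_store,
      Memory.write_ne _ _ _ (by decide), run_store]
    exact Memory.write_same _ _ _ _
  · rw [run_frame _ _ rfl, hm₂, run_frame _ _ rfl, hm₁, run_store_apply]
    simp only [Expr.val, and_self, if_true]
    rw [run_store, Memory.write_ne _ _ _ (by decide), hX]
  · have := h1 v
    rw [zero_add] at this
    rw [run_frame _ _ rfl]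
    exact this.trans (hc v)
  · have := h2 l
    rw [zero_add] at this
    exact this.trans (hcen l hl)

/-- The evaluation picks the best center of each class. The stored value is therefore at most the
one for any other centers, in particular for those whose existence `PDState.centers` asserts. -/
theorem run_select (h : Tables G D k b N Q m) {V₀ : Set (Fin n)} (hl : Labels V₀ comp m)
    (hpart : Labelling G V₀ comp)
    (hcard : freeCount V₀ comp ≤ k - b → (Finset.univ.filter fun v => comp v = v).card ≤ k)
    (hk : Kept G D k m) :
    Kept G D k (select.run m) ∧ Improves m (select.run m) ∧
      (freeCount V₀ comp ≤ k - b → select.run m aHas 0 = 1 ∧ ∀ cen : Fin n → Fin n,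
        (∀ l, comp l = l → comp (cen l) = l) →
        select.run m aBest 0 ≤ (∑ l with comp l = l, classRadius D comp l (cen l) : ℕ)) := by
  have hrun : select.run m = _ := run_ifLt (sc aRest) (sc aFree) skip (block [evaluate,
    ifEq (sc aHas) (.const 1) (ifLt (sc aTotal) (sc aBest) keep skip) keep]) m
  simp only [Expr.val, h.rest, hl.free, run_skip, Nat.cast_lt] at hrun
  by_cases hf : k - b < freeCount V₀ comp
  · rw [if_pos hf] at hrun
    rw [hrun]
    exact ⟨hk, fun h => ⟨h, le_rfl⟩, fun h => absurd hf (by omega)⟩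
  rw [if_neg hf] at hrun
  simp only [run_block_cons, run_block_nil, run_ifEq, run_ifLt, run_skip] at hrun
  set m₁ := evaluate.run m with hm₁
  obtain ⟨cen, h1, h2⟩ := run_evaluate h hl.label
  rw [← hm₁] at h1 h2
  set X := ∑ l with comp l = l, classRadius D comp l (cen l) with hX
  have hfr : ∀ a, 20 ≤ a → a ≤ 23 → m₁ a = m a := fun a h1 h2 => by
    have : a = 20 ∨ a = 21 ∨ a = 22 ∨ a = 23 := by omega
    rcases this with rfl | rfl | rfl | rfl <;> exact run_frame _ _ rfl
  have hstore := run_keep (h.run (c := evaluate) rfl) (comp := comp) (cen := cen) (X := X)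
    (by rw [run_frame evaluate _ rfl]; exact hl.label) (fun l hl => (h1 l hl).2.1) h2
  rw [← hm₁] at hstore
  have hcand : Candidate G D k comp cen X :=
    ⟨hpart.idem, hpart.conn, hcard (not_lt.1 hf), fun l hl => (h1 l hl).1, rfl⟩
  have hopt : ∀ cen' : Fin n → Fin n, (∀ l, comp l = l → comp (cen' l) = l) →
      (X : ℤ) ≤ (∑ l with comp l = l, classRadius D comp l (cen' l) : ℕ) := fun cen' hcen' => by
    exact_mod_cast Finset.sum_le_sum fun l hl =>
      (h1 l (Finset.mem_filter.1 hl).2).2.2 _ (hcen' l (Finset.mem_filter.1 hl).2)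
  simp only [Expr.val, h2, hfr aHas (by decide) (by decide), hfr aBest (by decide) (by decide)]
    at hrun
  by_cases hhas : m aHas 0 = 1
  · rw [if_pos hhas] at hrun
    by_cases hlt : (X : ℤ) < m aBest 0
    · rw [if_pos hlt] at hrun
      rw [hrun]
      exact ⟨Or.inr ⟨_, _, _, hcand, hstore⟩, fun _ => ⟨hstore.has, by rw [hstore.best]; exact hlt.le⟩,
        fun _ => ⟨hstore.has, by rw [hstore.best]; exact hopt⟩⟩
    · rw [if_neg hlt] at hrun
      rw [hrun]
      refine ⟨hk.congr hfr, Improves.of_eq hfr, fun _ => ⟨by rw [hfr _ (by decide) (by decide), hhas],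
        fun cen' hcen' => ?_⟩⟩
      rw [hfr _ (by decide) (by decide)]
      exact (not_lt.1 hlt).trans (hopt cen' hcen')
  · rw [if_neg hhas] at hrun
    rw [hrun]
    exact ⟨Or.inr ⟨_, _, _, hcand, hstore⟩, fun h => absurd h hhas,
      fun _ => ⟨hstore.has, by rw [hstore.best]; exact hopt⟩⟩

/-! ### All guesses -/

/-- The best solution found so far is as good as the one for the guess `g`. -/
def Achieved (G : SimpleGraph (Fin n)) (D : Fin n → Fin n → ℕ) (k b N Q : ℕ)
    (g : ℕ → Fin n × Fin n) (m : Memory) : Prop :=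
  ∃ α lam comp, PDState G (scaled D N (D (g 0).1 (g 0).2)) g b
      (threshold (scaled D N (D (g 0).1 (g 0).2)) g b k) (k - b) α lam comp ∧
    (k - b < freeCount (bigSet G (scaled D N (D (g 0).1 (g 0).2)) g b) comp → lam = Q) ∧
    (freeCount (bigSet G (scaled D N (D (g 0).1 (g 0).2)) g b) comp ≤ k - b →
      m aHas 0 = 1 ∧ ∀ cen : Fin n → Fin n, (∀ l, comp l = l → comp (cen l) = l) →
        m aBest 0 ≤ (∑ l with comp l = l, classRadius D comp l (cen l) : ℕ))

theorem Achieved.improve (h : Achieved G D k b N Q g m) (hm : Improves m m') :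
    Achieved G D k b N Q g m' := by
  obtain ⟨α, lam, comp, h1, h2, h3⟩ := h
  exact ⟨α, lam, comp, h1, h2, fun hf =>
    ⟨(hm (h3 hf).1).1, fun cen hcen => (hm (h3 hf).1).2.trans ((h3 hf).2 cen hcen)⟩⟩

theorem run_tryGuess (D_self : ∀ u, D u u = 0) (symm : ∀ u v, D u v = D v u)
    (tri : ∀ u v w, D u w ≤ D u v + D v w) (hb : 0 < b) (hbk : b ≤ k)
    (h : Tables G D k b N Q m) (hk : Kept G D k m)
    (hg : ∀ j < b, m aGuess (j : ℕ) = ix (g j)) :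
    Kept G D k (tryGuess.run m) ∧ Improves m (tryGuess.run m) ∧
      Achieved G D k b N Q g (tryGuess.run m) := by
  set d := scaled D N (D (g 0).1 (g 0).2) with hd
  have d_self := scaled_self (N := N) (R := D (g 0).1 (g 0).2) D_self
  have d_symm := scaled_symm (N := N) (R := D (g 0).1 (g 0).2) symm
  have d_tri := scaled_tri (N := N) (R := D (g 0).1 (g 0).2) tri
  rw [← hd] at d_self d_symm d_tri
  have h1 := run_computeTables h hb hg
  rw [← hd] at h1
  set m₁ := computeBig.run (computeBalls.run (loadScaled.run m)) with hm₁
  obtain ⟨i1, i2, i3, i4⟩ := run_initLabels h1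
  have h2 := h1.run (c := initLabels) rfl
  set m₂ := initLabels.run m₁ with hm₂
  obtain ⟨comp, j1, j2⟩ := run_bigPhase h2 i1 i4
  have h3 := h2.run (c := bigPhase) rfl
  set m₃ := bigPhase.run m₂ with hm₃
  obtain ⟨l1, l2⟩ := run_setGoal h3 hb
  have h4 := h3.run (c := setGoal) rfl
  set m₄ := setGoal.run m₃ with hm₄
  have hs : MainState (bigSet G d g b) (threshold d g b k) (k - b) (fun _ => 0) 0 comp m₄ := by
    refine ⟨j1.congr (run_frame setGoal _ rfl) (run_frame setGoal _ rfl), ?_, ?_, l1, l2⟩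
    · rw [hm₄, hm₃, run_frame setGoal _ rfl, run_frame bigPhase _ rfl]; exact i2
    · rw [hm₄, hm₃, run_frame setGoal _ rfl, run_frame bigPhase _ rfl]; exact i3
  obtain ⟨α, lam, comp', r1, r2, r3⟩ := run_rounds d_self d_symm d_tri h4 hs
    (PDState.init d_self d_symm d_tri j2 _ _)
  have h5 := h4.run (c := rounds) rfl
  have hfr : ∀ a, 20 ≤ a → a ≤ 23 → rounds.run m₄ a = m a := fun a h1 h2 => by
    have : a = 20 ∨ a = 21 ∨ a = 22 ∨ a = 23 := by omega
    rcases this with rfl | rfl | rfl | rfl <;>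
      rw [run_frame rounds _ rfl, hm₄, hm₃, hm₂, hm₁, run_frame setGoal _ rfl,
        run_frame bigPhase _ rfl, run_frame initLabels _ rfl, run_frame computeBig _ rfl, run_frame computeBalls _ rfl,
        run_frame loadScaled _ rfl]
  set m₅ := rounds.run m₄ with hm₅
  have hrun : tryGuess.run m = select.run m₅ := rfl
  obtain ⟨s1, s2, s3⟩ := run_select h5.toTables r1.toLabels r2.part
    (fun hf => r2.card_labels_le.trans (by omega)) (hk.congr hfr)
  rw [hrun]
  exact ⟨s1, (Improves.of_eq hfr).trans s2, α, lam, comp', r2, r3, s3⟩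

theorem wr_guessLoop {l a : ℕ} (ha : 100 + l ≤ a ∨ a < 20 ∧ a ≠ 1) :
    (guessLoop tryGuess l).wr a = false := by
  induction l with
  | zero =>
    rcases ha with ha | ha
    · simp only [guessLoop, tryGuess, loadScaled, computeBalls, computeBall, growBall, growBallStep,
        computeBig, initLabels, countFree, bigPhase, growSet, growStep, relabel, setGoal, rounds,
        tryPair, raise, select, evaluate, evalClass, evalCenter, keep, block, sweep, ifEq, ifLt, wr,
        Bool.or_eq_false_iff, beq_eq_false_iff_ne, and_true, true_and]
      omega
    · exact plain.wr_eq plain_tryGuess ha.1 ha.2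
  | succ l ih =>
    have := ih (by omega)
    simp only [guessLoop, block, wr, this, Bool.or_false, Bool.or_eq_false_iff, beq_eq_false_iff_ne]
    omega

theorem plain_guessLoop (l : ℕ) : (guessLoop tryGuess l).plain 20 = true := by
  induction l with
  | zero => exact plain_tryGuess
  | succ l ih =>
    simp only [guessLoop, block, plain, ih, wr, wr_guessLoop (l := l) (Or.inl le_rfl), Expr.additive]
    simp
    omega

/-- In the induction the cells from `l` on are fixed by outer loops, while those below `l` run
through all pairs. Since the best solution never gets worse, what is achieved for one guess persists
through the remaining ones. -/
theorem run_guessLoop (D_self : ∀ u, D u u = 0) (symm : ∀ u v, D u v = D v u)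
    (tri : ∀ u v w, D u w ≤ D u v + D v w) (hb : 0 < b) (hbk : b ≤ k) (l : ℕ)
    (h : Tables G D k b N Q m) (hk : Kept G D k m)
    (hg : ∀ j : ℕ, l ≤ j → j < b → m aGuess j = ix (g j)) :
    (∀ j : ℕ, l ≤ j → (guessLoop tryGuess l).run m aGuess j = m aGuess j) ∧
    Kept G D k ((guessLoop tryGuess l).run m) ∧ Improves m ((guessLoop tryGuess l).run m) ∧
      ∀ g' : ℕ → Fin n × Fin n, (∀ j, l ≤ j → j < b → g' j = g j) →
        Achieved G D k b N Q g' ((guessLoop tryGuess l).run m) := by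
  induction l generalizing m g with
  | zero =>
    have := fun g' hg' => run_tryGuess (N := N) (Q := Q) (g := g') D_self symm tri hb hbk h hk hg'
    refine ⟨fun j _ => by rw [guessLoop, run_frame tryGuess _ rfl],
      (this g fun j => hg j (Nat.zero_le j)).1, (this g fun j => hg j (Nat.zero_le j)).2.1,
      fun g' hg' => (this g' fun j hj => ?_).2.2⟩
    rw [hg' j (Nat.zero_le j) hj, hg j (Nat.zero_le j) hj]
  | succ l ih =>
    have := run_loop_inv (x := 100 + l) (b := aNN) (m := m)
      (p := block [store aGuess (.const l) (sc (100 + l)), guessLoop tryGuess l])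
      (I := fun t m' => (∀ j : ℕ, l + 1 ≤ j → m' aGuess j = m aGuess j) ∧ Kept G D k m' ∧
        Improves m m' ∧ ∀ g' : ℕ → Fin n × Fin n, (∀ j, l + 1 ≤ j → j < b → g' j = g j) →
          ix (g' l) < t → Achieved G D k b N Q g' m') (n * n) h.pairs
      ⟨fun _ _ => rfl, hk, fun h => ⟨h, le_rfl⟩, fun _ _ h => absurd h (Nat.not_lt_zero _)⟩
      (fun t m' z hI => by
        have hfr : ∀ a, a < 100 → m'.write (100 + l) 0 z a = m' a :=
          fun a ha => Memory.write_ne _ _ _ (by omega)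
        have hfr' : ∀ a, 20 ≤ a → a ≤ 23 → m'.write (100 + l) 0 z a = m' a :=
          fun a _ ha => hfr a (by omega)
        refine ⟨fun j hj => by rw [hfr _ (by decide), hI.1 j hj], hI.2.1.congr hfr',
          hI.2.2.1.trans (Improves.of_eq hfr'),
          fun g' h1 h2 => (hI.2.2.2 g' h1 h2).improve (Improves.of_eq hfr')⟩)
      (fun t ht m' hfr hx hI => by
        obtain ⟨S, hS⟩ := exists_ix ⟨t, ht⟩
        have hS' : ix S = t := hS
        simp only [run_block_cons, run_block_nil]
        set m₁ := (store aGuess (.const l) (sc (100 + l))).run m' with hm₁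
        have fr₁ : ∀ a, a ≠ aGuess → m₁ a = m' a := fun a ha => by
          rw [hm₁, run_store, Memory.write_ne _ _ _ ha]
        have hg₁ : ∀ j : ℕ, m₁ aGuess j = if j = l then (t : ℤ) else m' aGuess j := fun j => by
          simp only [hm₁, run_store_apply, Expr.val, hx, true_and, Nat.cast_inj]
        have ht₁ : Tables G D k b N Q m₁ := h.congr fun a ha ha1 => by
          rw [fr₁ a (by omega), hfr a (wr_guessLoop (l := l + 1) (Or.inr ⟨ha, ha1⟩))]
        have hfr' : ∀ a, 20 ≤ a → a ≤ 23 → m₁ a = m' a := fun a _ ha => fr₁ a (by omega)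
        obtain ⟨k1, k2, k3, k4⟩ := ih (g := Function.update g l S) ht₁ (hI.2.1.congr hfr')
          (fun j hlj hjb => by
            rw [hg₁]
            split_ifs with hjl
            · rw [hjl, Function.update_self, hS']
            · rw [Function.update_of_ne hjl, hI.1 j (by omega), hg j (by omega) hjb])
        have himp := (Improves.of_eq hfr').trans k3
        refine ⟨fun j hj => ?_, k2, hI.2.2.1.trans himp, fun g' hg' hlt => ?_⟩
        · rw [k1 j (by omega), hg₁, if_neg (by omega), hI.1 j hj]
        · rcases Nat.lt_succ_iff_lt_or_eq.1 hlt with hlt | heq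
          · exact (hI.2.2.2 g' hg' hlt).improve himp
          · refine k4 g' fun j hlj hjb => ?_
            by_cases hjl : j = l
            · rw [hjl, Function.update_self]
              exact ix_inj (heq.trans hS'.symm)
            · rw [Function.update_of_ne hjl]
              exact hg' j (by omega) hjb)
    exact ⟨this.1, this.2.1, this.2.2.1, fun g' hg' => this.2.2.2 g' hg' (ix_lt _)⟩

/-- After all guesses, the best solution is nearly optimal. -/
theorem run_guesses (D_self : ∀ u, D u u = 0) (symm : ∀ u v, D u v = D v u)
    (tri : ∀ u v w, D u w ≤ D u v + D v w) (hk2 : 2 ≤ k) {L C : ℕ} (hL : 1 ≤ L)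
    (h : Tables G D k (min L k) (C * n ^ 2) (n * (C * n ^ 2 + n) + 1) m) (h0 : m aHas 0 = 0) :
    ∀ S : Solution G k, Kept G D k ((guessLoop tryGuess L).run m) ∧
      (guessLoop tryGuess L).run m aHas 0 = 1 ∧
      ∀ X : ℕ, (guessLoop tryGuess L).run m aBest 0 = X →
        (∃ i v, S.label v = i ∧ 0 < D (S.center i) v) →
        C * L * X ≤ (3 * C * L + 3 * C + 9 * L) *
          ∑ i, classRadius D (fun v => S.center (S.label v)) (S.center i) (S.center i) := by
  intro S
  obtain ⟨g, hg⟩ := exists_guess (D := D) (C := C) hk2 hL S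
  obtain ⟨-, hkept, -, hach⟩ := run_guessLoop (g := g) D_self symm tri
    (show 0 < min L k by omega) (min_le_right _ _) L h (Or.inl h0) (fun j h1 h2 => by omega)
  obtain ⟨α, lam, comp, h1, h2, h3⟩ := hach g fun _ _ _ => rfl
  simp only [Fintype.card_fin] at hg
  obtain ⟨g1, g2⟩ := hg α lam comp h1
  -- With too many free classes left, `lam` would equal the number of rounds, which exceeds the
  -- bound in `exists_guess` by one.
  have hfree : freeCount (bigSet G (scaled D (C * n ^ 2) (D (g 0).1 (g 0).2)) g (min L k)) comp ≤
      k - min L k := by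
    by_contra hcon
    exact hcon (g1 (by rw [h2 (not_le.1 hcon)]; exact Nat.lt_succ_self _))
  obtain ⟨cen, c1, c2⟩ := g2 hfree
  refine ⟨hkept, (h3 hfree).1, fun X hX hpos => ?_⟩
  have h4 := (h3 hfree).2 cen c1
  rw [hX, Nat.cast_le] at h4
  exact (Nat.mul_le_mul_left _ h4).trans (c2 hpos)

end ConnectedMSR

namespace ConnectedMSR

open RAM RAM.Cmd

variable {n : ℕ} {G : SimpleGraph (Fin n)} {D d : Fin n → Fin n → ℕ} {k b N Q : ℕ}
  {m m' : Memory} {comp cen : Fin n → Fin n} {X : ℕ}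

/-! ### Exactly `k` clusters -/

/-- The number of labels below `t`. -/
def rank (comp : Fin n → Fin n) (t : ℕ) : ℕ :=
  (Finset.univ.filter fun l => comp l = l ∧ l.val < t).card

theorem rank_succ_of_label {t : ℕ} {ht : t < n} (h : comp ⟨t, ht⟩ = ⟨t, ht⟩) :
    rank comp (t + 1) = rank comp t + 1 := by
  unfold rank
  have : (Finset.univ.filter fun l : Fin n => comp l = l ∧ l.val < t + 1) =
      insert ⟨t, ht⟩ (Finset.univ.filter fun l : Fin n => comp l = l ∧ l.val < t) := by
    ext l
    simp only [Finset.mem_filter, Finset.mem_univ, true_and, Finset.mem_insert, Fin.ext_iff]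
    constructor
    · rintro ⟨h1, h2⟩
      by_cases h3 : l.val = t
      · exact Or.inl h3
      · exact Or.inr ⟨h1, by omega⟩
    · rintro (h1 | ⟨h1, h2⟩)
      · have : l = ⟨t, ht⟩ := Fin.ext h1
        subst this
        exact ⟨congrArg Fin.val h, Nat.lt_succ_self _⟩
      · exact ⟨h1, by omega⟩
  rw [this, Finset.card_insert_of_notMem (by simp)]

theorem rank_succ_of_not_label {t : ℕ} {ht : t < n} (h : comp ⟨t, ht⟩ ≠ ⟨t, ht⟩) :
    rank comp (t + 1) = rank comp t := by
  unfold rank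
  congr 1
  ext l
  simp only [Finset.mem_filter, Finset.mem_univ, true_and]
  refine and_congr_right fun hl => ⟨fun h1 => lt_of_le_of_ne (by omega) fun h2 => h ?_,
    fun h1 => by omega⟩
  rw [show (⟨t, ht⟩ : Fin n) = l from Fin.ext h2.symm, hl]

theorem rank_mono {s t : ℕ} (h : s ≤ t) : rank comp s ≤ rank comp t := by
  refine Finset.card_le_card fun l hl => ?_
  simp only [Finset.mem_filter, Finset.mem_univ, true_and] at hl ⊢
  exact ⟨hl.1, by omega⟩

theorem rank_lt {l : Fin n} (hl : comp l = l) {t : ℕ} (ht : l.val < t) :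
    rank comp l < rank comp t := by
  refine lt_of_lt_of_le ?_ (rank_mono (Nat.succ_le_of_lt ht))
  rw [rank_succ_of_label (ht := l.2) hl]
  exact Nat.lt_succ_self _

theorem rank_injOn {l l' : Fin n} (hl : comp l = l) (hl' : comp l' = l')
    (h : rank comp l = rank comp l') : l = l' := by
  rcases lt_trichotomy l.val l'.val with h1 | h1 | h1
  · exact absurd h (rank_lt hl h1).ne
  · exact Fin.ext h1
  · exact absurd h (rank_lt hl' h1).ne'

theorem rank_card : rank comp n = (Finset.univ.filter fun v => comp v = v).card := by
  simp [rank]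

theorem exists_rank_eq {i : ℕ} (hi : i < rank comp n) : ∃ l, comp l = l ∧ rank comp l = i := by
  have := Finset.surjOn_of_injOn_of_card_le (s := Finset.univ.filter fun v => comp v = v)
    (t := Finset.range (rank comp n)) (fun l : Fin n => rank comp l)
    (fun l hl => by
      simp only [Finset.coe_filter, Finset.mem_univ, true_and, Set.mem_ofPred_eq] at hl
      simpa using rank_lt hl l.2)
    (fun l hl l' hl' h => by
      simp only [Finset.coe_filter, Finset.mem_univ, true_and, Set.mem_ofPred_eq] at hl hl'
      exact rank_injOn hl hl' h) (by rw [Finset.card_range, rank_card])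
  obtain ⟨l, h1, h2⟩ := this (by simpa using hi)
  exact ⟨l, by simpa using h1, h2⟩

/-- An order of the vertices: first the centers, and then each vertex after a neighbour in its
class. -/
structure Order (G : SimpleGraph (Fin n)) (comp cen : Fin n → Fin n) (pos : Fin n → ℕ) : Prop where
  lt : ∀ v, pos v < n
  inj : Function.Injective pos
  center : ∀ l, comp l = l → pos (cen l) = rank comp l
  reach : ∀ v, v = cen (comp v) ∨ ∃ u, G.Adj u v ∧ comp u = comp v ∧ pos u < pos v

/-- The label after the last vertices have been made clusters of their own. -/
def splitLabel (comp : Fin n → Fin n) (pos : Fin n → ℕ) (k : ℕ) (v : Fin n) : ℕ :=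
  if pos v < n - k + rank comp n then rank comp (comp v) else pos v + k - n

/-- The vertices at the last `k - rank comp n` positions become singletons. What remains of a class
is connected, because each vertex other than the center comes after a neighbour in its class.
Centers stand at the beginning of the order and are not split off, as `k ≤ n`. Radii can only
shrink. -/
theorem Candidate.exists_solution (h : Candidate G D k comp cen X) (hkn : k ≤ n)
    {pos : Fin n → ℕ} (ho : Order G comp cen pos) (D_self : ∀ u, D u u = 0) :
    ∃ S : Solution G k, (∀ v, (S.label v : ℕ) = splitLabel comp pos k v) ∧
      (∀ l, comp l = l → ∀ i : Fin k, (i : ℕ) = rank comp l → S.center i = cen l) ∧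
      (∀ v, n - k + rank comp n ≤ pos v → ∀ i : Fin k, (i : ℕ) = pos v + k - n →
        S.center i = v) ∧
      ∑ i, (Finset.univ.filter fun v => S.label v = i).sup (D (S.center i)) ≤ X := by
  have hck : rank comp n ≤ k := by rw [rank_card]; exact h.card_le
  have hlab : ∀ v, rank comp (comp v) < rank comp n := fun v => rank_lt (h.idem v) (comp v).2
  have hlt : ∀ v, splitLabel comp pos k v < k := fun v => by
    have := hlab v
    have := ho.lt v
    unfold splitLabel
    split_ifs <;> omega
  have hsmall : ∀ {v}, splitLabel comp pos k v < rank comp n →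
      pos v < n - k + rank comp n ∧ splitLabel comp pos k v = rank comp (comp v) := fun {v} hv => by
    unfold splitLabel at hv ⊢
    split_ifs at hv ⊢ with h1
    · exact ⟨h1, rfl⟩
    · omega
  have hbig : ∀ {v}, rank comp n ≤ splitLabel comp pos k v →
      n - k + rank comp n ≤ pos v ∧ splitLabel comp pos k v = pos v + k - n := fun {v} hv => by
    have := hlab v
    unfold splitLabel at hv ⊢
    split_ifs at hv ⊢ with h1
    · omega
    · exact ⟨not_lt.1 h1, rfl⟩
  have hsurj : ∀ i : Fin k, ∃ c, splitLabel comp pos k c = i ∧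
      (∀ l, comp l = l → (i : ℕ) = rank comp l → c = cen l) ∧
      (∀ v, n - k + rank comp n ≤ pos v → (i : ℕ) = pos v + k - n → c = v) := by
    intro i
    by_cases hi : (i : ℕ) < rank comp n
    · obtain ⟨l, h1, h2⟩ := exists_rank_eq hi
      refine ⟨cen l, ?_, fun l' h3 h4 => ?_, fun v hv h4 => ?_⟩
      · unfold splitLabel
        rw [ho.center l h1, h.center l h1, if_pos (by omega), h2]
      · rw [rank_injOn h1 h3 (h2.trans h4)]
      · omega
    · have hpos : Function.Surjective fun v => (⟨pos v, ho.lt v⟩ : Fin n) :=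
        Finite.injective_iff_surjective.1 fun u v huv => ho.inj (Fin.mk.inj_iff.1 huv)
      have := i.2
      obtain ⟨v, hv⟩ := hpos ⟨n - k + i, by omega⟩
      have hv' : pos v = n - k + i := Fin.mk.inj_iff.1 hv
      refine ⟨v, ?_, fun l h3 h4 => ?_, fun v' h3 h4 => ho.inj (by omega)⟩
      · unfold splitLabel
        rw [if_neg (by omega)]
        omega
      · have := rank_lt h3 l.2
        omega
  choose cc hcc1 hcc2 hcc3 using hsurj
  set label : Fin n → Fin k := fun v => ⟨splitLabel comp pos k v, hlt v⟩ with hlabel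
  have hl1 : ∀ {v i}, label v = i ↔ splitLabel comp pos k v = i := fun {v i} => by
    rw [hlabel, Fin.ext_iff]
  have hclass : ∀ (i : Fin k) (l : Fin n), comp l = l → (i : ℕ) = rank comp l → ∀ v, label v = i →
      pos v < n - k + rank comp n ∧ comp v = l := fun i l hl hi v hv => by
    rw [hl1] at hv
    obtain ⟨h1, h2⟩ := hsmall (by rw [hv, hi]; exact rank_lt hl l.2)
    exact ⟨h1, rank_injOn (h.idem v) hl (h2.symm.trans (hv.trans hi))⟩
  have hsingle : ∀ i : Fin k, rank comp n ≤ i → ∀ v, label v = i → v = cc i := fun i hi v hv => by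
    rw [hl1] at hv
    obtain ⟨h1, h2⟩ := hbig (hv ▸ hi)
    exact (hcc3 i v h1 (hv ▸ h2)).symm
  refine ⟨⟨label, cc, fun i => hl1.2 (hcc1 i), fun i => ?_⟩, fun _ => rfl,
    fun l hl i hi => hcc2 i l hl hi, fun v hv i hi => hcc3 i v hv hi, ?_⟩
  -- Induction along the order: the earlier neighbour has not been split off either, so it carries
  -- the same label.
  · have key : ∀ p : ℕ, ∀ x : {v | label v = i}, pos x < p →
        (G.induce {v | label v = i}).Reachable ⟨cc i, hl1.2 (hcc1 i)⟩ x := by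
      intro p
      induction p with
      | zero => intro x hx; exact absurd hx (Nat.not_lt_zero _)
      | succ p ih =>
        intro x hx
        by_cases hi : (i : ℕ) < rank comp n
        · obtain ⟨l, h1, h2⟩ := exists_rank_eq hi
          have hx' := hclass i l h1 h2.symm x x.2
          rcases ho.reach x with h3 | ⟨u, h3, h4, h5⟩
          · have : x = ⟨cc i, hl1.2 (hcc1 i)⟩ := Subtype.ext (by
              rw [h3, hx'.2]; exact (hcc2 i l h1 h2.symm).symm)
            rw [this]
          · have hu : label u = i := by
              rw [hl1]
              unfold splitLabel
              rw [if_pos (by omega), h4, hx'.2, h2]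
            refine (ih ⟨u, hu⟩ (by dsimp only; omega)).trans (SimpleGraph.Adj.reachable ?_)
            exact h3
        · have : x = ⟨cc i, hl1.2 (hcc1 i)⟩ := Subtype.ext (hsingle i (not_lt.1 hi) x x.2)
          rw [this]
    have : Nonempty {v | label v = i} := ⟨⟨cc i, hl1.2 (hcc1 i)⟩⟩
    refine ⟨fun x y => ?_⟩
    exact (key _ x (Nat.lt_succ_self _)).symm.trans (key _ y (Nat.lt_succ_self _))
  · have hterm : ∀ i : Fin k, (Finset.univ.filter fun v => label v = i).sup (D (cc i)) ≤
        ∑ l with comp l = l, if rank comp l = i then classRadius D comp l (cen l) else 0 := by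
      intro i
      by_cases hi : (i : ℕ) < rank comp n
      · obtain ⟨l, h1, h2⟩ := exists_rank_eq hi
        refine le_trans ?_ (Finset.single_le_sum (f := fun l : Fin n => if rank comp l = i then
          classRadius D comp l (cen l) else 0) (fun _ _ => Nat.zero_le _)
          (Finset.mem_filter.2 ⟨Finset.mem_univ l, h1⟩))
        rw [if_pos h2, hcc2 i l h1 h2.symm]
        refine Finset.sup_mono fun v hv => ?_
        simp only [Finset.mem_filter, Finset.mem_univ, true_and] at hv ⊢
        exact (hclass i l h1 h2.symm v hv).2
      · refine le_trans (Finset.sup_le fun v hv => ?_) (Nat.zero_le _)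
        simp only [Finset.mem_filter, Finset.mem_univ, true_and] at hv
        rw [hsingle i (not_lt.1 hi) v hv, D_self]
    refine (Finset.sum_le_sum fun i _ => hterm i).trans ?_
    rw [Finset.sum_comm, h.total]
    refine Finset.sum_le_sum fun l _ => ?_
    rw [Finset.sum_ite]
    simp only [Finset.sum_const_zero, add_zero, Finset.sum_const, smul_eq_mul]
    refine le_trans (Nat.mul_le_mul_right _ (Finset.card_le_one.2 fun i hi j hj => ?_))
      (one_mul _).le
    simp only [Finset.mem_filter, Finset.mem_univ, true_and] at hi hj
    exact Fin.ext (hi.symm.trans hj)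

/-! ### The output phase -/

notation "aIdx" => 50
notation "aPos" => 51
notation "aCnt" => 52
notation "aLast" => 53
notation "aNext" => 54

def listLabels : Cmd := loop iU aN (ifEq (at_ aBestComp iU) (sc iU) (block
  [store aIdx (sc iU) (sc aCnt), store aPos (at_ aBestCen iU) (sc aCnt),
   store 1 (.add (.add (.const 1) (sc aN)) (sc aCnt)) (at_ aBestCen iU),
   set aCnt (.add (sc aCnt) (.const 1))]) skip)

def placeStep : Cmd :=
  ifLt (at_ aPos iU) (.const 0) skip (ifLt (at_ aPos iV) (.const 0) (ifEq (adjE iU iV) (.const 1)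
    (ifEq (at_ aBestComp iU) (at_ aBestComp iV)
      (block [store aPos (sc iV) (sc aNext), set aNext (.add (sc aNext) (.const 1))]) skip) skip)
    skip)

def place : Cmd := sweep iT iU iV aN placeStep

def writeOutput : Cmd := loop iV aN (ifLt (at_ aPos iV) (sc aLast)
  (store 1 (.add (.const 1) (sc iV)) (.load aIdx (at_ aBestComp iV)))
  (block [store 1 (.add (.const 1) (sc iV)) (.add (.sub (at_ aPos iV) (sc aN)) (sc aK)),
    store 1 (.add (.const 1) (.add (at_ aPos iV) (sc aK))) (sc iV)]))

/-- Position `-1` marks a vertex that has not been placed. `aLast` is the position from which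
vertices are split off. -/
def outputPhase : Cmd := block
  [loop iV aN (store aPos (sc iV) (.const (-1))), set aCnt (.const 0),
   store 1 (.const 0) (.add (sc aN) (sc aK)), listLabels,
   set aLast (.add (.sub (sc aN) (sc aK)) (sc aCnt)), set aNext (sc aCnt), place, writeOutput]

theorem plain_outputPhase : outputPhase.plain 20 = true := rfl

theorem Stored.congr (h : Stored comp cen X m) (hm : ∀ a, 20 ≤ a → a ≤ 23 → m' a = m a) :
    Stored comp cen X m' := by
  obtain ⟨h2, h3, h4, h5⟩ := h
  refine ⟨?_, ?_, ?_, ?_⟩ <;> rw [hm _ (by decide) (by decide)] <;> assumption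

/-- The labels below `t` have been listed. -/
structure Listed (comp cen : Fin n → Fin n) (k t : ℕ) (m : Memory) : Prop where
  cnt : m aCnt 0 = rank comp t
  idx : ∀ l : Fin n, comp l = l → l.val < t → m aIdx (l : ℕ) = rank comp l
  out : ∀ l : Fin n, comp l = l → l.val < t → m 1 (1 + n + rank comp l : ℕ) = (cen l : ℕ)
  size : m 1 0 = (n + k : ℕ)
  pos : ∀ v : Fin n, m aPos (v : ℕ) =
    if v = cen (comp v) ∧ (comp v).val < t then (rank comp (comp v) : ℤ) else -1

theorem run_listLabels (h : Tables G D k b N Q m) (hs : Stored comp cen X m)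
    (hcand : Candidate G D k comp cen X) (h0 : Listed comp cen k 0 m) :
    Listed comp cen k n (listLabels.run m) := by
  refine run_loop_inv (x := iU) (b := aN) (m := m) (I := fun t m' => Listed comp cen k t m') n h.card
    h0 (fun t m' z hI => ?_) (fun t ht m' hfr hx hI => ?_)
  · obtain ⟨h1, h2, h3, h4, h5⟩ := hI
    constructor <;> rw [Memory.write_ne _ _ _ (by decide)] <;> assumption
  have e1 : m' aN 0 = n := by rw [hfr aN rfl, h.card]
  have e2 : m' aBestComp (t : ℕ) = (comp ⟨t, ht⟩ : ℕ) := by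
    rw [hfr aBestComp rfl]; exact hs.label ⟨t, ht⟩
  rw [run_ifEq]
  have e3 : (at_ aBestComp iU).val m' = (comp ⟨t, ht⟩ : ℕ) := by simp only [Expr.val, hx, e2]
  have e4 : (sc iU).val m' = ((⟨t, ht⟩ : Fin n) : ℕ) := hx
  rw [e3, e4]
  have hcase : ∀ l : Fin n, l.val < t + 1 → l.val < t ∨ l = ⟨t, ht⟩ :=
    fun l hl => (Nat.lt_succ_iff_lt_or_eq.1 hl).imp_right fun h => Fin.ext h
  by_cases hcl : comp ⟨t, ht⟩ = ⟨t, ht⟩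
  swap
  · rw [if_neg (by rwa [cast_eq_cast_iff]), run_skip]
    have hcase' : ∀ l : Fin n, comp l = l → l.val < t + 1 → l.val < t := fun l hl h =>
      (hcase l h).resolve_right fun h => hcl (h ▸ hl)
    refine ⟨by rw [rank_succ_of_not_label hcl, hI.cnt], fun l hl hlt => hI.idx l hl (hcase' l hl hlt),
      fun l hl hlt => hI.out l hl (hcase' l hl hlt), hI.size, fun v => ?_⟩
    rw [hI.pos]
    refine if_congr (and_congr_right fun _ => ⟨fun h => by omega, fun h => ?_⟩) rfl rfl
    exact hcase' _ (hcand.idem v) h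
  rw [if_pos (by rw [hcl])]
  have e5 : m' aBestCen (t : ℕ) = (cen ⟨t, ht⟩ : ℕ) := by
    rw [hfr aBestCen rfl]; exact hs.center ⟨t, ht⟩ hcl
  have hrun : (block [store aIdx (sc iU) (sc aCnt), store aPos (at_ aBestCen iU) (sc aCnt),
      store 1 (.add (.add (.const 1) (sc aN)) (sc aCnt)) (at_ aBestCen iU),
      set aCnt (.add (sc aCnt) (.const 1))]).run m' =
      (((m'.write aIdx (t : ℕ) (rank comp t)).write aPos (cen ⟨t, ht⟩ : ℕ) (rank comp t)).write 1
        (1 + n + rank comp t : ℕ) (cen ⟨t, ht⟩ : ℕ)).write aCnt 0 (rank comp t + 1) := by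
    simp only [run_block_cons, run_block_nil, run_store, Expr.val]
    simp only [Memory.write_ne _ _ _ (show aBestCen ≠ aIdx by decide),
      Memory.write_ne _ _ _ (show aBestCen ≠ aPos by decide),
      Memory.write_ne _ _ _ (show aCnt ≠ aIdx by decide),
      Memory.write_ne _ _ _ (show aCnt ≠ aPos by decide),
      Memory.write_ne _ _ _ (show aCnt ≠ 1 by decide),
      Memory.write_ne _ _ _ (show iU ≠ aIdx by decide),
      Memory.write_ne _ _ _ (show iU ≠ aPos by decide),
      Memory.write_ne _ _ _ (show aN ≠ aIdx by decide),
      Memory.write_ne _ _ _ (show aN ≠ aPos by decide), hx, e1, e5, hI.cnt]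
    push_cast
    rfl
  rw [hrun]
  refine ⟨?_, fun l hl hlt => ?_, fun l hl hlt => ?_, ?_, fun v => ?_⟩
  · rw [Memory.write_same, rank_succ_of_label hcl]; push_cast; rfl
  · rw [Memory.write_ne _ _ _ (show aIdx ≠ aCnt by decide),
      Memory.write_ne _ _ _ (show aIdx ≠ 1 by decide),
      Memory.write_ne _ _ _ (show aIdx ≠ aPos by decide)]
    rcases hcase l hlt with h1 | rfl
    · rw [Memory.write_cell_ne _ _ _ (by norm_cast; omega), hI.idx l hl h1]
    · exact Memory.write_same _ _ _ _
  · rw [Memory.write_ne _ _ _ (show 1 ≠ aCnt by decide)]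
    rcases hcase l hlt with h1 | rfl
    · have := rank_lt hl h1
      rw [Memory.write_cell_ne _ _ _ (by norm_cast; omega),
        Memory.write_ne _ _ _ (show 1 ≠ aPos by decide),
        Memory.write_ne _ _ _ (show 1 ≠ aIdx by decide), hI.out l hl h1]
    · exact Memory.write_same _ _ _ _
  · rw [Memory.write_ne _ _ _ (show 1 ≠ aCnt by decide),
      Memory.write_cell_ne _ _ _ (by norm_cast; omega),
      Memory.write_ne _ _ _ (show 1 ≠ aPos by decide),
      Memory.write_ne _ _ _ (show 1 ≠ aIdx by decide), hI.size]
  · rw [Memory.write_ne _ _ _ (show aPos ≠ aCnt by decide),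
      Memory.write_ne _ _ _ (show aPos ≠ 1 by decide)]
    by_cases hv : v = cen ⟨t, ht⟩
    · subst hv
      rw [Memory.write_same, hcand.center _ hcl, if_pos ⟨rfl, Nat.lt_succ_self t⟩]
    · rw [Memory.write_cell_ne _ _ _ (fun h => hv (cast_eq_cast_iff.1 h)),
        Memory.write_ne _ _ _ (show aPos ≠ aIdx by decide), hI.pos]
      refine if_congr (and_congr_right fun h1 => ⟨fun h => by omega, fun h => ?_⟩) rfl rfl
      exact (hcase _ h).resolve_right fun h2 => hv (h2 ▸ h1)

/-- Some vertices have positions in an order. -/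
structure Placed (G : SimpleGraph (Fin n)) (comp cen : Fin n → Fin n) (m : Memory) : Prop where
  next : m aNext 0 = (Finset.univ.filter fun v : Fin n => 0 ≤ m aPos (v : ℕ)).card
  lt : ∀ v : Fin n, m aPos (v : ℕ) < m aNext 0
  inj : ∀ u v : Fin n, 0 ≤ m aPos (u : ℕ) → m aPos (u : ℕ) = m aPos (v : ℕ) → u = v
  center : ∀ l, comp l = l → m aPos (cen l : ℕ) = rank comp l
  reach : ∀ v : Fin n, 0 ≤ m aPos (v : ℕ) → v = cen (comp v) ∨
    ∃ u : Fin n, G.Adj u v ∧ comp u = comp v ∧ 0 ≤ m aPos (u : ℕ) ∧ m aPos (u : ℕ) < m aPos (v : ℕ)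

theorem Placed.congr (h : Placed G comp cen m) (h1 : m' aNext = m aNext) (h2 : m' aPos = m aPos) :
    Placed G comp cen m' := by
  obtain ⟨i1, i2, i3, i4, i5⟩ := h
  constructor <;> simp only [h1, h2] <;> assumption

theorem Placed.add (h : Placed G comp cen m) {u v : Fin n} (hu : 0 ≤ m aPos (u : ℕ))
    (hv : m aPos (v : ℕ) < 0) (hadj : G.Adj u v) (hc : comp u = comp v)
    (hpos : ∀ w : Fin n, m' aPos (w : ℕ) = if w = v then m aNext 0 else m aPos (w : ℕ))
    (hnext : m' aNext 0 = m aNext 0 + 1) : Placed G comp cen m' := by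
  have hn0 : 0 ≤ m aNext 0 := by rw [h.next]; exact Nat.cast_nonneg _
  have hset : (Finset.univ.filter fun w : Fin n => 0 ≤ m' aPos (w : ℕ)) =
      insert v (Finset.univ.filter fun w : Fin n => 0 ≤ m aPos (w : ℕ)) := by
    ext w
    simp only [Finset.mem_filter, Finset.mem_univ, true_and, Finset.mem_insert, hpos]
    split_ifs with hw <;> simp [hw, hn0]
  have huv : u ≠ v := fun h => by rw [h] at hu; omega
  refine ⟨?_, fun w => ?_, fun w w' h1 h2 => ?_, fun l hl => ?_, fun w hw => ?_⟩
  · rw [hset, Finset.card_insert_of_notMem (by simpa using hv), hnext, h.next]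
    push_cast; rfl
  · have := h.lt w
    rw [hpos, hnext]
    split_ifs <;> omega
  · have l1 := h.lt w
    have l2 := h.lt w'
    rw [hpos] at h1
    rw [hpos w, hpos w'] at h2
    split_ifs at h1 h2 with j1 j2 j2
    · rw [j1, j2]
    · omega
    · omega
    · exact h.inj w w' h1 h2
  · have := h.center l hl
    rw [hpos, if_neg, this]
    rintro rfl
    omega
  · have l1 := h.lt u
    rw [hpos] at hw ⊢
    by_cases hwv : w = v
    · subst hwv
      refine Or.inr ⟨u, hadj, hc, ?_⟩
      rw [hpos, if_neg huv, if_pos rfl]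
      exact ⟨hu, l1⟩
    · rw [if_neg hwv] at hw ⊢
      refine (h.reach w hw).imp_right ?_
      rintro ⟨x, j1, j2, j3, j4⟩
      refine ⟨x, j1, j2, ?_⟩
      rw [hpos, if_neg (by rintro rfl; omega)]
      exact ⟨j3, j4⟩

/-- The placed vertices are closed under adjacency within a class after the sweep. They contain the
center of each class, and classes are connected, so every vertex has been placed. -/
theorem run_place (h : Tables G D k b N Q m) (hs : Stored comp cen X m)
    (hcand : Candidate G D k comp cen X) (hn : 0 < n) (hp : Placed G comp cen m) :
    Placed G comp cen (place.run m) ∧ ∀ v : Fin n, 0 ≤ place.run m aPos (v : ℕ) := by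
  classical
  have hcen : ∀ m', Placed G comp cen m' → ∀ v, 0 ≤ m' aPos (cen (comp v) : ℕ) := fun m' h v => by
    rw [h.center _ (hcand.idem v)]; exact Nat.cast_nonneg _
  obtain ⟨h1, -, h3⟩ := run_sweep (t := iT) (u := iU) (v := iV) (b := aN)
    (p := placeStep) (m := m) h.card rfl (by decide) rfl (Placed G comp cen)
    (fun m' => {v | 0 ≤ m' aPos (v : ℕ)}) (fun u v => G.Adj u v ∧ comp u = comp v)
    (fun m' x z hx hP => by
      have e1 : m'.write x 0 z aPos = m' aPos := Memory.write_ne _ _ _ (by omega)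
      have e2 : m'.write x 0 z aNext = m' aNext := Memory.write_ne _ _ _ (by omega)
      exact ⟨hP.congr e2 e1, by rw [e1]⟩)
    (fun m' x y hfr hP hx hy => by
      have ht' : Tables G D k b N Q m' := h.congr fun a ha ha1 =>
        hfr a (plain.wr_eq (lo := 20) rfl ha ha1)
      have e1 : (at_ aPos iU).val m' = m' aPos (x : ℕ) := by simp only [Expr.val, hx]
      have e2 : (at_ aPos iV).val m' = m' aPos (y : ℕ) := by simp only [Expr.val, hy]
      have e3 : (at_ aBestComp iU).val m' = (comp x : ℕ) := by
        simp only [Expr.val, hx, hfr aBestComp rfl, hs.label]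
      have e4 : (at_ aBestComp iV).val m' = (comp y : ℕ) := by
        simp only [Expr.val, hy, hfr aBestComp rfl, hs.label]
      have hadj : ((adjE iU iV).val m' = (Expr.const 1).val m') ↔ G.Adj x y := by
        rw [ht'.adjE_val hx hy]
        simp [Expr.val]
      have hrun : placeStep.run m' = if m' aPos (x : ℕ) < 0 then m' else
          if m' aPos (y : ℕ) < 0 then if G.Adj x y then if comp x = comp y then
            (block [store aPos (sc iV) (sc aNext), set aNext (.add (sc aNext) (.const 1))]).run m'
            else m' else m' else m' := by
        simp only [placeStep, run_ifLt, run_ifEq, run_skip, e1, e2, e3, e4, hadj, cast_eq_cast_iff]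
        rfl
      by_cases hcc : (¬ m' aPos (x : ℕ) < 0) ∧ m' aPos (y : ℕ) < 0 ∧ G.Adj x y ∧ comp x = comp y
      swap
      · have heq : placeStep.run m' = m' := by
          rw [hrun]
          split_ifs with c1 c2 c3 c4 <;> first | rfl | exact absurd ⟨c1, c2, c3, c4⟩ hcc
        rw [heq]
        refine ⟨hP, subset_rfl, fun hR hx => ?_, fun _ => Or.inl rfl⟩
        by_contra hy
        exact hcc ⟨not_lt.2 hx, not_le.1 hy, hR⟩
      obtain ⟨c1, c2, c3, c4⟩ := hcc
      rw [if_neg c1, if_pos c2, if_pos c3, if_pos c4] at hrun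
      have hpos : ∀ w : Fin n, placeStep.run m' aPos (w : ℕ) =
          if w = y then m' aNext 0 else m' aPos (w : ℕ) := fun w => by
        rw [hrun]
        simp only [run_block_cons, run_block_nil, run_store, Expr.val, hy]
        rw [Memory.write_ne _ _ _ (by decide)]
        simp only [Memory.write, true_and, cast_eq_cast_iff]
      have hnext : placeStep.run m' aNext 0 = m' aNext 0 + 1 := by
        rw [hrun]
        simp only [run_block_cons, run_block_nil, run_store, Expr.val]
        rw [Memory.write_same, Memory.write_ne _ _ _ (by decide)]
      have hn0 : 0 ≤ m' aNext 0 := by rw [hP.next]; exact Nat.cast_nonneg _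
      refine ⟨hP.add (not_lt.1 c1) c2 c3 c4 hpos hnext, fun w hw => ?_, fun _ _ => ?_,
        fun hno => absurd (hno ⟨c3, c4⟩ (not_lt.1 c1)) (not_le.2 c2)⟩
      · simp only [Set.mem_ofPred_eq, hpos] at hw ⊢
        split_ifs
        · exact hn0
        · exact hw
      · simp only [Set.mem_ofPred_eq, hpos, if_true]
        exact hn0)
    hp ⟨cen (comp ⟨0, hn⟩), hcen m hp _⟩
  refine ⟨h1, fun v => ?_⟩
  have hc₀ := hcen _ h1 v
  have := hcand.conn (cen (comp v)) v (hcand.center _ (hcand.idem v))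
  generalize cen (comp v) = c at this hc₀
  induction this with
  | refl => exact hc₀
  | tail hb hbc ih => exact h3 _ ih _ hbc

/-- A vertex split off at position `p` has label `p + k - n`, so as a center it is written to cell
`1 + n + (p + k - n) = 1 + (p + k)`. As `p + k ≥ n + rank comp n`, this overwrites neither a label
nor one of the centers listed before. -/
theorem run_writeOutput (h : Tables G D k b N Q m) (hk : m aK 0 = k) (hkn : k ≤ n)
    (hs : Stored comp cen X m) (hcand : Candidate G D k comp cen X) (hl : Listed comp cen k n m')
    (hm' : m 1 = m' 1) (hidx : m aIdx = m' aIdx) {pos : Fin n → ℕ} (ho : Order G comp cen pos)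
    (hpos : ∀ v : Fin n, m aPos (v : ℕ) = pos v) (hlast : m aLast 0 = (n - k + rank comp n : ℕ)) :
    writeOutput.run m 1 0 = (n + k : ℕ) ∧
    (∀ l, comp l = l → writeOutput.run m 1 (1 + n + rank comp l : ℕ) = (cen l : ℕ)) ∧
    (∀ v : Fin n, writeOutput.run m 1 (1 + v : ℕ) = splitLabel comp pos k v) ∧
    ∀ v : Fin n, n - k + rank comp n ≤ pos v →
      writeOutput.run m 1 (1 + (pos v + k) : ℕ) = (v : ℕ) := by
  have := run_loop_inv (x := iV) (b := aN) (m := m) (p := ifLt (at_ aPos iV) (sc aLast)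
    (store 1 (.add (.const 1) (sc iV)) (.load aIdx (at_ aBestComp iV)))
    (block [store 1 (.add (.const 1) (sc iV)) (.add (.sub (at_ aPos iV) (sc aN)) (sc aK)),
      store 1 (.add (.const 1) (.add (at_ aPos iV) (sc aK))) (sc iV)]))
    (I := fun t m' => m' 1 0 = (n + k : ℕ) ∧
      (∀ l, comp l = l → m' 1 (1 + n + rank comp l : ℕ) = (cen l : ℕ)) ∧
      (∀ v : Fin n, v.val < t → m' 1 (1 + v : ℕ) = splitLabel comp pos k v) ∧
      ∀ v : Fin n, v.val < t → n - k + rank comp n ≤ pos v →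
        m' 1 (1 + (pos v + k) : ℕ) = (v : ℕ)) n h.card
    ⟨by rw [hm']; exact hl.size, fun l hll => by rw [hm']; exact hl.out l hll l.2,
      fun v hv => absurd hv (Nat.not_lt_zero _), fun v hv => absurd hv (Nat.not_lt_zero _)⟩
    (fun t m' z hI => by rwa [Memory.write_ne _ _ _ (show 1 ≠ iV by decide)])
    (fun t ht m₁ hfr hx hI => by
      obtain ⟨i1, i2, i3, i4⟩ := hI
      have hcase : ∀ v : Fin n, v.val < t + 1 → v.val < t ∨ v = ⟨t, ht⟩ :=
        fun v hv => (Nat.lt_succ_iff_lt_or_eq.1 hv).imp_right fun h => Fin.ext h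
      have e1 : (at_ aPos iV).val m₁ = pos ⟨t, ht⟩ := by
        simp only [Expr.val, hx, hfr aPos rfl]; exact hpos ⟨t, ht⟩
      have e2 : (sc aLast).val m₁ = (n - k + rank comp n : ℕ) := by
        simp only [Expr.val, hfr aLast rfl, hlast]
      have e3 : (Expr.load aIdx (at_ aBestComp iV)).val m₁ = rank comp (comp ⟨t, ht⟩) := by
        have := hs.label ⟨t, ht⟩
        dsimp only at this
        simp only [Expr.val, hx, hfr aIdx rfl, hfr aBestComp rfl, this, hidx]
        exact hl.idx _ (hcand.idem _) (Fin.is_lt _)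
      have hrank : ∀ l, comp l = l → rank comp l < rank comp n := fun l hll => rank_lt hll l.2
      rw [run_ifLt, e1, e2]
      by_cases hlt : pos ⟨t, ht⟩ < n - k + rank comp n
      · rw [if_pos (by exact_mod_cast hlt)]
        have hrun : (store 1 (.add (.const 1) (sc iV)) (.load aIdx (at_ aBestComp iV))).run m₁ =
            m₁.write 1 (1 + t : ℕ) (splitLabel comp pos k ⟨t, ht⟩) := by
          rw [run_store, e3]
          unfold splitLabel
          rw [if_pos hlt]
          simp only [Expr.val, hx]
          push_cast
          rfl
        rw [hrun]
        refine ⟨?_, fun l hll => ?_, fun v hv => ?_, fun v hv hp => ?_⟩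
        · rw [Memory.write_cell_ne _ _ _ (by norm_cast; omega), i1]
        · rw [Memory.write_cell_ne _ _ _ (by norm_cast; omega), i2 l hll]
        · rcases hcase v hv with hv | rfl
          · rw [Memory.write_cell_ne _ _ _ (by norm_cast; omega), i3 v hv]
          · exact Memory.write_same _ _ _ _
        · rcases hcase v hv with hv | rfl
          · rw [Memory.write_cell_ne _ _ _ (by norm_cast; omega), i4 v hv hp]
          · omega
      · rw [if_neg (by exact_mod_cast hlt)]
        have hrun : (block [store 1 (.add (.const 1) (sc iV))
              (.add (.sub (at_ aPos iV) (sc aN)) (sc aK)),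
            store 1 (.add (.const 1) (.add (at_ aPos iV) (sc aK))) (sc iV)]).run m₁ =
            (m₁.write 1 (1 + t : ℕ) (splitLabel comp pos k ⟨t, ht⟩)).write 1
              (1 + (pos ⟨t, ht⟩ + k) : ℕ) (t : ℕ) := by
          have hk₁ : m₁ aK 0 = k := by rw [hfr aK rfl, hk]
          have hn₁ : m₁ aN 0 = n := by rw [hfr aN rfl, h.card]
          have hp₁ : m₁ aPos (t : ℕ) = pos ⟨t, ht⟩ := by rw [hfr aPos rfl]; exact hpos ⟨t, ht⟩
          have hsplit : ((splitLabel comp pos k ⟨t, ht⟩ : ℕ) : ℤ) = pos ⟨t, ht⟩ - n + k := by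
            unfold splitLabel
            rw [if_neg hlt]
            omega
          simp only [run_block_cons, run_block_nil, run_store, Expr.val]
          simp only [Memory.write_ne _ _ _ (show iV ≠ 1 by decide),
            Memory.write_ne _ _ _ (show aPos ≠ 1 by decide),
            Memory.write_ne _ _ _ (show aK ≠ 1 by decide), hx, hk₁, hn₁, hp₁, hsplit]
          push_cast
          rfl
        rw [hrun]
        refine ⟨?_, fun l hll => ?_, fun v hv => ?_, fun v hv hp => ?_⟩
        · rw [Memory.write_cell_ne _ _ _ (by norm_cast; omega),
            Memory.write_cell_ne _ _ _ (by norm_cast; omega), i1]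
        · have := hrank l hll
          rw [Memory.write_cell_ne _ _ _ (by norm_cast; omega),
            Memory.write_cell_ne _ _ _ (by norm_cast; omega), i2 l hll]
        · have := v.2
          rw [Memory.write_cell_ne _ _ _ (by norm_cast; omega)]
          rcases hcase v hv with hv | rfl
          · rw [Memory.write_cell_ne _ _ _ (by norm_cast; omega), i3 v hv]
          · exact Memory.write_same _ _ _ _
        · rcases hcase v hv with hv | rfl
          · have hne : pos v ≠ pos ⟨t, ht⟩ := fun h => by
              have := ho.inj h
              rw [this] at hv
              exact lt_irrefl _ hv
            rw [Memory.write_cell_ne _ _ _ (by norm_cast; omega),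
              Memory.write_cell_ne _ _ _ (by norm_cast; omega), i4 v hv hp]
          · exact Memory.write_same _ _ _ _)
  exact ⟨this.1, this.2.1, fun v => this.2.2.1 v v.2, fun v => this.2.2.2 v v.2⟩

theorem Solution.encode_eq_output (S : Solution G k) (h0 : m 1 0 = (n + k : ℕ))
    (h1 : ∀ v : Fin n, m 1 (1 + v : ℕ) = (S.label v : ℕ))
    (h2 : ∀ i : Fin k, m 1 (1 + n + i : ℕ) = (S.center i : ℕ)) : output m = S.encode := by
  have hlen : (m 1 0).toNat = n + k := by rw [h0, Int.toNat_natCast]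
  unfold output Solution.encode
  refine List.ext_getElem (by simp [hlen]) fun j hj hj' => ?_
  simp only [List.length_ofFn, hlen] at hj
  rw [List.getElem_ofFn]
  by_cases hjn : j < n
  · rw [List.getElem_append_left (by simpa using hjn), List.getElem_ofFn, ← h1 ⟨j, hjn⟩]
    congr 1
    push_cast
    ring
  · rw [List.getElem_append_right (by simpa using hjn), List.getElem_ofFn]
    simp only [List.length_ofFn]
    rw [← h2 ⟨j - n, by omega⟩]
    congr 1
    dsimp only
    omega

theorem run_outputPhase (h : Tables G D k b N Q m) (hk : m aK 0 = k) (hkn : k ≤ n) (hn : 0 < n)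
    (hs : Stored comp cen X m) (hcand : Candidate G D k comp cen X) (D_self : ∀ u, D u u = 0) :
    ∃ S : Solution G k, output (outputPhase.run m) = S.encode ∧
      ∑ i, (Finset.univ.filter fun v => S.label v = i).sup (D (S.center i)) ≤ X := by
  set m₁ := (loop iV aN (store aPos (sc iV) (.const (-1)))).run m with hm₁
  set m₂ := (store 1 (.const 0) (.add (sc aN) (sc aK))).run ((set aCnt (.const 0)).run m₁) with hm₂
  set m₃ := listLabels.run m₂ with hm₃
  set m₄ := (set aNext (sc aCnt)).run
    ((set aLast (.add (.sub (sc aN) (sc aK)) (sc aCnt))).run m₃) with hm₄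
  set m₅ := place.run m₄ with hm₅
  have hrun : outputPhase.run m = writeOutput.run m₅ := rfl
  have fr : ∀ a, a < 20 ∨ 20 ≤ a ∧ a ≤ 23 → a ≠ 1 →
      m₁ a = m a ∧ m₂ a = m a ∧ m₃ a = m a ∧ m₄ a = m a ∧ m₅ a = m a := fun a ha ha1 => by
    have w1 : (loop iV aN (store aPos (sc iV) (.const (-1)))).wr a = false := by
      simp [wr]; omega
    have w2 : listLabels.wr a = false := by simp [listLabels, ifEq, block, wr]; omega
    have w3 : place.wr a = false := by simp [place, placeStep, sweep, ifLt, ifEq, block, wr]; omega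
    have f1 : m₁ a = m a := run_frame _ _ w1
    have f2 : m₂ a = m a := by
      rw [hm₂, run_store, Memory.write_ne _ _ _ ha1, run_store, Memory.write_ne _ _ _ (by omega), f1]
    have f3 : m₃ a = m a := (run_frame _ _ w2).trans f2
    have f4 : m₄ a = m a := by
      rw [hm₄, run_store, Memory.write_ne _ _ _ (by omega), run_store,
        Memory.write_ne _ _ _ (by omega), f3]
    exact ⟨f1, f2, f3, f4, (run_frame _ _ w3).trans f4⟩
  have frS : ∀ a, 20 ≤ a → a ≤ 23 → _ := fun a h1 h2 => fr a (Or.inr ⟨h1, h2⟩) (by omega)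
  have frT : ∀ a, a < 20 → a ≠ 1 → _ := fun a h1 h2 => fr a (Or.inl h1) h2
  have frN := frT aN (by decide) (by decide)
  have frK := frT aK (by decide) (by decide)
  have hpos₁ := (run_each (x := iV) (a := aPos) (m := m) (p := store aPos (sc iV) (.const (-1))) 0
    (fun _ _ => -1) h.card (by decide) (fun t m' hfr hx j => by
      simp [run_store_apply, Expr.val, hx])).1
  have hl₂ : Listed comp cen k 0 m₂ := by
    refine ⟨?_, fun _ _ h => absurd h (Nat.not_lt_zero _), fun _ _ h => absurd h (Nat.not_lt_zero _),
      ?_, fun v => ?_⟩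
    · rw [hm₂, run_store, Memory.write_ne _ _ _ (by decide), run_store]
      simp [Memory.write, Expr.val, rank]
    · rw [hm₂, run_store, run_store]
      simp [Memory.write, Expr.val, frN.1, frK.1, h.card, hk]
    · have := hpos₁ v
      rw [zero_add] at this
      rw [hm₂, run_store, Memory.write_ne _ _ _ (by decide), run_store,
        Memory.write_ne _ _ _ (by decide), if_neg fun h => Nat.not_lt_zero _ h.2]
      exact this
  have hl₃ : Listed comp cen k n m₃ := run_listLabels (h.congr fun a h1 h2 => (frT a h1 h2).2.1)
    (hs.congr fun a h1 h2 => (frS a h1 h2).2.1) hcand hl₂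
  have hposT : ∀ v : Fin n, m₄ aPos (v : ℕ) =
      if v = cen (comp v) then (rank comp (comp v) : ℤ) else -1 := fun v => by
    rw [hm₄, run_store, Memory.write_ne _ _ _ (by decide), run_store,
      Memory.write_ne _ _ _ (by decide), hl₃.pos]
    simp
  have hnext : m₄ aNext 0 = rank comp n := by
    rw [hm₄, run_store, Expr.val, Memory.write_same, run_store]
    simp only [Expr.val]
    rw [Memory.write_ne _ _ _ (by decide), hl₃.cnt]
  have hlast : m₄ aLast 0 = (n - k + rank comp n : ℕ) := by
    rw [hm₄, run_store, Memory.write_ne _ _ _ (by decide), run_store, Expr.val, Memory.write_same]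
    simp only [Expr.val, frN.2.2.1, frK.2.2.1, h.card, hk, hl₃.cnt]
    omega
  have hpl : Placed G comp cen m₄ := by
    refine ⟨?_, fun v => ?_, fun u v hu huv => ?_, fun l hl => ?_, fun v hv => Or.inl ?_⟩
    · rw [hnext, rank_card, Nat.cast_inj]
      refine Finset.card_bij (fun l _ => cen l) (fun l hl => ?_) (fun l hl l' hl' h => ?_)
        fun v hv => ?_
      · simp only [Finset.mem_filter, Finset.mem_univ, true_and] at hl ⊢
        rw [hposT, hcand.center l hl, if_pos rfl]
        exact Nat.cast_nonneg _
      · simp only [Finset.mem_filter, Finset.mem_univ, true_and] at hl hl'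
        rw [← hcand.center l hl, h, hcand.center l' hl']
      · simp only [Finset.mem_filter, Finset.mem_univ, true_and] at hv
        rw [hposT] at hv
        refine ⟨comp v, by simpa using hcand.idem v, ?_⟩
        split_ifs at hv with h1
        · exact h1.symm
        · omega
    · have := rank_lt (hcand.idem v) (comp v).2
      rw [hposT, hnext]
      split_ifs <;> omega
    · rw [hposT] at hu
      rw [hposT u, hposT v] at huv
      split_ifs at hu huv with h1 h2
      · rw [h1, h2, rank_injOn (hcand.idem u) (hcand.idem v) (by exact_mod_cast huv)]
      · omega
    · rw [hposT, hcand.center l hl, if_pos rfl]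
    · rw [hposT] at hv
      split_ifs at hv with h1
      · exact h1
      · omega
  obtain ⟨hp5, hall⟩ := run_place (h.congr fun a h1 h2 => (frT a h1 h2).2.2.2.1)
    (hs.congr fun a h1 h2 => (frS a h1 h2).2.2.2.1) hcand hn hpl
  rw [← hm₅] at hp5 hall
  have hnn : m₅ aNext 0 = n := by
    rw [hp5.next, Finset.filter_true_of_mem fun v _ => hall v]
    simp
  have hpos : ∀ v : Fin n, m₅ aPos (v : ℕ) = ((m₅ aPos (v : ℕ)).toNat : ℕ) := fun v =>
    (Int.toNat_of_nonneg (hall v)).symm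
  have ho : Order G comp cen fun v => (m₅ aPos (v : ℕ)).toNat := by
    refine ⟨fun v => ?_, fun u v huv => ?_, fun l hl => ?_, fun v => ?_⟩
    · have := hp5.lt v
      have := hall v
      omega
    · refine hp5.inj u v (hall u) ?_
      rw [hpos u, hpos v]
      exact_mod_cast huv
    · rw [hp5.center l hl, Int.toNat_natCast]
    · refine (hp5.reach v (hall v)).imp_right ?_
      rintro ⟨u, h1, h2, h3, h4⟩
      exact ⟨u, h1, h2, by omega⟩
  have fr1 : m₅ 1 = m₃ 1 := by
    rw [hm₅, run_frame place _ rfl, hm₄, run_store, Memory.write_ne _ _ _ (by decide), run_store,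
      Memory.write_ne _ _ _ (by decide)]
  have frI : m₅ aIdx = m₃ aIdx := by
    rw [hm₅, run_frame place _ rfl, hm₄, run_store, Memory.write_ne _ _ _ (by decide), run_store,
      Memory.write_ne _ _ _ (by decide)]
  obtain ⟨w1, w2, w3, w4⟩ := run_writeOutput (h.congr fun a h1 h2 => (frT a h1 h2).2.2.2.2)
    (by rw [frK.2.2.2.2, hk]) hkn (hs.congr fun a h1 h2 => (frS a h1 h2).2.2.2.2) hcand hl₃ fr1 frI
    ho hpos (by rw [hm₅, run_frame place _ rfl]; exact hlast)
  obtain ⟨S, s1, s2, s3, s4⟩ := hcand.exists_solution hkn ho D_self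
  refine ⟨S, ?_, s4⟩
  rw [hrun]
  refine S.encode_eq_output w1 (fun v => by rw [w3, s1]) fun i => ?_
  have hi := S.center_mem i
  by_cases hlt : (i : ℕ) < rank comp n
  · obtain ⟨l, h1, h2⟩ := exists_rank_eq hlt
    rw [← h2, w2 l h1, s2 l h1 i h2.symm]
  · have h1 := s1 (S.center i)
    rw [hi] at h1
    have h2 := rank_lt (hcand.idem (S.center i)) (comp (S.center i)).2
    unfold splitLabel at h1
    split_ifs at h1 with h3
    · omega
    · have e : 1 + n + (i : ℕ) = 1 + ((m₅ aPos (S.center i : ℕ)).toNat + k) := by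
        dsimp only at h1 h3
        omega
      rw [e]
      exact w4 (S.center i) (not_lt.1 h3)

end ConnectedMSR

/-! ### Lengths of integers in binary. -/

namespace RAM

theorem bitLength_le_iff {z : ℤ} {w : ℕ} : bitLength z ≤ w ↔ z.natAbs < 2 ^ w := Nat.size_le

theorem lt_two_pow_bitLength (z : ℤ) : z.natAbs < 2 ^ bitLength z := Nat.lt_size_self _

theorem bitLength_natCast_le (x : ℕ) : bitLength (x : ℤ) ≤ x := by
  rw [bitLength_le_iff, Int.natAbs_natCast]
  exact Nat.lt_two_pow_self

theorem bitLength_mono {x y : ℤ} (h : x.natAbs ≤ y.natAbs) : bitLength x ≤ bitLength y :=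
  bitLength_le_iff.2 (lt_of_le_of_lt h (lt_two_pow_bitLength y))

theorem bitLength_mul_le (x y : ℤ) : bitLength (x * y) ≤ bitLength x + bitLength y := by
  rw [bitLength_le_iff, Int.natAbs_mul, pow_add]
  exact Nat.mul_lt_mul'' (lt_two_pow_bitLength x) (lt_two_pow_bitLength y)

theorem bitLength_add_le (x y : ℤ) : bitLength (x + y) ≤ bitLength x + bitLength y + 1 := by
  rw [bitLength_le_iff]
  have h1 := lt_two_pow_bitLength x
  have h2 := lt_two_pow_bitLength y
  have h3 := Int.natAbs_add_le x y
  have h4 : 2 ^ bitLength x ≤ 2 ^ (bitLength x + bitLength y) :=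
    Nat.pow_le_pow_right (by decide) (Nat.le_add_right _ _)
  have h5 : 2 ^ bitLength y ≤ 2 ^ (bitLength x + bitLength y) :=
    Nat.pow_le_pow_right (by decide) (Nat.le_add_left _ _)
  rw [pow_succ]
  omega

/-- The summand `1` is the length of the empty product. -/
theorem bitLength_prod_le {ι : Type*} (s : Finset ι) (f : ι → ℕ) :
    bitLength ((∏ i ∈ s, f i : ℕ) : ℤ) ≤ ∑ i ∈ s, bitLength (f i : ℤ) + 1 := by
  classical
  induction s using Finset.induction_on with
  | empty => simp [bitLength]
  | insert i s hi ih =>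
    rw [Finset.prod_insert hi, Finset.sum_insert hi]
    push_cast at ih ⊢
    have := bitLength_mul_le (f i : ℤ) (∏ i ∈ s, (f i : ℤ))
    omega

theorem input_cell (w : List ℤ) (i : ℕ) : input w 0 (i + 1 : ℕ) = w.getD i 0 := by
  have h1 : ((i + 1 : ℕ) : ℤ) ≠ 0 := by omega
  have h2 : (0 : ℤ) < ((i + 1 : ℕ) : ℤ) := by omega
  have h3 : (((i + 1 : ℕ) : ℤ) - 1).toNat = i := by omega
  simp only [input, h1, h2, h3, if_true, if_false]

theorem size_append (v w : List ℤ) : size (v ++ w) = size v + size w := by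
  simp [size]

theorem size_ofFn {l : ℕ} (f : Fin l → ℤ) : size (List.ofFn f) = ∑ i, (bitLength (f i) + 1) := by
  simp [size, List.map_ofFn, List.sum_ofFn]

end RAM

namespace ConnectedMSR

open RAM RAM.Cmd

/-! ### Reading the instance -/

namespace Instance

variable (I : Instance)

/-- The entry at position `p` of the distance matrix. -/
noncomputable def entry (p : ℕ) : ℚ≥0 :=
  if h : p < I.n * I.n then I.d (Fin.divNat ⟨p, h⟩) (Fin.modNat ⟨p, h⟩) else 0

/-- A common denominator of the distances. -/
noncomputable def denom : ℕ := ∏ p ∈ Finset.range (I.n * I.n), (I.entry p).den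

/-- The distances, multiplied by the common denominator. -/
noncomputable def intEntry (p : ℕ) : ℕ := (I.entry p).num * (I.denom / (I.entry p).den)

noncomputable def intDist (u v : Fin I.n) : ℕ := I.intEntry (ix (u, v))

variable {I}

theorem divNat_ix (S : Fin I.n × Fin I.n) : Fin.divNat (⟨ix S, ix_lt S⟩ : Fin (I.n * I.n)) = S.1 := by
  have h1 := S.1.2
  have h2 := S.2.2
  apply Fin.ext
  simp only [Fin.coe_divNat, ix]
  rw [Nat.mul_add_div (by omega), Nat.div_eq_of_lt h2, add_zero]

theorem modNat_ix (S : Fin I.n × Fin I.n) : Fin.modNat (⟨ix S, ix_lt S⟩ : Fin (I.n * I.n)) = S.2 := by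
  apply Fin.ext
  simp only [Fin.coe_modNat, ix]
  rw [Nat.mul_add_mod, Nat.mod_eq_of_lt S.2.2]

theorem entry_ix (S : Fin I.n × Fin I.n) : I.entry (ix S) = I.d S.1 S.2 := by
  rw [entry, dif_pos (ix_lt S), divNat_ix, modNat_ix]

theorem denom_pos : 0 < I.denom := Finset.prod_pos fun p _ => (I.entry p).den_pos

theorem intEntry_cast {p : ℕ} (hp : p < I.n * I.n) :
    ((I.intEntry p : ℕ) : ℚ≥0) = I.entry p * I.denom := by
  obtain ⟨c, hc⟩ : (I.entry p).den ∣ I.denom :=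
    Finset.dvd_prod_of_mem (fun p => (I.entry p).den) (Finset.mem_range.2 hp)
  have hpos := (I.entry p).den_pos
  rw [intEntry, hc, Nat.mul_div_cancel_left _ hpos]
  push_cast
  rw [← mul_assoc, NNRat.mul_den_eq_num]

theorem intDist_cast (u v : Fin I.n) : ((I.intDist u v : ℕ) : ℚ≥0) = I.d u v * I.denom := by
  rw [intDist, intEntry_cast (ix_lt _), entry_ix]

theorem intDist_eq_zero {u v : Fin I.n} : I.intDist u v = 0 ↔ u = v := by
  rw [← Nat.cast_eq_zero (R := ℚ≥0), intDist_cast, mul_eq_zero, I.d_eq_zero]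
  have : (I.denom : ℚ≥0) ≠ 0 := Nat.cast_ne_zero.2 denom_pos.ne'
  simp [this]

theorem intDist_symm (u v : Fin I.n) : I.intDist u v = I.intDist v u := by
  rw [← Nat.cast_inj (R := ℚ≥0), intDist_cast, intDist_cast, I.d_symm]

theorem intDist_tri (u v w : Fin I.n) : I.intDist u w ≤ I.intDist u v + I.intDist v w := by
  rw [← Nat.cast_le (α := ℚ≥0)]
  push_cast
  rw [intDist_cast, intDist_cast, intDist_cast, ← add_mul]
  exact mul_le_mul_left (I.d_triangle u v w) _

theorem word_card : input I.encode 0 1 = I.n := by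
  have := input_cell I.encode 0
  exact this

theorem word_clusters : input I.encode 0 2 = I.k := by
  have := input_cell I.encode 1
  exact this

open Classical in
theorem word_adj (S : Fin I.n × Fin I.n) :
    input I.encode 0 (3 + ix S : ℕ) = if I.G.Adj S.1 S.2 then 1 else 0 := by
  have h := ix_lt S
  rw [show 3 + ix S = (2 + ix S) + 1 by omega, input_cell, encode, List.getD_append _ _ _ _ (by simp; omega),
    List.getD_append _ _ _ _ (by simp; omega), List.getD_append_right _ _ _ _ (by simp)]
  simp only [List.length_cons, List.length_nil, zero_add, Nat.reduceAdd, Nat.add_sub_cancel_left]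
  rw [List.getD_eq_getElem _ _ (by simpa using h), List.getElem_ofFn, divNat_ix, modNat_ix]

theorem word_num {p : ℕ} (hp : p < I.n * I.n) :
    input I.encode 0 (3 + I.n * I.n + p : ℕ) = (I.entry p).num := by
  rw [show 3 + I.n * I.n + p = (2 + I.n * I.n + p) + 1 by omega, input_cell, encode,
    List.getD_append _ _ _ _ (by simp; omega), List.getD_append_right _ _ _ _ (by simp; omega)]
  simp only [List.length_append, List.length_ofFn, List.length_cons, List.length_nil, zero_add,
    Nat.reduceAdd, Nat.add_sub_cancel_left]
  rw [List.getD_eq_getElem _ _ (by simpa using hp), List.getElem_ofFn, entry, dif_pos hp]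

theorem word_den {p : ℕ} (hp : p < I.n * I.n) :
    input I.encode 0 (3 + (I.n * I.n + I.n * I.n) + p : ℕ) = (I.entry p).den := by
  rw [show 3 + (I.n * I.n + I.n * I.n) + p = (2 + I.n * I.n + I.n * I.n + p) + 1 by omega,
    input_cell, encode, List.getD_append_right _ _ _ _ (by simp; omega)]
  simp only [List.length_append, List.length_ofFn, List.length_cons, List.length_nil, zero_add,
    Nat.reduceAdd, Nat.add_sub_cancel_left]
  rw [List.getD_eq_getElem _ _ (by simpa using hp), List.getElem_ofFn, entry, dif_pos hp]

variable (I) in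
/-- The encoding length. -/
noncomputable abbrev length : ℕ := size I.encode

theorem sum_le_length :
    ∑ p ∈ Finset.range (I.n * I.n), (bitLength ((I.entry p).num : ℤ) + 1) +
      ∑ p ∈ Finset.range (I.n * I.n), (bitLength ((I.entry p).den : ℤ) + 1) ≤ I.length := by
  rw [length, encode, size_append, size_append, size_append, size_ofFn, size_ofFn, size_ofFn,
    Finset.sum_range, Finset.sum_range]
  have : ∀ p : Fin (I.n * I.n), I.entry p = I.d p.divNat p.modNat := fun p => by
    rw [entry, dif_pos p.2]
  simp only [this]
  omega

/-- Each matrix entry contributes at least one symbol. So `n` itself, not only its length, is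
bounded by the encoding length. -/
theorem pairs_le_length : I.n * I.n ≤ I.length := by
  refine le_trans ?_ sum_le_length
  simp only [Finset.sum_add_distrib, Finset.sum_const, Finset.card_range, smul_eq_mul, mul_one]
  omega

theorem card_le_length : I.n ≤ I.length := (Nat.le_mul_self _).trans pairs_le_length

theorem word_length_le : (input I.encode 0 0).toNat ≤ I.length := by
  have : input I.encode 0 0 = I.encode.length := rfl
  rw [this, Int.toNat_natCast, length, size, List.sum_map_add]
  simp

theorem bitLength_num_le {p : ℕ} (hp : p < I.n * I.n) :
    bitLength ((I.entry p).num : ℤ) ≤ I.length := by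
  have h1 := sum_le_length (I := I)
  have h2 := Finset.single_le_sum (f := fun p => bitLength ((I.entry p).num : ℤ) + 1)
    (fun _ _ => Nat.zero_le _) (Finset.mem_range.2 hp)
  omega

theorem bitLength_den_le {p : ℕ} (hp : p < I.n * I.n) :
    bitLength ((I.entry p).den : ℤ) ≤ I.length := by
  have h1 := sum_le_length (I := I)
  have h2 := Finset.single_le_sum (f := fun p => bitLength ((I.entry p).den : ℤ) + 1)
    (fun _ _ => Nat.zero_le _) (Finset.mem_range.2 hp)
  omega

/-- Lengths of factors add up, so the common denominator and all its partial products have length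
linear in that of the instance. -/
theorem bitLength_partial_le {t : ℕ} (ht : t ≤ I.n * I.n) :
    bitLength ((∏ p ∈ Finset.range t, (I.entry p).den : ℕ) : ℤ) ≤ I.length + 1 := by
  refine (bitLength_prod_le _ _).trans (Nat.add_le_add_right ?_ 1)
  have h1 := sum_le_length (I := I)
  have h2 : ∑ p ∈ Finset.range t, bitLength ((I.entry p).den : ℤ) ≤
      ∑ p ∈ Finset.range (I.n * I.n), (bitLength ((I.entry p).den : ℤ) + 1) :=
    (Finset.sum_le_sum_of_subset (Finset.range_subset_range.2 ht)).trans
      (Finset.sum_le_sum fun _ _ => Nat.le_succ _)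
  omega

theorem bitLength_quot_le (p : ℕ) :
    bitLength ((I.denom / (I.entry p).den : ℕ) : ℤ) ≤ I.length + 1 :=
  (bitLength_mono (by rw [Int.natAbs_natCast, Int.natAbs_natCast]; exact Nat.div_le_self _ _)).trans
    (bitLength_partial_le le_rfl)

theorem bitLength_intEntry_le {p : ℕ} (hp : p < I.n * I.n) :
    bitLength (I.intEntry p : ℤ) ≤ 2 * I.length + 1 := by
  have h1 := bitLength_mul_le ((I.entry p).num : ℤ) ((I.denom / (I.entry p).den : ℕ) : ℤ)
  have h2 := bitLength_num_le hp
  have h3 := bitLength_quot_le (I := I) p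
  rw [intEntry, Nat.cast_mul]
  omega

end Instance

end ConnectedMSR

namespace ConnectedMSR

open RAM RAM.Cmd

/-! ### Preprocessing -/

notation "aDen" => 70
notation "aScale" => 71

/-- The number of rounds is one more than the bound on `lam` in `exists_guess`. It is polynomial in
`n` because rescaled radii are at most `C * n ^ 2`. -/
def readInput (L C : ℕ) : Cmd := block
  [set aN (.load 0 (.const 1)), set aK (.load 0 (.const 2)), set aNN (.mul (sc aN) (sc aN)),
   set aScale (.mul (.const C) (sc aNN)),
   set aRounds (.add (.mul (sc aN) (.add (sc aScale) (sc aN))) (.const 1)),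
   ifLt (sc aK) (.const L) (set aB (sc aK)) (set aB (.const L)), set aRest (.sub (sc aK) (sc aB))]

def numE : Expr := .load 0 (.add (.add (.const 3) (sc aNN)) (sc iP))

def denE : Expr := .load 0 (.add (.add (.const 3) (.add (sc aNN) (sc aNN))) (sc iP))

def offsets : Cmd := loop iP aNN (block
  [store aOff (sc iP) (.mul (sc aN) (sc iP)), store aOffPair (sc iP) (.mul (sc aNN) (sc iP)),
   store aFst (sc iP) (.div (sc iP) (sc aN))])

def commonDenom : Cmd := block
  [set aDen (.const 1), loop iP aNN (set aDen (.mul (sc aDen) denE))]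

def distances : Cmd := loop iP aNN (store aDist (sc iP) (.mul numE (.div (sc aDen) denE)))

def scaledE : Expr :=
  .div (.add (.mul (at_ aDist iJ) (sc aScale)) (.sub (at_ aDist iP) (.const 1))) (at_ aDist iP)

def scaledTable : Cmd := loop iP aNN (loop iJ aNN
  (store aTable (.add (at_ aOffPair iP) (sc iJ)) scaledE))

def preprocess : Cmd := block [offsets, commonDenom, distances, scaledTable]

variable {I : Instance} {L C B W : ℕ} {m m' : Memory}

/-- The memory after the head of the input has been read. -/
structure Head (I : Instance) (L C : ℕ) (m : Memory) : Prop where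
  word : m 0 = input I.encode 0
  card : m aN 0 = I.n
  clusters : m aK 0 = I.k
  pairs : m aNN 0 = (I.n * I.n : ℕ)
  scale : m aScale 0 = (C * I.n ^ 2 : ℕ)
  rounds : m aRounds 0 = (I.n * (C * I.n ^ 2 + I.n) + 1 : ℕ)
  big : m aB 0 = (min L I.k : ℕ)
  rest : m aRest 0 = (I.k - min L I.k : ℕ)

theorem run_readInput : Head I L C ((readInput L C).run (input I.encode)) ∧
    ∀ a, 8 ≤ a → a ≠ aScale → (readInput L C).run (input I.encode) a 0 = 0 := by
  have hmin : ((min L I.k : ℕ) : ℤ) = if (I.k : ℤ) < L then (I.k : ℤ) else L := by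
    split_ifs <;> omega
  have hsub : ((I.k - min L I.k : ℕ) : ℤ) = I.k - (min L I.k : ℕ) := by omega
  refine ⟨⟨run_frame _ _ rfl, ?_, ?_, ?_, ?_, ?_, ?_, ?_⟩, fun a ha ha' => ?_⟩
  · simp only [readInput, run_block_cons, run_block_nil, run_ifLt_apply, run_store, Expr.val,
      Memory.write]
    simp [Instance.word_card]
  · simp only [readInput, run_block_cons, run_block_nil, run_ifLt_apply, run_store, Expr.val,
      Memory.write]
    simp [Instance.word_clusters]
  · simp only [readInput, run_block_cons, run_block_nil, run_ifLt_apply, run_store, Expr.val,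
      Memory.write]
    simp [Instance.word_card]
  · simp only [readInput, run_block_cons, run_block_nil, run_ifLt_apply, run_store, Expr.val,
      Memory.write]
    simp [Instance.word_card, pow_two]
  · simp only [readInput, run_block_cons, run_block_nil, run_ifLt_apply, run_store, Expr.val,
      Memory.write]
    simp [Instance.word_card, pow_two]
  · rw [hmin]
    simp only [readInput, run_block_cons, run_block_nil, run_ifLt_apply, run_store, Expr.val,
      Memory.write]
    simp [Instance.word_clusters]
  · rw [hsub, hmin]
    simp only [readInput, run_block_cons, run_block_nil, run_ifLt_apply, run_store, Expr.val,
      Memory.write]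
    simp [Instance.word_clusters]
  · have hwr : (readInput L C).wr a = false := by
      simp [readInput, block, ifLt, wr]; omega
    rw [run_frame _ _ hwr]
    exact if_neg (by omega)

theorem Head.congr (h : Head I L C m) (hm : ∀ a, a < 8 ∨ a = aScale → a ≠ 1 → m' a = m a) :
    Head I L C m' := by
  obtain ⟨h1, h2, h3, h4, h5, h6, h7, h8⟩ := h
  constructor <;> rw [hm _ (by decide) (by decide)] <;> assumption

theorem Head.num_val (h : Head I L C m) {p : ℕ} (hp : p < I.n * I.n) (hx : m iP 0 = p) :
    numE.val m = (I.entry p).num := by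
  rw [← Instance.word_num hp]
  simp only [numE, Expr.val, h.word, h.pairs, hx]
  push_cast
  rfl

theorem Head.den_val (h : Head I L C m) {p : ℕ} (hp : p < I.n * I.n) (hx : m iP 0 = p) :
    denE.val m = (I.entry p).den := by
  rw [← Instance.word_den hp]
  simp only [denE, Expr.val, h.word, h.pairs, hx]
  push_cast
  rfl

theorem cheap_numE : numE.Cheap W m := Expr.additive.cheap rfl _ _

theorem cheap_denE : denE.Cheap W m := Expr.additive.cheap rfl _ _

theorem bitLength_le_of_eq {z : ℤ} {x : ℕ} (hz : z = x) (hx : x ≤ W) : bitLength z ≤ W := by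
  rw [hz]; exact (bitLength_natCast_le x).trans hx

theorem run_offsets (h : Head I L C m) :
    (∀ p < I.n * I.n, offsets.run m aOff (p : ℕ) = (I.n * p : ℕ)) ∧
    (∀ p < I.n * I.n, offsets.run m aOffPair (p : ℕ) = (I.n * I.n * p : ℕ)) ∧
    ∀ S : Fin I.n × Fin I.n, offsets.run m aFst (ix S) = (S.1 : ℕ) := by
  refine ⟨fun p hp => ?_, fun p hp => ?_, fun S => ?_⟩
  · have := (run_each (x := iP) (b := aNN) (a := aOff) (m := m) (p := block
      [store aOff (sc iP) (.mul (sc aN) (sc iP)), store aOffPair (sc iP) (.mul (sc aNN) (sc iP)),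
       store aFst (sc iP) (.div (sc iP) (sc aN))]) 0 (fun t _ => (I.n * t : ℕ)) h.pairs (by decide)
      (fun t m' hfr hx j => by
        simp [run_block_cons, run_block_nil, run_store, Memory.write, Expr.val, hx, hfr aN rfl,
          h.card])).1 ⟨p, hp⟩
    rw [zero_add] at this
    exact this
  · have := (run_each (x := iP) (b := aNN) (a := aOffPair) (m := m) (p := block
      [store aOff (sc iP) (.mul (sc aN) (sc iP)), store aOffPair (sc iP) (.mul (sc aNN) (sc iP)),
       store aFst (sc iP) (.div (sc iP) (sc aN))]) 0 (fun t _ => (I.n * I.n * t : ℕ)) h.pairs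
      (by decide) (fun t m' hfr hx j => by
        simp [run_block_cons, run_block_nil, run_store, Memory.write, Expr.val, hx, hfr aNN rfl,
          h.pairs])).1 ⟨p, hp⟩
    rw [zero_add] at this
    exact this
  · have := (run_each (x := iP) (b := aNN) (a := aFst) (m := m) (p := block
      [store aOff (sc iP) (.mul (sc aN) (sc iP)), store aOffPair (sc iP) (.mul (sc aNN) (sc iP)),
       store aFst (sc iP) (.div (sc iP) (sc aN))]) 0 (fun t _ => (t / I.n : ℕ)) h.pairs
      (by decide) (fun t m' hfr hx j => by
        simp [run_block_cons, run_block_nil, run_store, Memory.write, Expr.val, hx, hfr aN rfl,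
          h.card])).1 ⟨ix S, ix_lt S⟩
    rw [zero_add] at this
    refine this.trans ?_
    have h1 := S.1.2
    dsimp only [ix]
    rw [Nat.mul_add_div (by omega), Nat.div_eq_of_lt S.2.2, add_zero]

theorem cheap_offsets (h : Head I L C m) (hB : I.n * I.n ≤ B) (hW : I.n * I.n ≤ W) :
    offsets.Cheap B W m := by
  have hn : I.n ≤ W := (Nat.le_mul_self _).trans hW
  refine (cheap_loop (I := fun _ _ => True) _ h.pairs hB trivial (fun _ _ _ _ => trivial)
    fun t ht m' hfr hx _ => ⟨?_, trivial⟩).1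
  have e1 : m' aN 0 = I.n := by rw [hfr aN rfl, h.card]
  have e2 : m' aNN 0 = (I.n * I.n : ℕ) := by rw [hfr aNN rfl, h.pairs]
  have b1 := bitLength_le_of_eq e1 hn
  have b2 := bitLength_le_of_eq e2 hW
  have b3 := bitLength_le_of_eq hx (ht.le.trans hW)
  simp [block, Cheap, Expr.Cheap, run_store, Expr.val, Memory.write, b1, b2, b3]

theorem run_commonDenom (h : Head I L C m) (hB : I.n * I.n ≤ B) (hW : I.length + 1 ≤ W) :
    commonDenom.Cheap B W m ∧ commonDenom.run m aDen 0 = I.denom := by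
  set m₁ := (set aDen (.const 1)).run m with hm₁
  have h1 : Head I L C m₁ := h.congr fun a ha _ => by
    rw [hm₁, run_store, Memory.write_ne _ _ _ (by omega)]
  have := cheap_loop (B := B) (W := W) (x := iP) (b := aNN) (m := m₁)
    (p := set aDen (.mul (sc aDen) denE))
    (I := fun t m' => m' aDen 0 = (∏ p ∈ Finset.range t, (I.entry p).den : ℕ)) (I.n * I.n) h1.pairs
    hB (by simp [hm₁, run_store, Memory.write, Expr.val])
    (fun t m' z hI => by rwa [Memory.write_ne _ _ _ (by decide)])
    (fun t ht m' hfr hx hI => by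
      have h' : Head I L C m' := h1.congr fun a ha _ => hfr a (by simp [wr]; omega)
      have e1 := h'.den_val ht hx
      refine ⟨⟨trivial, trivial, cheap_denE, ?_, ?_⟩, ?_⟩
      · refine le_trans ?_ ((Instance.bitLength_partial_le ht.le).trans hW)
        simp only [Expr.val, hI, le_refl]
      · rw [e1]
        have := Instance.bitLength_den_le ht
        omega
      · rw [run_store, Expr.val, Memory.write_same, Expr.val, e1, Finset.prod_range_succ]
        simp only [Expr.val, hI]
        push_cast
        rfl)
  exact ⟨⟨⟨trivial, trivial⟩, this.1, trivial⟩, this.2⟩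

theorem run_distances (h : Head I L C m) (hden : m aDen 0 = I.denom) (hB : I.n * I.n ≤ B)
    (hW : I.length + 1 ≤ W) : distances.Cheap B W m ∧
      ∀ p < I.n * I.n, distances.run m aDist (p : ℕ) = I.intEntry p := by
  have hhead : ∀ m' : Memory, (∀ a, distances.wr a = false → m' a = m a) → Head I L C m' ∧
      m' aDen 0 = I.denom := fun m' hfr => ⟨h.congr fun a ha _ =>
        hfr a (by simp [distances, wr]; omega), by rw [hfr aDen rfl, hden]⟩
  refine ⟨(cheap_loop (I := fun _ _ => True) _ h.pairs hB trivial (fun _ _ _ _ => trivial)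
    fun t ht m' hfr hx _ => ⟨?_, trivial⟩).1, fun p hp => ?_⟩
  · obtain ⟨h', hd⟩ := hhead m' hfr
    have e1 := h'.num_val ht hx
    have e2 := h'.den_val ht hx
    have e3 : (sc aDen).val m' = I.denom := hd
    refine ⟨trivial, cheap_numE, ⟨trivial, cheap_denE, ?_, ?_⟩, ?_, ?_⟩
    · rw [e3]; exact (Instance.bitLength_partial_le le_rfl).trans hW
    · rw [e2]; exact (Instance.bitLength_den_le ht).trans (by omega)
    · rw [e1]; exact (Instance.bitLength_num_le ht).trans (by omega)
    · rw [Expr.val, e2, e3, ← Int.natCast_ediv]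
      exact (Instance.bitLength_quot_le t).trans hW
  · have := (run_each (x := iP) (b := aNN) (a := aDist) (m := m)
      (p := store aDist (sc iP) (.mul numE (.div (sc aDen) denE))) 0
      (fun t _ => (I.intEntry t : ℤ)) h.pairs (by decide) (fun t m' hfr hx j => by
        obtain ⟨h', hd⟩ := hhead m' hfr
        have e1 := h'.num_val t.2 hx
        have e2 := h'.den_val t.2 hx
        have e3 : (sc aDen).val m' = I.denom := hd
        have e4 : (sc iP).val m' = (t : ℕ) := hx
        have e5 : (Expr.mul numE (.div (sc aDen) denE)).val m' = I.intEntry t := by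
          rw [Expr.val, Expr.val, e1, e2, e3, Instance.intEntry]
          push_cast
          rfl
        rw [run_store_apply, e4, e5, zero_add]
        simp)).1 ⟨p, hp⟩
    rw [zero_add] at this
    exact this

theorem intDist_ix (S : Fin I.n × Fin I.n) : I.intEntry (ix S) = I.intDist S.1 S.2 := rfl

theorem scaledE_val (hs : m aScale 0 = (C * I.n ^ 2 : ℕ))
    (hd : ∀ p < I.n * I.n, m aDist (p : ℕ) = I.intEntry p) {S T : Fin I.n × Fin I.n}
    (hS : m iP 0 = ix S) (hT : m iJ 0 = ix T) :
    scaledE.val m = scaled I.intDist (C * I.n ^ 2) (I.intDist S.1 S.2) T.1 T.2 := by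
  simp only [scaledE, Expr.val, hs, hS, hT, hd _ (ix_lt _), intDist_ix, scaled]
  -- For `R = 0` the integer `R - 1` differs from the truncated one, but division by zero is zero on
  -- both sides.
  rcases Nat.eq_zero_or_pos (I.intDist S.1 S.2) with h0 | h0
  · simp [h0]
  · push_cast [Nat.cast_sub h0]
    rfl

theorem run_scaledTable (h : Head I L C m)
    (hoff : ∀ p < I.n * I.n, m aOffPair (p : ℕ) = (I.n * I.n * p : ℕ))
    (hd : ∀ p < I.n * I.n, m aDist (p : ℕ) = I.intEntry p) (hB : I.n * I.n ≤ B)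
    (hW : 4 * I.length + C * I.length + 6 ≤ W) : scaledTable.Cheap B W m ∧
      ∀ S T : Fin I.n × Fin I.n, scaledTable.run m aTable (I.n * I.n * ix S + ix T : ℕ) =
        scaled I.intDist (C * I.n ^ 2) (I.intDist S.1 S.2) T.1 T.2 := by
  have hl := Instance.pairs_le_length (I := I)
  have := cheap_loop (B := B) (W := W) (x := iP) (b := aNN) (m := m)
    (p := loop iJ aNN (store aTable (.add (at_ aOffPair iP) (sc iJ)) scaledE))
    (I := fun t m' => ∀ S T : Fin I.n × Fin I.n, ix S < t →
      m' aTable (I.n * I.n * ix S + ix T : ℕ) =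
        scaled I.intDist (C * I.n ^ 2) (I.intDist S.1 S.2) T.1 T.2) (I.n * I.n) h.pairs hB
    (fun _ _ hS => absurd hS (Nat.not_lt_zero _))
    (fun t m' z hI => by rwa [Memory.write_ne _ _ _ (by decide)])
    (fun t ht m' hfr hx hI => by
      have h' : Head I L C m' := h.congr fun a ha _ => hfr a (by simp [wr]; omega)
      have hoff' := hfr aOffPair rfl ▸ hoff
      have hd' := hfr aDist rfl ▸ hd
      obtain ⟨S₀, hS₀⟩ := exists_ix ⟨t, ht⟩
      have hS₀' : ix S₀ = t := hS₀
      have hcheap := (cheap_loop (B := B) (W := W) (x := iJ) (b := aNN) (m := m')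
        (p := store aTable (.add (at_ aOffPair iP) (sc iJ)) scaledE) (I := fun _ _ => True)
        _ h'.pairs hB trivial (fun _ _ _ _ => trivial) fun s hs m₁ hfr₁ hx₁ _ => ⟨by
          have b1 := Instance.bitLength_intEntry_le ht
          have b2 := Instance.bitLength_intEntry_le hs
          have b3 : bitLength ((C * I.n ^ 2 : ℕ) : ℤ) ≤ C * I.length :=
            (bitLength_natCast_le _).trans (Nat.mul_le_mul_left _ (by rw [pow_two]; exact hl))
          have b4 := bitLength_mul_le (I.intEntry s : ℤ) ((C * I.n ^ 2 : ℕ) : ℤ)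
          have b5 := bitLength_add_le (I.intEntry t : ℤ) (-1)
          have b6 := bitLength_add_le ((I.intEntry s : ℤ) * ((C * I.n ^ 2 : ℕ) : ℤ))
            ((I.intEntry t : ℤ) + -1)
          have b7 : bitLength (-1) = 1 := by decide
          have e1 : (at_ aDist iP).val m₁ = I.intEntry t := by
            simp only [Expr.val, hfr₁ iP rfl, hx, hfr₁ aDist rfl, hd' t ht]
          have e2 : (at_ aDist iJ).val m₁ = I.intEntry s := by
            simp only [Expr.val, hx₁, hfr₁ aDist rfl, hd' s hs]
          have e3 : (sc aScale).val m₁ = (C * I.n ^ 2 : ℕ) := by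
            simp only [Expr.val, hfr₁ aScale rfl, h'.scale]
          refine ⟨⟨trivial, trivial⟩, ⟨⟨trivial, trivial, ?_, ?_⟩, trivial, trivial⟩, trivial, ?_, ?_⟩
          · rw [e2]; omega
          · rw [e3]; omega
          · have e4 : (Expr.add (.mul (at_ aDist iJ) (sc aScale)) (.sub (at_ aDist iP) (.const 1))).val
                m₁ = I.intEntry s * (C * I.n ^ 2 : ℕ) + (I.intEntry t + -1) := by
              simp only [Expr.val] at e1 e2 e3 ⊢
              rw [e1, e2, e3, sub_eq_add_neg]
            rw [e4]; omega
          · rw [e1]; omega, trivial⟩).1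
      have hrow := run_each (x := iJ) (b := aNN) (a := aTable) (m := m')
        (p := store aTable (.add (at_ aOffPair iP) (sc iJ)) scaledE) (I.n * I.n * t : ℕ)
        -- The first summand is zero. In the second the inner counter is set by hand, since the
        -- other cells that the entry depends on do not change in the inner loop.
        (fun s _ => m' aTable 0 * 0 + scaledE.val ((m'.write iJ 0 (s : ℕ)))) h'.pairs (by decide)
        (fun s m₁ hfr₁ hx₁ j => by
          have e0 : (Expr.add (at_ aOffPair iP) (sc iJ)).val m₁ = (I.n * I.n * t : ℕ) + (s : ℕ) := by
            simp only [Expr.val, hfr₁ iP rfl, hx, hfr₁ aOffPair rfl, hoff' t ht, hx₁]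
          have e1 : scaledE.val m₁ = scaledE.val (m'.write iJ 0 (s : ℕ)) := by
            simp only [scaledE, Expr.val, Memory.write_same,
              Memory.write_ne _ _ _ (show aDist ≠ iJ by decide),
              Memory.write_ne _ _ _ (show iP ≠ iJ by decide),
              Memory.write_ne _ _ _ (show aScale ≠ iJ by decide), hfr₁ aDist rfl, hfr₁ iP rfl,
              hfr₁ aScale rfl, hx₁]
          rw [run_store_apply, e0, e1, mul_zero, zero_add]
          simp)
      refine ⟨hcheap, fun S T hS => ?_⟩
      rcases Nat.lt_succ_iff_lt_or_eq.1 hS with hS | hS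
      · rw [hrow.2 _ ?_, hI S T hS]
        have h1 := ix_lt T
        rcases row_disjoint (n := I.n * I.n) (a := ix S) (b := t) (by omega) h1 with h2 | h2
        · exact Or.inl (by exact_mod_cast h2)
        · exact Or.inr (by exact_mod_cast h2)
      · have hSS : S = S₀ := ix_inj (hS.trans hS₀'.symm)
        have h1 := hrow.1 ⟨ix T, ix_lt T⟩
        rw [hS]
        push_cast at h1 ⊢
        rw [h1, mul_zero, zero_add]
        have := scaledE_val (I := I) (C := C) (m := m'.write iJ 0 (ix T : ℕ)) (S := S) (T := T)
          (by rw [Memory.write_ne _ _ _ (by decide), h'.scale])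
          (by rw [Memory.write_ne _ _ _ (by decide)]; exact hd')
          (by rw [Memory.write_ne _ _ _ (by decide), hx, hS]) (Memory.write_same _ _ _ _)
        exact this)
  exact ⟨this.1, fun S T => this.2 S T (ix_lt S)⟩

end ConnectedMSR

namespace ConnectedMSR

open RAM RAM.Cmd

variable {I : Instance} {L C B W : ℕ} {m m' : Memory}

/-- The last clause says that no solution has been stored yet and also bounds the idle arrays below
`20`, as `plain.cheap` asks. -/
theorem run_preprocess (h : Head I L C m) (h0 : ∀ a, 8 ≤ a → a ≠ aScale → m a 0 = 0)
    (hB : I.n * I.n ≤ B) (hW : 4 * I.length + C * I.length + 6 ≤ W) :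
    preprocess.Cheap B W m ∧ Head I L C (preprocess.run m) ∧
      Tables I.G I.intDist I.k (min L I.k) (C * I.n ^ 2) (I.n * (C * I.n ^ 2 + I.n) + 1)
        (preprocess.run m) ∧ ∀ a, 13 ≤ a → a < 60 → preprocess.run m a 0 = 0 := by
  have hl := Instance.pairs_le_length (I := I)
  set m₁ := offsets.run m with hm₁
  set m₂ := commonDenom.run m₁ with hm₂
  set m₃ := distances.run m₂ with hm₃
  set m₄ := scaledTable.run m₃ with hm₄
  have hrun : preprocess.run m = m₄ := rfl
  have w1 : ∀ a, a < 8 ∨ 11 ≤ a ∧ a ≠ iP → offsets.wr a = false := fun a ha => by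
    simp [offsets, block, wr]; omega
  have w2 : ∀ a, a ≠ aDen → a ≠ iP → commonDenom.wr a = false := fun a ha hb => by
    simp [commonDenom, block, wr, ha, hb]
  have w3 : ∀ a, a ≠ aDist → a ≠ iP → distances.wr a = false := fun a ha hb => by
    simp [distances, wr, ha, hb]
  have w4 : ∀ a, a ≠ aTable → a ≠ iP → a ≠ iJ → scaledTable.wr a = false := fun a ha hb hc => by
    simp [scaledTable, wr, ha, hb, hc]
  have h1 : Head I L C m₁ := h.congr fun a ha _ => run_frame _ _ (w1 a (by omega))
  have h2 : Head I L C m₂ := h1.congr fun a ha _ => run_frame _ _ (w2 a (by omega) (by omega))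
  have h3 : Head I L C m₃ := h2.congr fun a ha _ => run_frame _ _ (w3 a (by omega) (by omega))
  have h4 : Head I L C m₄ := h3.congr fun a ha _ =>
    run_frame _ _ (w4 a (by omega) (by omega) (by omega))
  obtain ⟨o1, o2, o3⟩ := run_offsets h
  have c1 := cheap_offsets h hB (show I.n * I.n ≤ W by omega)
  obtain ⟨c2, d2⟩ := run_commonDenom h1 hB (show I.length + 1 ≤ W by omega)
  obtain ⟨c3, d3⟩ := run_distances h2 d2 hB (show I.length + 1 ≤ W by omega)
  have f2 : ∀ a, a ≠ aDen → a ≠ iP → m₂ a = m₁ a := fun a ha hb => run_frame _ _ (w2 a ha hb)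
  have f3 : ∀ a, a ≠ aDist → a ≠ iP → m₃ a = m₂ a := fun a ha hb => run_frame _ _ (w3 a ha hb)
  have f4 : ∀ a, a ≠ aTable → a ≠ iP → a ≠ iJ → m₄ a = m₃ a := fun a ha hb hc =>
    run_frame _ _ (w4 a ha hb hc)
  obtain ⟨c4, d4⟩ := run_scaledTable h3 (C := C)
    (by rw [f3 aOffPair (by decide) (by decide), f2 aOffPair (by decide) (by decide)]; exact o2)
    d3 hB hW
  rw [hrun]
  refine ⟨⟨c1, c2, c3, c4, trivial⟩, h4, ⟨h4.card, h4.pairs, h4.big, h4.rounds, h4.rest, ?_, ?_, ?_,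
    ?_, d4, fun S => ?_⟩, fun a h1 h2 => ?_⟩
  · rw [f4 _ (by decide) (by decide) (by decide), f3 _ (by decide) (by decide),
      f2 _ (by decide) (by decide)]
    exact o1
  · rw [f4 _ (by decide) (by decide) (by decide), f3 _ (by decide) (by decide),
      f2 _ (by decide) (by decide)]
    exact o2
  · rw [f4 _ (by decide) (by decide) (by decide), f3 _ (by decide) (by decide),
      f2 _ (by decide) (by decide)]
    exact o3
  · rw [f4 _ (by decide) (by decide) (by decide)]
    exact fun S => d3 _ (ix_lt S)
  · rw [h4.word]
    exact Instance.word_adj S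
  · rw [f4 _ (by omega) (by omega) (by omega), f3 _ (by omega) (by omega),
      f2 _ (by omega) (by omega), hm₁, run_frame _ _ (w1 a (by omega))]
    exact h0 a (by omega) (by omega)

/-! ### The algorithm -/

/-- For `n < k` nothing is done: centers are distinct, so there is no feasible solution. -/
def algorithm (L C : ℕ) : Cmd := block [readInput L C, ifLt (sc aN) (sc aK) skip
  (block [preprocess, guessLoop tryGuess L, outputPhase])]

theorem wf_algorithm (L C : ℕ) : (algorithm L C).wf = true := by
  simp only [algorithm, block, ifLt, wf, plain.wf (plain_guessLoop L), plain.wf plain_outputPhase]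
  rfl

theorem cheap_readInput {m : Memory} (hm : m = input I.encode)
    (hW : 4 * I.length + C * I.length + C + 6 ≤ W) : (readInput L C).Cheap B W m := by
  have hl := Instance.pairs_le_length (I := I)
  have hl' := Instance.card_le_length (I := I)
  have hCl : C * (I.n * I.n) ≤ C * I.length := Nat.mul_le_mul_left _ hl
  have b1 : bitLength (I.n : ℤ) ≤ W := (bitLength_natCast_le _).trans (by omega)
  have b2 : bitLength ((I.n : ℤ) * I.n) ≤ W := by
    rw [← Nat.cast_mul]; exact (bitLength_natCast_le _).trans (by omega)
  have b3 : bitLength (C : ℤ) ≤ W := (bitLength_natCast_le _).trans (by omega)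
  have b4 : bitLength ((C : ℤ) * ((I.n : ℤ) * I.n) + I.n) ≤ W := by
    have : (C : ℤ) * ((I.n : ℤ) * I.n) + I.n = (C * (I.n * I.n) + I.n : ℕ) := by push_cast; rfl
    rw [this]
    exact (bitLength_natCast_le _).trans (by omega)
  subst hm
  simp only [readInput, block, Cheap, ifLt, run_store, Expr.Cheap, Expr.val, Memory.write, and_true,
    true_and, ite_self]
  simp [Instance.word_card, b1, b2, b3, b4]

/-- Only reading and preprocessing multiply or divide, on operands of length linear in that of the
instance. The guesses and the output are plain programs, so only cell `0` of the arrays below `20`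
has to be bounded. -/
theorem cheap_algorithm
    (hB : I.length * (C * I.length + I.length) + 1 + I.length ≤ B)
    (hW : 4 * I.length + C * I.length + C + 6 ≤ W) :
    (algorithm L C).Cheap B W (input I.encode) := by
  have hl := Instance.pairs_le_length (I := I)
  have hl' := Instance.card_le_length (I := I)
  obtain ⟨h, h0⟩ := run_readInput (I := I) (L := L) (C := C)
  refine ⟨cheap_readInput rfl hW, ⟨⟨⟨trivial, trivial⟩, ?_⟩, trivial⟩⟩
  set m := (readInput L C).run (input I.encode) with hm
  have e1 : (Expr.sub (sc aK) (sc aN)).val m = I.k - I.n := by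
    simp only [Expr.val, h.clusters, h.card]
  rw [e1]
  split_ifs with hkn
  · trivial
  have hkn' : I.k ≤ I.n := by omega
  obtain ⟨p1, p2, p3, p4⟩ := run_preprocess h h0 (B := B) (W := W) (by omega) (by omega)
  set m₁ := preprocess.run m with hm₁
  have hn : 0 < I.n := by have := I.two_le_k; omega
  have hix : ix ((⟨0, hn⟩, ⟨0, hn⟩) : Fin I.n × Fin I.n) = 0 := by simp [ix]
  have hbnd : ∀ b < 20, b ≠ 1 → (m₁ b 0).toNat ≤ B := by
    intro b hb hb1
    have hQ : I.n * (C * I.n ^ 2 + I.n) + 1 ≤ B := by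
      have h1 : C * I.n ^ 2 ≤ C * I.length := Nat.mul_le_mul_left C (by rw [pow_two]; exact hl)
      have h2 := Nat.mul_le_mul hl' (Nat.add_le_add h1 hl')
      omega
    have hword := Instance.word_length_le (I := I)
    -- The tables are not loop bounds, but `plain.cheap` does not distinguish them from the
    -- parameters. Their first entries vanish.
    have z1 := p3.off 0 (Nat.mul_pos hn hn)
    have z2 := p3.offPair 0 (Nat.mul_pos hn hn)
    have z3 := p3.fst (⟨0, hn⟩, ⟨0, hn⟩)
    have z4 := p3.dist (⟨0, hn⟩, ⟨0, hn⟩)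
    have z5 := p3.table (⟨0, hn⟩, ⟨0, hn⟩) (⟨0, hn⟩, ⟨0, hn⟩)
    have hself : I.intDist ⟨0, hn⟩ ⟨0, hn⟩ = 0 := Instance.intDist_eq_zero.2 rfl
    rw [hix] at z3 z4 z5
    simp only [hself, scaled, Nat.mul_zero, Nat.cast_zero, add_zero, Nat.div_zero] at z1 z2 z3 z4 z5
    rcases Nat.lt_or_ge b 13 with hb' | hb'
    · interval_cases b
      · rw [p2.word]; omega
      · exact absurd rfl hb1
      · rw [p2.card]; omega
      · rw [p2.clusters]; omega
      · rw [p2.pairs]; omega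
      · rw [p2.big]; omega
      · rw [p2.rounds]; omega
      · rw [p2.rest]; omega
      · rw [z1]; omega
      · rw [z2]; omega
      · rw [z3]; omega
      · rw [z4]; omega
      · rw [z5]; omega
    · rw [p4 b hb' (by omega)]; omega
  refine ⟨p1, plain.cheap (plain_guessLoop L) hbnd W, plain.cheap plain_outputPhase (fun b hb hb1 => ?_) W,
    trivial⟩
  rw [run_frame _ _ (wr_guessLoop (Or.inr ⟨hb, hb1⟩))]
  exact hbnd b hb hb1

/-! ### The approximation guarantee -/

/-- The cost for integer distances. -/
def Solution.intCost {n k : ℕ} {G : SimpleGraph (Fin n)} (S : Solution G k)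
    (D : Fin n → Fin n → ℕ) : ℕ :=
  ∑ i, (Finset.univ.filter fun v => S.label v = i).sup (D (S.center i))

theorem Solution.intCost_cast (S : Solution I.G I.k) :
    ((S.intCost I.intDist : ℕ) : ℚ≥0) = S.cost I.d * I.denom := by
  unfold Solution.intCost Solution.cost Solution.radius
  rw [Nat.cast_sum, Finset.sum_mul]
  refine Finset.sum_congr rfl fun i _ => ?_
  rw [Finset.apply_sup_eq_sup_comp_of_linearOrder (fun x : ℕ => (x : ℚ≥0)) Nat.mono_cast rfl,
    Finset.apply_sup_eq_sup_comp_of_linearOrder (fun x : ℚ≥0 => x * I.denom)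
      (fun x y h => mul_le_mul_left h _) (zero_mul _)]
  refine Finset.sup_congr rfl fun v _ => ?_
  simp only [Function.comp_apply]
  rw [Instance.intDist_cast, I.d_symm]

theorem Solution.center_injective {V : Type*} {G : SimpleGraph V} {k : ℕ} (S : Solution G k) :
    Function.Injective S.center := fun i j h => by
  rw [← S.center_mem i, h, S.center_mem]

theorem Solution.sum_classRadius {n k : ℕ} {G : SimpleGraph (Fin n)} (S : Solution G k)
    (D : Fin n → Fin n → ℕ) :
    ∑ i, classRadius D (fun v => S.center (S.label v)) (S.center i) (S.center i) =
      S.intCost D := by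
  unfold Solution.intCost classRadius
  simp only [S.center_injective.eq_iff]

/-- If some solution has cost zero, then every solution has. -/
theorem Solution.intCost_eq_zero {n k : ℕ} {G : SimpleGraph (Fin n)} (S S' : Solution G k)
    {D : Fin n → Fin n → ℕ} (hD : ∀ u v, D u v = 0 ↔ u = v)
    (h : ∀ i v, S'.label v = i → D (S'.center i) v = 0) : S.intCost D = 0 := by
  -- The clusters of `S'` are singletons, so there are at most `k` vertices and the centers of `S`
  -- exhaust them.
  have hinj : Function.Injective S'.label := fun u v huv => by
    rw [← (hD _ _).1 (h _ u rfl), ← (hD _ _).1 (h _ v rfl), huv]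
  have hsurj : Function.Surjective S.center := by
    refine ((Fintype.bijective_iff_injective_and_card S.center).2
      ⟨S.center_injective, le_antisymm ?_ ?_⟩).2
    · exact Fintype.card_le_of_injective _ S.center_injective
    · exact Fintype.card_le_of_injective _ hinj
  refine Finset.sum_eq_zero fun i _ => Nat.le_zero.1 (Finset.sup_le fun v hv => ?_)
  obtain ⟨j, rfl⟩ := hsurj v
  have := (Finset.mem_filter.1 hv).2
  rw [S.center_mem] at this
  rw [this, (hD _ _).2 rfl]

theorem run_algorithm (hL : 1 ≤ L) (h : Nonempty (Solution I.G I.k)) :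
    ∃ S : Solution I.G I.k, output ((algorithm L C).run (input I.encode)) = S.encode ∧
      ∀ S' : Solution I.G I.k, C * L * S.intCost I.intDist ≤
        (3 * C * L + 3 * C + 9 * L) * S'.intCost I.intDist := by
  obtain ⟨S₀⟩ := h
  have hkn : I.k ≤ I.n := by simpa using S₀.card_le
  have hn : 0 < I.n := by have := I.two_le_k; omega
  obtain ⟨h, h0⟩ := run_readInput (I := I) (L := L) (C := C)
  set m := (readInput L C).run (input I.encode) with hm
  obtain ⟨-, p2, p3, p4⟩ := run_preprocess h h0 le_rfl le_rfl
  set m₁ := preprocess.run m with hm₁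
  set m₂ := (guessLoop tryGuess L).run m₁ with hm₂
  have hrun : (algorithm L C).run (input I.encode) = outputPhase.run m₂ := by
    simp only [algorithm, run_block_cons, run_block_nil, run_ifLt, ← hm, Expr.val, h.clusters, h.card]
    rw [if_neg (by omega)]
  have hself : ∀ u, I.intDist u u = 0 := fun u => Instance.intDist_eq_zero.2 rfl
  have hg := run_guesses hself Instance.intDist_symm Instance.intDist_tri I.two_le_k hL p3
    (p4 aHas (by decide) (by decide))
  rw [← hm₂] at hg
  obtain ⟨hkept, hhas, -⟩ := hg S₀
  rcases hkept with hk | ⟨comp, cen, X, hcand, hst⟩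
  · rw [hk] at hhas
    exact absurd hhas (by decide)
  have fr : ∀ a < 20, a ≠ 1 → m₂ a = m₁ a := fun a ha ha1 =>
    run_frame _ _ (wr_guessLoop (Or.inr ⟨ha, ha1⟩))
  obtain ⟨S, s1, s2⟩ := run_outputPhase (p3.congr fr)
    (by rw [fr _ (by decide) (by decide), p2.clusters]) hkn hn hst hcand hself
  refine ⟨S, by rw [hrun, s1], fun S' => ?_⟩
  -- The approximation bound needs a positive scale `R`, that is, a competitor of positive cost. A
  -- competitor of cost zero forces every solution to have cost zero.
  by_cases hpos : ∃ i v, S'.label v = i ∧ 0 < I.intDist (S'.center i) v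
  · have := (hg S').2.2 X hst.best hpos
    rw [S'.sum_classRadius] at this
    exact (Nat.mul_le_mul_left _ s2).trans this
  · rw [S.intCost_eq_zero S' (fun _ _ => Instance.intDist_eq_zero) fun i v hv => ?_]
    · simp
    · by_contra hne
      exact hpos ⟨i, v, hv, Nat.pos_of_ne_zero hne⟩

end ConnectedMSR

/-- For every `ε > 0` there are a program and a polynomial such that on every instance the program
halts in time polynomial in the encoding length, and, whenever the instance has a feasible solution,
outputs a feasible solution that costs at most `3 + ε` times as much as any feasible solution. -/
theorem mainTheorem2 (ε : ℝ) (hε : 0 < ε) :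
    ∃ (A : RAM.Program) (p : Polynomial ℕ), ∀ I : ConnectedMSR.Instance,
      ∃ (t : ℕ) (m : RAM.Memory),
        RAM.Exec A (RAM.input I.encode) t m ∧
        t ≤ p.eval (RAM.size I.encode) ∧
        (Nonempty (ConnectedMSR.Solution I.G I.k) →
          ∃ S : ConnectedMSR.Solution I.G I.k,
            RAM.output m = S.encode ∧
            ∀ S' : ConnectedMSR.Solution I.G I.k,
              ((S.cost I.d : ℚ≥0) : ℝ) ≤ (3 + ε) * ((S'.cost I.d : ℚ≥0) : ℝ)) := by
  -- With `C = L` the ratio `3 + 3 / L + 9 / C` is `3 + 12 / L`, which is at most `3 + ε`.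
  set L : ℕ := ⌈12 / ε⌉₊ + 1 with hL
  -- The time bound is formed in `ℕ[X]`, with the bounds of `cheap_algorithm` on loop counts and
  -- operand lengths as polynomials in the encoding length.
  refine ⟨(ConnectedMSR.algorithm L L).compile, (ConnectedMSR.algorithm L L).bound
    (R := Polynomial ℕ)
    (Polynomial.X * ((L : Polynomial ℕ) * Polynomial.X + Polynomial.X) + 1 + Polynomial.X)
    (4 * Polynomial.X + (L : Polynomial ℕ) * Polynomial.X + (L : Polynomial ℕ) + 6), fun I => ?_⟩
  obtain ⟨t, h1, h2⟩ := RAM.Cmd.exec_compile (ConnectedMSR.wf_algorithm L L)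
    (ConnectedMSR.cheap_algorithm (I := I) (L := L) (C := L) le_rfl le_rfl)
  refine ⟨t, _, h1, h2.trans_eq ?_, fun hne => ?_⟩
  · rw [← Polynomial.coe_evalRingHom, RAM.Cmd.map_bound]
    simp
  · obtain ⟨S, s1, s2⟩ := ConnectedMSR.run_algorithm (L := L) (C := L) (by omega) hne
    refine ⟨S, s1, fun S' => ?_⟩
    have h3 : ((L * L * S.intCost I.intDist : ℕ) : ℚ≥0) ≤
        ((3 * L * L + 3 * L + 9 * L) * S'.intCost I.intDist : ℕ) := Nat.cast_le.2 (s2 S')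
    push_cast [ConnectedMSR.Solution.intCost_cast] at h3
    rw [← mul_assoc, ← mul_assoc] at h3
    have h4 := le_of_mul_le_mul_right h3 (Nat.cast_pos.2 ConnectedMSR.Instance.denom_pos)
    have h5 : (L * L * (S.cost I.d : ℝ) : ℝ) ≤ (3 * L * L + 3 * L + 9 * L) * (S'.cost I.d : ℝ) := by
      exact_mod_cast h4
    have hLpos : (0 : ℝ) < L := by rw [hL]; positivity
    have hLε : 12 ≤ ε * L := by
      have h6 := Nat.le_ceil (12 / ε)
      rw [div_le_iff₀ hε] at h6
      rw [hL]
      push_cast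
      nlinarith
    have hc : (0 : ℝ) ≤ S'.cost I.d := by positivity
    have h7 : (L : ℝ) * (L * (S.cost I.d : ℝ)) ≤ L * (L * ((3 + ε) * (S'.cost I.d : ℝ))) := by
      have := mul_le_mul_of_nonneg_right hLε (mul_nonneg hLpos.le hc)
      nlinarith
    exact le_of_mul_le_mul_left (le_of_mul_le_mul_left h7 hLpos) hLpos
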